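/- **Theorem.** Let $m\ge 1$, let $n\ge 2$ be even, and let $K$ be a field of characteristic zero. Consider a system of $m$ linear equations $$\Delta_i\equiv y_i^{(n)}+A_2(x)\,y_i^{(n-2)}+\dots+A_n(x)\,y_i=0,\qquad i=1,\dots,m,$$ in the canonical class: it is obtained from $\mathbf w^{(n)}=0$ by a change of variables $x=f(z)$, $\mathbf y=f'(z)^{(n-1)/2}\,\mathbf w$ (locally around each point of the $x$-domain). Let $y''+q(x)y=0$ be its source equation, that is, the transform of $w''=0$ under $x=f(z)$, $y=f'(z)^{1/2}w$ with the same $f$, and let $u,v$ be solutions of the source equation with Wronskian $uv'-u'v=1$. All functions are either smooth functions over $K=\mathbb R$ or holomorphic functions over $K=\mathbb C$, the functions of $x$ being given on an open set $\Omega\subseteq K$ and the vector fields living on a non-empty connected open set $M\subseteq\Omega\times K^m$; or, over an arbitrary field $K$ of characteristic zero, formal power series in $x$ and $y_1-c_1,\dots,y_m-c_m$ for a point $c\in K^m$. Let $L_0=\frac12\sum_i y_i\Delta_i$. Let $\mathcal S_{var}$ be the set of vector fields $\mathbf v=\xi(x,\mathbf y)\partial_x+\sum_j\psi_j(x,\mathbf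 y)\partial_{y_j}$ that generate point symmetries of the system (the prolongation $\mathbf v^{(n)}$ applied to each $\Delta_i$ vanishes on $\Delta=0$) and satisfy $\mathbf v^{(n)}(L_0)+L_0D_x\xi=0$. Let $\mathfrak g_F$ be the span of $$F_p=v^2\partial_x+(n-1)vv'\sum_i y_i\partial_{y_i},\quad F_m=-u^2\partial_x-(n-1)uu'\sum_i y_i\partial_{y_i},\quad F_z=2uv\,\partial_x+(n-1)(uv'+u'v)\sum_i y_i\partial_{y_i},$$ let $\mathfrak{so}(m)$ be realized as the span of the rotations $y_i\partial_{y_j}-y_j\partial_{y_i}$, and let $\mathfrak g_S$ be the span of the $u^{n-1-k}v^k\,\partial_{y_j}$ ($0\le k\le n-1$, $1\le j\le m$). Then $\mathcal S_{var}$ is a Lie algebra under the bracket of vector fields, $\mathfrak g_F\cong\mathfrak{sl}_2$ and $\mathfrak{so}(m)$ are commuting subalgebras of it, and $$\mathcal S_{var}=\mathfrak g_F\oplus\mathfrak{so}(m),\qquad \dim\mathcal S_{var}=\tfrac12(m^2-m+6).$$ This Lie algebra is semisimple if $m\ne 2$. No non-zero element of $\mathfrak g_S$ is a variational symmetry. 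-/

import Mathlib

open scoped ContDiff

noncomputable section

namespace VarSym

/-! ## Coordinates, point vector fields, jets

The data needed to write the formulas of the jet calculus for one independent variable `x` and
`m` dependent variables `y_1, …, y_m`:
* `B` is the algebra of functions of `x`, with `d = d/dx`;
* `R` is the algebra of functions of `(x, y)`, with `dx = ∂/∂x`, `dy j = ∂/∂y_j` and the
  coordinate functions `y j`;
* `incl` regards a function of `x` as a function of `(x, y)`.
Only the two concrete instances `smoothCoords` and `formalCoords` constructed below are used. -/

structure Coords (K : Type*) [Field K] (m : ℕ) (B R : Type*) [CommRing B] [Algebra K B]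
    [CommRing R] [Algebra K R] where
  d : Derivation K B B
  incl : B →ₐ[K] R
  dx : Derivation K R R
  dy : Fin m → Derivation K R R
  y : Fin m → R

section Algebraic

variable {K : Type*} [Field K] {m : ℕ} {B R : Type*} [CommRing B] [Algebra K B]
  [CommRing R] [Algebra K R]

/-- The vector field `ξ ∂_x + ∑_j ψ_j ∂_{y_j}`. A vector field is identified with the derivation
of the algebra of functions that it defines; the Lie bracket is the commutator. -/
def vectorField (S : Coords K m B R) (ξ : R) (ψ : Fin m → R) : Derivation K R R :=
  ξ • S.dx + ∑ j, ψ j • S.dy j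

/-- Differential functions: polynomials in the derivatives of the dependent variables, with
functions of `(x, y)` as coefficients. The variable `(k, j)` is the jet coordinate
`y_j^{(k+1)}`. -/
abbrev DiffFun (m : ℕ) (R : Type*) [CommRing R] : Type _ := MvPolynomial (ℕ × Fin m) R

/-- The jet coordinate `y_j^{(k)}`, with `y_j^{(0)} = y_j`. -/
def jet (S : Coords K m B R) (j : Fin m) : ℕ → DiffFun m R
  | 0 => MvPolynomial.C (S.y j)
  | k + 1 => MvPolynomial.X (k, j)

/-- A vector field acting on the coefficients of a differential function, with the derivatives
`y_j^{(k)}`, `k ≥ 1`, held fixed. -/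
def onCoeffs (w : Derivation K R R) (P : DiffFun m R) : DiffFun m R :=
  ∑ a ∈ P.support, MvPolynomial.monomial a (w (P.coeff a))

/-- The total derivative `D_x = ∂_x + ∑_j ∑_k y_j^{(k+1)} ∂/∂y_j^{(k)}`. -/
def totalD (S : Coords K m B R) (P : DiffFun m R) : DiffFun m R :=
  onCoeffs S.dx P + ∑ j, jet S j 1 * onCoeffs (S.dy j) P +
    MvPolynomial.mkDerivation R (fun kj : ℕ × Fin m => jet S kj.2 (kj.1 + 2)) P

/-- The coefficients of the prolongation: `ψ_j^{(0)} = ψ_j` and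
`ψ_j^{(k+1)} = D_x ψ_j^{(k)} - y_j^{(k+1)} D_x ξ`. -/
def prolCoeff (S : Coords K m B R) (ξ : R) (ψ : Fin m → R) (j : Fin m) : ℕ → DiffFun m R
  | 0 => MvPolynomial.C (ψ j)
  | k + 1 => totalD S (prolCoeff S ξ ψ j k) - jet S j (k + 1) * totalD S (MvPolynomial.C ξ)

/-- The prolongation `ξ ∂_x + ∑_j ∑_k ψ_j^{(k)} ∂/∂y_j^{(k)}` of `ξ ∂_x + ∑_j ψ_j ∂_{y_j}`,
acting on differential functions. -/
def prolong (S : Coords K m B R) (ξ : R) (ψ : Fin m → R) (P : DiffFun m R) : DiffFun m R :=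
  onCoeffs (vectorField S ξ ψ) P +
    MvPolynomial.mkDerivation R (fun kj : ℕ × Fin m => prolCoeff S ξ ψ kj.2 (kj.1 + 1)) P

/-! ## The equations -/

/-- `Δ_i = y_i^{(n)} + A_2 y_i^{(n-2)} + ⋯ + A_n y_i`, the left-hand sides of the isotropic
system of order `n`. -/
def eqn (S : Coords K m B R) (n : ℕ) (A : ℕ → B) (i : Fin m) : DiffFun m R :=
  jet S i n + ∑ j ∈ Finset.Icc 2 n, MvPolynomial.C (S.incl (A j)) * jet S i (n - j)

/-- Restriction to `Δ = 0`: the derivatives `y_i^{(n)}` are replaced by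
`y_i^{(n)} - Δ_i = -(A_2 y_i^{(n-2)} + ⋯ + A_n y_i)`. -/
def onShell (S : Coords K m B R) (n : ℕ) (A : ℕ → B) : DiffFun m R →ₐ[R] DiffFun m R :=
  MvPolynomial.aeval (fun kj : ℕ × Fin m =>
    if kj.1 + 1 = n then jet S kj.2 n - eqn S n A kj.2 else MvPolynomial.X kj)

/-- The scalar equation `y^{(n)} + A_2 y^{(n-2)} + ⋯ + A_n y = 0` and the source equation
`y'' + q y = 0` are the transforms of `w^{(n)} = 0` and `w'' = 0` by the same change of variables
`z = ∫ dx / u²`, `w = u^{1-n} y` (resp. `w = u^{-1} y`), where `u` is an invertible solution of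
the source equation. This is `x = f(z)`, `y = f'(z)^{(n-1)/2} w` with `f'(z) = u²`, so that
`d/dz = u² d/dx`; the equation `w^{(n)} = 0` becomes `u^{n+1} (y^{(n)} + ⋯ + A_n y) = 0`. -/
def IsCanonicalTransform (d : Derivation K B B) (n : ℕ) (A : ℕ → B) (q : B) : Prop :=
  ∃ u : Bˣ, d (d (u : B)) + q * (u : B) = 0 ∧
    ∀ y : B, (fun g : B => (u : B) ^ 2 * d g)^[n] (((u⁻¹ : Bˣ) : B) ^ (n - 1) * y) =
      (u : B) ^ (n + 1) * (d^[n] y + ∑ j ∈ Finset.Icc 2 n, A j * d^[n - j] y)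

/-- `u` and `v` are solutions of the source equation `y'' + q y = 0`, with Wronskian one. -/
def IsNormalizedBasis (d : Derivation K B B) (q u v : B) : Prop :=
  d (d u) + q * u = 0 ∧ d (d v) + q * v = 0 ∧ u * d v - d u * v = 1

/-! ## Symmetries -/

/-- The infinitesimal criterion: the prolongation of `ξ ∂_x + ∑_j ψ_j ∂_{y_j}`, applied to `Δ_i`,
vanishes on `Δ = 0`. -/
def IsPointSymmetry (S : Coords K m B R) (n : ℕ) (A : ℕ → B) (ξ : R) (ψ : Fin m → R) : Prop :=
  ∀ i, onShell S n A (prolong S ξ ψ (eqn S n A i)) = 0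

/-- The Lagrangian `L₀ = ½ y · Δ`. -/
def lagrangian (S : Coords K m B R) (n : ℕ) (A : ℕ → B) : DiffFun m R :=
  (1 / 2 : K) • ∑ i, jet S i 0 * eqn S n A i

/-- `v^{(n)}(L) + L D_x ξ` for `v = ξ ∂_x + ∑_j ψ_j ∂_{y_j}`. -/
def varExpr (S : Coords K m B R) (L : DiffFun m R) (ξ : R) (ψ : Fin m → R) : DiffFun m R :=
  prolong S ξ ψ L + L * totalD S (MvPolynomial.C ξ)

/-- The set of variational symmetries of the system `Δ = 0` with respect to `L₀`: the generators
`v` of point symmetries of the system with `v^{(n)}(L₀) + L₀ D_x ξ = 0`. -/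
def variationalSymmetries (S : Coords K m B R) (n : ℕ) (A : ℕ → B) : Set (Derivation K R R) :=
  {w | ∃ (ξ : R) (ψ : Fin m → R), w = vectorField S ξ ψ ∧ IsPointSymmetry S n A ξ ψ ∧
    varExpr S (lagrangian S n A) ξ ψ = 0}

/-- `F_p = v² ∂_x + (n-1) v v' ∑ y_i ∂_i`. -/
def Fp (S : Coords K m B R) (n : ℕ) (v : B) : Derivation K R R :=
  vectorField S (S.incl (v ^ 2)) fun i => ((n : R) - 1) * S.incl (v * S.d v) * S.y i

/-- `F_m = -u² ∂_x - (n-1) u u' ∑ y_i ∂_i`. -/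
def Fm (S : Coords K m B R) (n : ℕ) (u : B) : Derivation K R R :=
  vectorField S (-S.incl (u ^ 2)) fun i => -(((n : R) - 1) * S.incl (u * S.d u) * S.y i)

/-- `F_z = 2 u v ∂_x + (n-1) (u v' + u' v) ∑ y_i ∂_i`. -/
def Fz (S : Coords K m B R) (n : ℕ) (u v : B) : Derivation K R R :=
  vectorField S (2 * S.incl (u * v)) fun i =>
    ((n : R) - 1) * S.incl (u * S.d v + S.d u * v) * S.y i

/-- `𝔤_F`, spanned by `F_p`, `F_m`, `F_z`. -/
def gF (S : Coords K m B R) (n : ℕ) (u v : B) : Submodule K (Derivation K R R) :=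
  Submodule.span K {Fp S n v, Fm S n u, Fz S n u v}

/-- The rotation `R_ij = H_ij - H_ji = y_i ∂_j - y_j ∂_i`. -/
def rotation (S : Coords K m B R) (i j : Fin m) : Derivation K R R :=
  S.y i • S.dy j - S.y j • S.dy i

/-- The span of the rotations `R_ij`. -/
def gRot (S : Coords K m B R) : Submodule K (Derivation K R R) :=
  Submodule.span K (Set.range fun p : Fin m × Fin m => rotation S p.1 p.2)

/-- `𝔤_S`, spanned by the `S_kj = u^{n-1-k} v^k ∂_j`, `0 ≤ k ≤ n - 1`. -/
def gS (S : Coords K m B R) (n : ℕ) (u v : B) : Submodule K (Derivation K R R) :=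
  Submodule.span K (Set.range fun p : Fin n × Fin m =>
    S.incl (u ^ (n - 1 - (p.1 : ℕ)) * v ^ (p.1 : ℕ)) • S.dy p.2)

/-- The set `𝒮_var` of variational symmetries is a Lie algebra, the (internal) direct sum of its
commuting subalgebras `𝔤_F ≅ 𝔰𝔩₂` and `𝔰𝔬(m)`, the latter spanned by the rotations. It has dimension
`(m² - m + 6) / 2`, it is semisimple unless `m = 2` (where `𝔰𝔬(2)` is abelian), and zero is the
only element of `𝔤_S` that is a variational symmetry. -/
def VariationalAlgebraDecomposes (S : Coords K m B R) (n : ℕ) (A : ℕ → B) (u v : B) : Prop :=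
  ∃ sVar sF sRot : LieSubalgebra K (Derivation K R R),
    (sVar : Set (Derivation K R R)) = variationalSymmetries S n A ∧
    sF.toSubmodule = gF S n u v ∧
    sRot.toSubmodule = gRot S ∧
    (∀ a ∈ sF, ∀ b ∈ sRot, ⁅a, b⁆ = 0) ∧
    Disjoint sF.toSubmodule sRot.toSubmodule ∧
    sF.toSubmodule ⊔ sRot.toSubmodule = sVar.toSubmodule ∧
    Nonempty (sF ≃ₗ⁅K⁆ LieAlgebra.SpecialLinear.sl (Fin 2) K) ∧
    Nonempty (sRot ≃ₗ⁅K⁆ LieAlgebra.Orthogonal.so (Fin m) K) ∧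
    Module.Finite K sVar ∧
    (Module.finrank K sVar : ℚ) = ((m : ℚ) ^ 2 - m + 6) / 2 ∧
    (m ≠ 2 → LieAlgebra.IsSemisimple K sVar) ∧
    ∀ w ∈ gS S n u v, w ∈ variationalSymmetries S n A → w = 0

end Algebraic

/-! ## Smooth functions over `ℝ` or `ℂ` -/

section Smooth

variable {𝕜 : Type*} [RCLike 𝕜] {E E' : Type*} [NormedAddCommGroup E] [NormedSpace 𝕜 E]
  [NormedAddCommGroup E'] [NormedSpace 𝕜 E']

/-- The algebra of smooth functions on the open set `U` (for `𝕜 = ℂ`: holomorphic functions). -/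
def smoothFn (U : TopologicalSpace.Opens E) : Subalgebra 𝕜 (U → 𝕜) where
  carrier := {f | ∃ g : E → 𝕜, ContDiffOn 𝕜 ∞ g U ∧ ∀ p : U, f p = g p}
  mul_mem' := by
    rintro a b ⟨g, hg, hag⟩ ⟨h, hh, hbh⟩
    exact ⟨fun p => g p * h p, hg.mul hh, fun p => by simp [hag, hbh]⟩
  add_mem' := by
    rintro a b ⟨g, hg, hag⟩ ⟨h, hh, hbh⟩
    exact ⟨fun p => g p + h p, hg.add hh, fun p => by simp [hag, hbh]⟩
  algebraMap_mem' r := ⟨fun _ => r, contDiffOn_const, fun _ => rfl⟩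

/-- Extension by zero to the whole space. -/
def extend {U : TopologicalSpace.Opens E} (f : U → 𝕜) : E → 𝕜 :=
  Function.extend Subtype.val f 0

theorem extend_apply {U : TopologicalSpace.Opens E} (f : U → 𝕜) (p : U) :
    extend f (p : E) = f p :=
  Subtype.val_injective.extend_apply f 0 p

theorem contDiffOn_extend {U : TopologicalSpace.Opens E} (f : smoothFn (𝕜 := 𝕜) U) :
    ContDiffOn 𝕜 ∞ (extend (f : U → 𝕜)) U := by
  obtain ⟨f, g, hg, hfg⟩ := f
  exact hg.congr fun p hp => (extend_apply f ⟨p, hp⟩).trans (hfg ⟨p, hp⟩)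

theorem differentiableAt_extend {U : TopologicalSpace.Opens E} (f : smoothFn (𝕜 := 𝕜) U)
    (p : U) : DifferentiableAt 𝕜 (extend (f : U → 𝕜)) p :=
  ((contDiffOn_extend f).contDiffAt (U.isOpen.mem_nhds p.2)).differentiableAt (by simp)

theorem extend_add_eq {U : TopologicalSpace.Opens E} (f g : U → 𝕜) (p : U) :
    extend (f + g) =ᶠ[nhds (p : E)] extend f + extend g := by
  filter_upwards [U.isOpen.mem_nhds p.2] with r hr
  have h := fun k : U → 𝕜 => extend_apply k ⟨r, hr⟩
  simp only [Pi.add_apply] at h ⊢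
  rw [h, h, h, Pi.add_apply]

theorem extend_mul_eq {U : TopologicalSpace.Opens E} (f g : U → 𝕜) (p : U) :
    extend (f * g) =ᶠ[nhds (p : E)] extend f * extend g := by
  filter_upwards [U.isOpen.mem_nhds p.2] with r hr
  have h := fun k : U → 𝕜 => extend_apply k ⟨r, hr⟩
  simp only [Pi.mul_apply] at h ⊢
  rw [h, h, h, Pi.mul_apply]

theorem extend_smul_eq {U : TopologicalSpace.Opens E} (c : 𝕜) (f : U → 𝕜) (p : U) :
    extend (c • f) =ᶠ[nhds (p : E)] c • extend f := by
  filter_upwards [U.isOpen.mem_nhds p.2] with r hr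
  have h := fun k : U → 𝕜 => extend_apply k ⟨r, hr⟩
  simp only [Pi.smul_apply] at h ⊢
  rw [h, h, Pi.smul_apply]

/-- The derivative in the constant direction `e`, as a derivation of the algebra of smooth
functions. -/
def dirDeriv (U : TopologicalSpace.Opens E) (e : E) :
    Derivation 𝕜 (smoothFn (𝕜 := 𝕜) U) (smoothFn (𝕜 := 𝕜) U) :=
  Derivation.mk'
    { toFun := fun f => ⟨fun p => fderiv 𝕜 (extend (f : U → 𝕜)) p e,
        fun p => fderiv 𝕜 (extend (f : U → 𝕜)) p e,
        ((contDiffOn_extend f).fderiv_of_isOpen U.isOpen (by simp)).clm_apply contDiffOn_const,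
        fun _ => rfl⟩
      map_add' := fun f g => by
        ext p
        change fderiv 𝕜 (extend ((f : U → 𝕜) + (g : U → 𝕜))) p e = _
        rw [(extend_add_eq _ _ p).fderiv_eq,
          fderiv_add (differentiableAt_extend f p) (differentiableAt_extend g p)]
        rfl
      map_smul' := fun c f => by
        ext p
        change fderiv 𝕜 (extend (c • (f : U → 𝕜))) p e = _
        rw [(extend_smul_eq _ _ p).fderiv_eq, fderiv_const_smul (differentiableAt_extend f p)]
        rfl }
    (fun f g => by
      ext p
      change fderiv 𝕜 (extend ((f : U → 𝕜) * (g : U → 𝕜))) p e = _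
      rw [(extend_mul_eq _ _ p).fderiv_eq,
        fderiv_mul (differentiableAt_extend f p) (differentiableAt_extend g p),
        extend_apply, extend_apply]
      rfl)

/-- Composition with a continuous linear map that maps `U` into `V`. -/
def pullback (T : E →L[𝕜] E') (U : TopologicalSpace.Opens E) (V : TopologicalSpace.Opens E')
    (h : ∀ p ∈ U, T p ∈ V) : smoothFn (𝕜 := 𝕜) V →ₐ[𝕜] smoothFn (𝕜 := 𝕜) U where
  toFun f := ⟨fun p => (f : V → 𝕜) ⟨T p, h p p.2⟩, by
    obtain ⟨f, g, hg, hfg⟩ := f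
    exact ⟨fun p => g (T p), hg.comp T.contDiff.contDiffOn h, fun p => hfg ⟨T p, h p p.2⟩⟩⟩
  map_one' := rfl
  map_mul' _ _ := rfl
  map_zero' := rfl
  map_add' _ _ := rfl
  commutes' _ := rfl

/-- The coordinates `(x, y)` on the open set `M ⊆ Ω × 𝕜^m`, with smooth functions. -/
def smoothCoords (m : ℕ) (Ω : TopologicalSpace.Opens 𝕜)
    (M : TopologicalSpace.Opens (𝕜 × (Fin m → 𝕜))) (hM : ∀ p ∈ M, p.1 ∈ Ω) :
    Coords 𝕜 m (smoothFn (𝕜 := 𝕜) Ω) (smoothFn (𝕜 := 𝕜) M) where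
  d := dirDeriv Ω 1
  incl := pullback (ContinuousLinearMap.fst 𝕜 𝕜 (Fin m → 𝕜)) M Ω hM
  dx := dirDeriv M (1, 0)
  dy j := dirDeriv M (0, Pi.single j 1)
  y j := ⟨fun p => p.1.2 j, fun p => p.2 j, by fun_prop, fun _ => rfl⟩

/-- Around every point of `Ω`, the equation `y^{(n)} + A_2 y^{(n-2)} + ⋯ + A_n y = 0`, with source
equation `y'' + q y = 0`, is a transform of the equation `w^{(n)} = 0`. -/
def IsCanonicalSmooth (Ω : TopologicalSpace.Opens 𝕜) (n : ℕ)
    (A : ℕ → smoothFn (𝕜 := 𝕜) Ω) (q : smoothFn (𝕜 := 𝕜) Ω) : Prop :=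
  ∀ x ∈ Ω, ∃ (U : TopologicalSpace.Opens 𝕜) (hU : ∀ t ∈ U, t ∈ Ω), x ∈ U ∧
    IsCanonicalTransform (dirDeriv U (1 : 𝕜)) n
      (fun j => pullback (ContinuousLinearMap.id 𝕜 𝕜) U Ω hU (A j))
      (pullback (ContinuousLinearMap.id 𝕜 𝕜) U Ω hU q)

end Smooth

/-! ## Formal power series over an arbitrary field -/

section Formal

variable {K : Type*} [Field K]

/-- The coordinates `(x, y)` on the formal neighbourhood of the point `(0, c)`: functions are
formal power series in `x` and `y_1 - c_1, …, y_m - c_m`. -/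
def formalCoords {m : ℕ} (c : Fin m → K) :
    Coords K m (PowerSeries K) (MvPowerSeries (Option (Fin m)) K) where
  d := PowerSeries.derivative K
  incl := MvPowerSeries.rename (fun _ : Unit => (none : Option (Fin m)))
  dx := MvPowerSeries.pderiv K none
  dy j := MvPowerSeries.pderiv K (some j)
  y j := MvPowerSeries.C (c j) + MvPowerSeries.X (some j)

end Formal

end VarSym

end

/-! Let `L = d^n + A_2 d^(n-2) + ... + A_n`, and write `'` for the derivative in `x`, `∂_j` for the
derivative in `y_j`.

Necessity. The condition `v^{(n)}(L₀) + L₀ D_x ξ = 0` is a polynomial identity in the derivatives of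
`y`, and its highest coefficients determine `v`. The coefficient of `y_j^{(n)}` gives `∂_j ξ = 0`
and `ψ_j + ∑ y_i ∂_j ψ_i = (n-1) y_j ξ'` (`linear_relation`). Together with that of `y_j^{(n-1)}` it
shows that the `y`-gradient of `ψ` is skew up to a multiple of the identity. Symmetry of second
derivatives then makes `ψ` affine in `y`, and `ψ_j = (n-1)/2 ξ' y_j + ∑ Ω_ij y_i` with a constant
skew matrix `Ω` (`exists_skew_matrix`). The coefficient of `y_j^{(n-2)}` (for `n = 2`, the terms
free of derivatives) and `6 A_2 = n(n²-1) q` give `ξ''' + 4 q ξ' + 2 q' ξ = 0` (`xi_equation`). This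
is the symmetric square of the source equation, so `ξ` is a combination of `u²`, `uv`, `v²`
(`exists_quadratic`).

Sufficiency. In the coordinate `z` the operator `L` becomes `(d/dz)^n`, and a solution `ξ` of the
third-order equation becomes a field `η ∂_z` with `η` quadratic in `z`, an infinitesimal Möbius
transformation. Such fields intertwine `(d/dz)^n`, acting from densities of weight `-(n-1)/2` to
densities of weight `(n+1)/2` (`IsCanonicalTransform.intertwine`). An identity of operators on
functions of `x` is an identity of symbols, hence holds for jets as well (`jetOp_intertwine`). It
follows that `v^{(n)}(Δ_j) = -(n+1)/2 ξ' Δ_j + ∑ Ω_ij Δ_i` (`two_mul_prolong_eqn`), from which both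
defining conditions can be read off.

Structure. The pair (quadratic form in `u, v`; matrix `Ω`) parametrizes the symmetries by an
injective homomorphism from `𝔰𝔩₂ × 𝔰𝔬(m)` (`symmetryHom`, `range_symmetryHom`). Dimension and
semisimplicity follow, the latter from the Killing forms `4 tr(xy)` and `(m-2) tr(xy)`. An element
of `𝔤_S` has `ξ = 0` and `ψ` independent of `y`, so `linear_relation` forces `ψ = 0`.

The argument is carried out for any coordinates that are `Regular` and any equation that is an
`IsSymmetricPower`; the smooth and the formal setting only enter in verifying these two properties.
-/

open scoped ContDiff

noncomputable section

namespace VarSym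

/-! ### Symbols of linear differential operators in `x` -/

section Symbols

open Polynomial

variable {K B S : Type*} [Field K] [CommRing B] [Algebra K B] [CommRing S] [Algebra K S]

/-- Composition with `d` on the left, on symbols of differential operators: the symbol `∑ a_k X^k`
stands for `∑ a_k d^k`. -/
def symbolD (d : Derivation K B B) : B[X] →+ B[X] :=
  AddMonoidHom.mk' (fun p => p.sum fun k a => monomial k (d a) + monomial (k + 1) a) fun p q => by
    refine sum_add_index p q _ (by simp) fun k a b => ?_
    simp only [map_add]
    abel

theorem symbolD_monomial (d : Derivation K B B) (k : ℕ) (a : B) :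
    symbolD d (monomial k a) = monomial k (d a) + monomial (k + 1) a :=
  sum_monomial_index a (fun k a => monomial k (d a) + monomial (k + 1) a) (by simp)

theorem coeff_symbolD_zero (d : Derivation K B B) (p : B[X]) :
    (symbolD d p).coeff 0 = d (p.coeff 0) := by
  induction p using Polynomial.induction_on' with
  | add p q hp hq => simp [hp, hq]
  | monomial k a =>
    rw [symbolD_monomial]
    rcases k with _ | k <;> simp [coeff_monomial]

theorem coeff_symbolD_succ (d : Derivation K B B) (p : B[X]) (j : ℕ) :
    (symbolD d p).coeff (j + 1) = d (p.coeff (j + 1)) + p.coeff j := by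
  induction p using Polynomial.induction_on' with
  | add p q hp hq => simp only [map_add, coeff_add, hp, hq]; abel
  | monomial k a =>
    rw [symbolD_monomial]
    simp only [coeff_add, coeff_monomial, Nat.add_right_cancel_iff]
    split_ifs <;> simp

/-- The value `∑ φ(a_k) s_k` of the symbol `∑ a_k X^k`. -/
def symbolEval (φ : B →+* S) (s : ℕ → S) : B[X] →+ S :=
  AddMonoidHom.mk' (fun p => p.sum fun k a => φ a * s k) fun p q => by
    refine sum_add_index p q _ (by simp) fun k a b => ?_
    simp only [map_add, add_mul]

theorem symbolEval_monomial (φ : B →+* S) (s : ℕ → S) (k : ℕ) (a : B) :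
    symbolEval φ s (monomial k a) = φ a * s k :=
  sum_monomial_index a (fun k a => φ a * s k) (by simp)

theorem symbolEval_C_mul (φ : B →+* S) (s : ℕ → S) (b : B) (p : B[X]) :
    symbolEval φ s (C b * p) = φ b * symbolEval φ s p := by
  induction p using Polynomial.induction_on' with
  | add p q hp hq => simp only [mul_add, map_add, hp, hq]
  | monomial k a => rw [C_mul_monomial, symbolEval_monomial, symbolEval_monomial, map_mul, mul_assoc]

/-- Used twice: with `φ = id` and `s_k = d^k y`, where symbols act on functions of `x`, and with `φ
= C ∘ incl` and `s_k = y_i^{(k)}`, where they become differential functions. -/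
theorem symbolEval_symbolD (φ : B →+* S) (s : ℕ → S) (d : Derivation K B B)
    (D : Derivation K S S) (hφ : ∀ b, D (φ b) = φ (d b)) (hs : ∀ k, D (s k) = s (k + 1))
    (p : B[X]) : symbolEval φ s (symbolD d p) = D (symbolEval φ s p) := by
  induction p using Polynomial.induction_on' with
  | add p q hp hq => simp only [map_add, hp, hq]
  | monomial k a =>
    rw [symbolD_monomial, map_add]
    simp only [symbolEval_monomial, Derivation.leibniz, smul_eq_mul, hφ, hs]
    ring

theorem symbolEval_symbolD_iterate (φ : B →+* S) (s : ℕ → S) (d : Derivation K B B)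
    (D : Derivation K S S) (hφ : ∀ b, D (φ b) = φ (d b)) (hs : ∀ k, D (s k) = s (k + 1))
    (n : ℕ) (p : B[X]) : symbolEval φ s ((symbolD d)^[n] p) = D^[n] (symbolEval φ s p) := by
  induction n with
  | zero => rfl
  | succ n ih =>
    rw [Function.iterate_succ_apply', Function.iterate_succ_apply',
      symbolEval_symbolD φ s d D hφ hs, ih]

theorem iterate_derivation_pow {d : Derivation K B B} {t : B} (ht : d t = 1) (k : ℕ) :
    d^[k] (t ^ k) = (k.factorial : B) ∧ ∀ j, d^[k + 1 + j] (t ^ k) = 0 := by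
  have key : ∀ k, d^[k] (t ^ k) = (k.factorial : B) := by
    intro k
    induction k with
    | zero => simp
    | succ k ih =>
      have h : ∀ (c : ℕ) (f : B) (j : ℕ), d^[j] ((c : B) * f) = c * d^[j] f := by
        intro c f j
        induction j with
        | zero => rfl
        | succ j hj => rw [Function.iterate_succ_apply', Function.iterate_succ_apply', hj]; simp
      rw [Function.iterate_succ_apply, Derivation.leibniz_pow, ht]
      simp only [nsmul_eq_mul, smul_eq_mul, mul_one, Nat.add_sub_cancel]
      rw [h, ih, Nat.factorial_succ]
      push_cast
      ring
  refine ⟨key k, fun j => ?_⟩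
  have h0 : ∀ j, d^[j] (0 : B) = 0 := fun j => iterate_map_zero d j
  rw [show k + 1 + j = j + (1 + k) by ring, Function.iterate_add_apply, Function.iterate_add_apply,
    key]
  simp [h0]

/-- Test on `t^k`: the terms of order above `k` vanish, those of order below `k` are zero by
induction, and the remaining one is `k!` times the `k`-th coefficient. -/
theorem symbol_eq_zero [CharZero K] {d : Derivation K B B} {t : B} (ht : d t = 1) (p : B[X])
    (h : ∀ y, symbolEval (RingHom.id B) (fun k => d^[k] y) p = 0) : p = 0 := by
  ext k
  induction k using Nat.strong_induction_on with
  | _ k ih =>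
    have hk := h (t ^ k)
    change p.sum (fun j a => a * d^[j] (t ^ k)) = 0 at hk
    rw [Polynomial.sum_def, Finset.sum_eq_single k] at hk
    · rw [(iterate_derivation_pow ht k).1] at hk
      have hu : IsUnit ((k.factorial : B)) := by
        rw [← map_natCast (algebraMap K B)]
        exact (IsUnit.mk0 _ (Nat.cast_ne_zero.2 k.factorial_ne_zero)).map _
      simpa using hu.mul_left_eq_zero.1 hk
    · intro j _ hjk
      rcases lt_or_gt_of_ne hjk with hj | hj
      · rw [ih j hj]; simp
      · obtain ⟨l, rfl⟩ := Nat.exists_eq_add_of_lt hj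
        rw [show k + l + 1 = k + 1 + l by ring, (iterate_derivation_pow ht k).2, mul_zero]
    · intro hk'
      rw [notMem_support_iff.1 hk', zero_mul]

/-- This turns identities checked on all functions of `x` into formal ones, which can then be
compared coefficientwise or evaluated on jets. -/
theorem symbol_ext [CharZero K] {d : Derivation K B B} {t : B} (ht : d t = 1) {p q : B[X]}
    (h : ∀ y, symbolEval (RingHom.id B) (fun k => d^[k] y) p =
      symbolEval (RingHom.id B) (fun k => d^[k] y) q) : p = q :=
  sub_eq_zero.1 <| symbol_eq_zero ht _ fun y => by rw [map_sub, h, sub_self]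

end Symbols

/-! ### Scalar operators in the canonical class -/

section ScalarOperators

variable {K B : Type*} [Field K] [CommRing B] [Algebra K B]

/-- The scalar operator `y ↦ y^{(n)} + A_2 y^{(n-2)} + ⋯ + A_n y`. -/
def scalarOp (d : Derivation K B B) (n : ℕ) (A : ℕ → B) (y : B) : B :=
  d^[n] y + ∑ j ∈ Finset.Icc 2 n, A j * d^[n - j] y

/-- The two consequences of canonicity on which the symmetry analysis rests. -/
structure IsSymmetricPower (d : Derivation K B B) (n : ℕ) (A : ℕ → B) (q : B) : Prop where
  second_coeff : 6 * A 2 = (n : B) * (n - 1) * (n + 1) * q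
  intertwine : ∀ ξ, d (d (d ξ)) + 4 * q * d ξ + 2 * d q * ξ = 0 → ∀ y,
    scalarOp d n A (2 * (ξ * d y) - ((n : B) - 1) * (d ξ * y)) =
      2 * (ξ * d (scalarOp d n A y)) + ((n : B) + 1) * (d ξ * scalarOp d n A y)

theorem derivation_inv {d : Derivation K B B} (u : Bˣ) :
    d ((u⁻¹ : Bˣ) : B) = -(((u⁻¹ : Bˣ) : B) * (((u⁻¹ : Bˣ) : B) * d u)) := by
  have h : d ((u : B) * ((u⁻¹ : Bˣ) : B)) = 0 := by simp
  rw [Derivation.leibniz, smul_eq_mul, smul_eq_mul] at h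
  have h1 : ((u⁻¹ : Bˣ) : B) * u = 1 := by simp
  linear_combination ((u⁻¹ : Bˣ) : B) * h - d ((u⁻¹ : Bˣ) : B) * h1

theorem derivation_inv_pow {d : Derivation K B B} (u : Bˣ) (s : ℕ) :
    d (((u⁻¹ : Bˣ) : B) ^ s) = -(s * (((u⁻¹ : Bˣ) : B) * d u) * ((u⁻¹ : Bˣ) : B) ^ s) := by
  induction s with
  | zero => simp
  | succ s ih =>
    rw [pow_succ, Derivation.leibniz, ih, derivation_inv]
    simp only [smul_eq_mul]
    push_cast
    ring

/-- The Riccati equation for `p = u'/u`: all derivatives of `u` become expressions in `u`, `p`, `q`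
and derivatives of `q`. -/
theorem derivation_logDeriv {d : Derivation K B B} (u : Bˣ) {q : B}
    (hu : d (d (u : B)) + q * u = 0) :
    d (((u⁻¹ : Bˣ) : B) * d u) = -q - (((u⁻¹ : Bˣ) : B) * d u) ^ 2 := by
  have h1 : ((u⁻¹ : Bˣ) : B) * u = 1 := by simp
  rw [Derivation.leibniz, derivation_inv]
  simp only [smul_eq_mul]
  linear_combination ((u⁻¹ : Bˣ) : B) * hu - q * h1

/-- The Leibniz expansion stops at `δ² η`. At `k = s` the last term drops out and the middle
coefficient becomes `s + 2`; with `s = n - 1` this is exactly the intertwining of `δ^n`. -/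
theorem iterate_quadratic_field {δ : Derivation K B B} {η : B} (hη : δ (δ (δ η)) = 0) (s : ℕ)
    (g : B) (k : ℕ) :
    δ^[k + 1] (2 * (η * δ g) - s * (δ η * g)) =
      2 * (η * δ^[k + 2] g) + (2 * (k + 1) - s) * (δ η * δ^[k + 1] g) +
        (k + 1) * (k - s) * (δ (δ η) * δ^[k] g) := by
  have h2 : δ (2 : B) = 0 := by exact_mod_cast δ.map_natCast 2
  induction k with
  | zero =>
    simp only [Function.iterate_succ_apply', Function.iterate_zero_apply, zero_add, map_sub,
      Derivation.leibniz, smul_eq_mul, Derivation.map_natCast, h2]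
    push_cast
    ring
  | succ k ih =>
    rw [Function.iterate_succ_apply', ih]
    simp only [Function.iterate_succ_apply', map_sub, map_add, Derivation.map_one_eq_zero,
      Derivation.leibniz, smul_eq_mul, Derivation.map_natCast, h2, hη]
    push_cast
    ring

variable {d : Derivation K B B} {n : ℕ} {A : ℕ → B} {q : B}

/-- Conjugation by `u^(1-n)` and passage to `δ = d/dz` turn the claim into `iterate_quadratic_field`
at `k = s = n - 1`. -/
theorem IsCanonicalTransform.intertwine (hn : 1 ≤ n) (h : IsCanonicalTransform d n A q) {ξ : B}
    (hξ : d (d (d ξ)) + 4 * q * d ξ + 2 * d q * ξ = 0) (y : B) :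
    scalarOp d n A (2 * (ξ * d y) - ((n : B) - 1) * (d ξ * y)) =
      2 * (ξ * d (scalarOp d n A y)) + ((n : B) + 1) * (d ξ * scalarOp d n A y) := by
  obtain ⟨u, hu, hL⟩ := h
  obtain ⟨s, rfl⟩ : ∃ s, n = s + 1 := ⟨n - 1, by omega⟩
  rw [Nat.add_sub_cancel] at hL
  change ∀ y, _ = _ * scalarOp d (s + 1) A y at hL
  set L := scalarOp d (s + 1) A
  set w : B := ((u⁻¹ : Bˣ) : B) with hw
  have huw : (u : B) * w = 1 := by simp [hw]
  set p : B := w * d u with hp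
  have hdp : d p = -q - p ^ 2 := derivation_logDeriv u hu
  have hdu : d (u : B) = u * p := by linear_combination -d (u : B) * huw
  have hdw : d w = -(w * p) := derivation_inv u
  have hdws : d (w ^ s) = -(s * p * w ^ s) := derivation_inv_pow u s
  have h2 : d (2 : B) = 0 := by exact_mod_cast d.map_natCast 2
  -- `δ` is `d/dz`, and `η = u⁻² ξ` below is the component of the field `ξ ∂_x` along `∂_z`.
  set δ : Derivation K B B := (u : B) ^ 2 • d with hδ
  have δ_apply : ∀ g, δ g = (u : B) ^ 2 * d g := fun g => rfl
  have hfun : (fun g : B => (u : B) ^ 2 * d g) = δ := rfl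
  rw [hfun] at hL
  set η := w ^ 2 * ξ with hη
  have hu2 : (u : B) ^ 2 * w ^ 2 = 1 := by rw [← mul_pow, huw, one_pow]
  have hη1 : δ η = d ξ - 2 * p * ξ := by
    rw [δ_apply, hη, Derivation.leibniz, Derivation.leibniz_pow, hdw]
    simp only [smul_eq_mul, nsmul_eq_mul]
    push_cast
    linear_combination (d ξ - 2 * p * ξ) * hu2
  -- `δ³ η` is `u⁴` times the left-hand side of the third-order equation: `ξ` solves that equation
  -- exactly when `η` is quadratic in `z`.
  have hη3 : δ (δ (δ η)) = 0 := by
    rw [hη1]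
    simp only [δ_apply, map_sub, map_add, Derivation.leibniz, Derivation.leibniz_pow, hdp, hdu, h2,
      smul_eq_mul, nsmul_eq_mul]
    push_cast
    simp only [map_zero, map_neg]
    linear_combination (u : B) ^ 4 * hξ
  set g := w ^ s * y with hg
  have hconj : w ^ s * (2 * (ξ * d y) - (((s + 1 : ℕ) : B) - 1) * (d ξ * y)) =
      2 * (η * δ g) - s * (δ η * g) := by
    rw [hη1, δ_apply, hg, Derivation.leibniz, hdws, hη]
    simp only [smul_eq_mul]
    push_cast
    linear_combination -(2 * ξ * w ^ s * (d y - s * p * y)) * hu2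
  have hfin : (u : B) ^ (s + 1 + 1) * L (2 * (ξ * d y) - (((s + 1 : ℕ) : B) - 1) * (d ξ * y)) =
      (u : B) ^ (s + 1 + 1) * (2 * (ξ * d (L y)) + (((s + 1 : ℕ) : B) + 1) * (d ξ * L y)) := by
    rw [← hL, hconj, iterate_quadratic_field hη3, show δ^[s + 2] g = δ (δ^[s + 1] g) from
      Function.iterate_succ_apply' _ _ _, hL, hη1, δ_apply, Derivation.leibniz,
      Derivation.leibniz_pow, hdu, hη]
    simp only [smul_eq_mul, nsmul_eq_mul, Nat.add_sub_cancel]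
    push_cast
    linear_combination (2 * (u : B) ^ (s + 2) * ξ * (d (L y) + (s + 2) * p * L y)) * hu2
  exact (u.isUnit.pow (s + 1 + 1)).mul_left_cancel hfin

-- Expands `(u² d)^n ∘ u^(1-n)` down to order `n - 2` and compares with `u^(n+1) L`.
open Polynomial in
theorem IsCanonicalTransform.second_coeff [CharZero K] (hn : 2 ≤ n) {t : B} (ht : d t = 1)
    (h : IsCanonicalTransform d n A q) : 6 * A 2 = (n : B) * (n - 1) * (n + 1) * q := by
  obtain ⟨u, hu, hL⟩ := h
  obtain ⟨s, rfl⟩ : ∃ s, n = s + 2 := ⟨n - 2, by omega⟩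
  rw [show s + 2 - 1 = s + 1 by omega] at hL
  set w : B := ((u⁻¹ : Bˣ) : B) with hw
  have huw : (u : B) * w = 1 := by simp [hw]
  set p : B := w * d u with hp
  have hdp : d p = -q - p ^ 2 := derivation_logDeriv u hu
  have hdu : d (u : B) = u * p := by linear_combination -d (u : B) * huw
  have hdws : d (w ^ (s + 1)) = -((s + 1 : ℕ) * p * w ^ (s + 1)) := derivation_inv_pow u (s + 1)
  -- `(u² d)^k ∘ w^{s+1} = u^{2k} w^{s+1} ∘ G k`
  obtain ⟨G, G0, Gs⟩ : ∃ G : ℕ → B[X], G 0 = 1 ∧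
      ∀ k, G (k + 1) = symbolD d (G k) + C ((2 * (k : B) - (s + 1)) * p) * G k :=
    ⟨fun k => k.rec 1 fun k P => symbolD d P + C ((2 * (k : B) - (s + 1)) * p) * P, rfl,
      fun _ => rfl⟩
  have hG : ∀ k y, (fun g : B => (u : B) ^ 2 * d g)^[k] (w ^ (s + 1) * y) =
      (u : B) ^ (2 * k) * w ^ (s + 1) * symbolEval (RingHom.id B) (fun k => d^[k] y) (G k) := by
    intro k y
    induction k with
    | zero =>
      rw [G0, ← C_1, ← monomial_zero_left, symbolEval_monomial]
      simp
    | succ k ih =>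
      rw [Function.iterate_succ_apply', ih, Gs, map_add, symbolEval_C_mul,
        symbolEval_symbolD (RingHom.id B) (fun k => d^[k] y) d d (fun b => rfl)
          (fun k => (Function.iterate_succ_apply' _ _ _).symm)]
      have hd2k : d ((u : B) ^ (2 * k)) = 2 * k * p * (u : B) ^ (2 * k) := by
        clear ih
        induction k with
        | zero => simp
        | succ k ih =>
          rw [show 2 * (k + 1) = 2 * k + 2 by ring, pow_add, Derivation.leibniz, ih,
            Derivation.leibniz_pow, hdu]
          simp only [smul_eq_mul, nsmul_eq_mul]
          push_cast
          ring
      rw [Derivation.leibniz, Derivation.leibniz, hd2k, hdws]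
      simp only [smul_eq_mul, RingHom.id_apply]
      push_cast
      ring
  -- `G k` is monic of degree `k`; the recursion for `G` then yields closed forms for its next two
  -- coefficients.
  have c1 : ∀ k j, (G k).coeff (k + 1 + j) = 0 := by
    intro k
    induction k with
    | zero => intro j; rw [G0, coeff_one, if_neg (by omega)]
    | succ k ih =>
      intro j
      rw [Gs, coeff_add, coeff_C_mul, show k + 1 + 1 + j = (k + 1 + j) + 1 by ring,
        coeff_symbolD_succ, ih, show k + 1 + j + 1 = k + 1 + (j + 1) by ring, ih]
      simp
  have c2 : ∀ k, (G k).coeff k = 1 := by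
    intro k
    induction k with
    | zero => rw [G0, coeff_one_zero]
    | succ k ih =>
      have := c1 k 0
      rw [add_zero] at this
      rw [Gs, coeff_add, coeff_C_mul, coeff_symbolD_succ, this, ih]
      simp
  have c3 : ∀ k, (G (k + 1)).coeff k = (k + 1) * (k - (s + 1)) * p := by
    intro k
    induction k with
    | zero => rw [Gs, G0, coeff_add, coeff_C_mul, coeff_symbolD_zero]; simp
    | succ k ih =>
      rw [Gs, coeff_add, coeff_C_mul, coeff_symbolD_succ, c2, ih]
      simp
      ring
  -- At `k = s = n - 2` the `p²` term vanishes because of the factor `k - s`, and `3(s + 1) - 2s = s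
  -- + 3 = n + 1`.
  have c4 : ∀ k, 6 * (G (k + 2)).coeff k = -(q * (k + 2) * (k + 1) * (2 * k - 3 * (s + 1))) +
      3 * p ^ 2 * (k + 2) * (k + 1) * (k - s) * (k - s - 1) := by
    intro k
    induction k with
    | zero =>
      rw [Gs, coeff_add, coeff_C_mul, coeff_symbolD_zero, c3]
      simp only [Derivation.leibniz, map_sub, map_add,
        Derivation.map_one_eq_zero, Derivation.map_natCast, smul_eq_mul, hdp]
      push_cast
      ring
    | succ k ih =>
      rw [Gs, coeff_add, coeff_C_mul, coeff_symbolD_succ, mul_add, mul_add, ih, c3]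
      push_cast
      simp only [Derivation.leibniz, map_sub, map_add,
        Derivation.map_one_eq_zero, Derivation.map_natCast, smul_eq_mul, hdp]
      ring
  have hsym : C ((u : B) ^ (2 * (s + 2)) * w ^ (s + 1)) * G (s + 2) =
      C ((u : B) ^ (s + 2 + 1)) *
        (monomial (s + 2) 1 + ∑ j ∈ Finset.Icc 2 (s + 2), monomial (s + 2 - j) (A j)) := by
    refine symbol_ext ht fun y => ?_
    rw [symbolEval_C_mul, symbolEval_C_mul, map_add, map_sum]
    simp only [symbolEval_monomial, RingHom.id_apply, one_mul]
    rw [← hL, hG]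
  have hcoef := congrArg (fun P : B[X] => P.coeff s) hsym
  simp only [coeff_C_mul, coeff_add, finsetSum_coeff, coeff_monomial] at hcoef
  rw [if_neg (by omega), zero_add, Finset.sum_eq_single 2, if_pos (by omega)] at hcoef
  · have hup : (u : B) ^ (2 * (s + 2)) * w ^ (s + 1) = (u : B) ^ (s + 2 + 1) := by
      rw [show 2 * (s + 2) = (s + 2 + 1) + (s + 1) by ring, pow_add, mul_assoc, ← mul_pow, huw,
        one_pow, mul_one]
    rw [hup] at hcoef
    rw [← (u.isUnit.pow (s + 2 + 1)).mul_left_cancel hcoef, c4]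
    push_cast
    ring
  · intro j hj hj2
    rw [Finset.mem_Icc] at hj
    rw [if_neg (by omega)]
  · intro h
    exact absurd (Finset.mem_Icc.2 ⟨le_rfl, by omega⟩) h

theorem IsCanonicalTransform.isSymmetricPower [CharZero K] (hn : 2 ≤ n) {t : B} (ht : d t = 1)
    (h : IsCanonicalTransform d n A q) : IsSymmetricPower d n A q :=
  ⟨h.second_coeff hn ht, fun _ hξ => h.intertwine (by omega) hξ⟩

end ScalarOperators

/-! ### Jet calculus: total derivative, prolongation, partial derivatives -/

section Jets

variable {K : Type*} [Field K] {m : ℕ} {B R : Type*} [CommRing B] [Algebra K B]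
  [CommRing R] [Algebra K R]

theorem coeff_onCoeffs (w : Derivation K R R) (P : DiffFun m R) (a : ℕ × Fin m →₀ ℕ) :
    (onCoeffs w P).coeff a = w (P.coeff a) := by
  classical
  simp only [onCoeffs, MvPolynomial.coeff_sum, MvPolynomial.coeff_monomial]
  rw [Finset.sum_ite_eq' P.support a fun b => w (P.coeff b)]
  split_ifs with h
  · rfl
  · rw [MvPolynomial.notMem_support_iff.1 h, map_zero]

/-- `onCoeffs` as a derivation. -/
def onCoeffsDer (m : ℕ) (w : Derivation K R R) : Derivation K (DiffFun m R) (DiffFun m R) :=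
  Derivation.mk'
    { toFun := onCoeffs w
      map_add' := fun P Q => by
        ext a
        simp only [MvPolynomial.coeff_add, coeff_onCoeffs, map_add]
      map_smul' := fun c P => by
        ext a
        simp only [MvPolynomial.coeff_smul, coeff_onCoeffs, Derivation.map_smul, RingHom.id_apply] }
    (fun P Q => by
      classical
      ext a
      change (onCoeffs w (P * Q)).coeff a = (P * onCoeffs w Q + Q * onCoeffs w P).coeff a
      rw [mul_comm Q]
      simp only [MvPolynomial.coeff_add, coeff_onCoeffs, MvPolynomial.coeff_mul, map_sum,
        Derivation.leibniz, smul_eq_mul, Finset.sum_add_distrib]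
      congr 1
      exact Finset.sum_congr rfl fun _ _ => mul_comm _ _)

theorem onCoeffsDer_apply (w : Derivation K R R) (P : DiffFun m R) :
    onCoeffsDer m w P = onCoeffs w P := rfl

theorem onCoeffs_C (w : Derivation K R R) (f : R) :
    onCoeffs w (MvPolynomial.C f : DiffFun m R) = MvPolynomial.C (w f) := by
  classical
  ext a
  rw [coeff_onCoeffs, MvPolynomial.coeff_C, MvPolynomial.coeff_C]
  split_ifs <;> simp

theorem onCoeffs_X (w : Derivation K R R) (i : ℕ × Fin m) :
    onCoeffs w (MvPolynomial.X i : DiffFun m R) = 0 := by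
  classical
  ext a
  rw [coeff_onCoeffs, MvPolynomial.coeff_X]
  split_ifs <;> simp

theorem diffFun_derivation_ext {D₁ D₂ : Derivation K (DiffFun m R) (DiffFun m R)}
    (hC : ∀ f, D₁ (MvPolynomial.C f) = D₂ (MvPolynomial.C f))
    (hX : ∀ i, D₁ (MvPolynomial.X i) = D₂ (MvPolynomial.X i)) : D₁ = D₂ := by
  ext1 P
  induction P using MvPolynomial.induction_on with
  | C f => exact hC f
  | add P Q hP hQ => rw [map_add, map_add, hP, hQ]
  | mul_X P i hP => rw [Derivation.leibniz, Derivation.leibniz, hP, hX]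

theorem derivation_sum_apply {T ι : Type*} [CommRing T] [Algebra K T] (s : Finset ι)
    (D : ι → Derivation K T T) (f : T) : (∑ i ∈ s, D i) f = ∑ i ∈ s, D i f := by
  classical
  induction s using Finset.induction_on with
  | empty => simp
  | insert i s hi ih => rw [Finset.sum_insert hi, Finset.sum_insert hi, Derivation.add_apply, ih]

/-- The total derivative as a derivation. -/
def totalDer (S : Coords K m B R) : Derivation K (DiffFun m R) (DiffFun m R) :=
  onCoeffsDer m S.dx + ∑ j, jet S j 1 • onCoeffsDer m (S.dy j) +
    (MvPolynomial.mkDerivation R fun kj : ℕ × Fin m => jet S kj.2 (kj.1 + 2)).restrictScalars K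

theorem totalDer_apply (S : Coords K m B R) (P : DiffFun m R) : totalDer S P = totalD S P := by
  simp only [totalDer, totalD, Derivation.add_apply, derivation_sum_apply,
    Derivation.smul_apply, onCoeffsDer_apply, smul_eq_mul, Derivation.restrictScalars_apply]

/-- The prolongation as a derivation. -/
def prolongDer (S : Coords K m B R) (ξ : R) (ψ : Fin m → R) :
    Derivation K (DiffFun m R) (DiffFun m R) :=
  onCoeffsDer m (vectorField S ξ ψ) +
    (MvPolynomial.mkDerivation R
      fun kj : ℕ × Fin m => prolCoeff S ξ ψ kj.2 (kj.1 + 1)).restrictScalars K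

theorem prolongDer_apply (S : Coords K m B R) (ξ : R) (ψ : Fin m → R) (P : DiffFun m R) :
    prolongDer S ξ ψ P = prolong S ξ ψ P := rfl

/-- The derivation `∂/∂y_j^{(k)}`. -/
def jetPartial (S : Coords K m B R) (j : Fin m) : ℕ → Derivation K (DiffFun m R) (DiffFun m R)
  | 0 => onCoeffsDer m (S.dy j)
  | k + 1 => (MvPolynomial.pderiv (k, j)).restrictScalars K

/-- The properties of the coordinates on which the symmetry analysis rests. -/
structure Regular (S : Coords K m B R) : Prop where
  exists_x : ∃ t : B, S.d t = 1
  dx_incl : ∀ b, S.dx (S.incl b) = S.incl (S.d b)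
  dy_incl : ∀ j b, S.dy j (S.incl b) = 0
  dx_y : ∀ j, S.dx (S.y j) = 0
  dy_y : ∀ j k, S.dy j (S.y k) = if j = k then 1 else 0
  dy_dx : ∀ j f, S.dy j (S.dx f) = S.dx (S.dy j f)
  dy_dy : ∀ j k f, S.dy j (S.dy k f) = S.dy k (S.dy j f)
  y_mul_cancel : ∀ j f, S.y j * f = 0 → f = 0
  const : ∀ f, S.dx f = 0 → (∀ j, S.dy j f = 0) → ∃ c : K, f = algebraMap K R c
  nontrivial : Nontrivial R

open MvPolynomial (C X)

variable {S : Coords K m B R}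

theorem totalDer_C (f : R) :
    totalDer S (C f) = C (S.dx f) + ∑ j, jet S j 1 * C (S.dy j f) := by
  rw [totalDer_apply, totalD, onCoeffs_C, MvPolynomial.derivation_C, add_zero]
  simp only [onCoeffs_C]

theorem jet_zero (j : Fin m) : jet S j 0 = C (S.y j) := rfl

theorem jet_succ (j : Fin m) (k : ℕ) : jet S j (k + 1) = X (k, j) := rfl

theorem totalDer_jet (hS : Regular S) (j : Fin m) (k : ℕ) :
    totalDer S (jet S j k) = jet S j (k + 1) := by
  rcases k with _ | k
  · rw [jet_zero, totalDer_C, hS.dx_y]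
    simp [hS.dy_y]
  · rw [jet_succ, totalDer_apply, totalD, onCoeffs_X]
    simp only [onCoeffs_X, MvPolynomial.mkDerivation_X, mul_zero, Finset.sum_const_zero, zero_add]

theorem totalDer_C_incl (hS : Regular S) (b : B) :
    totalDer S (C (S.incl b)) = C (S.incl (S.d b)) := by
  rw [totalDer_C, hS.dx_incl]
  simp [hS.dy_incl]

theorem iterate_totalDer_jet (hS : Regular S) (j : Fin m) (k l : ℕ) :
    (totalDer S)^[l] (jet S j k) = jet S j (k + l) := by
  induction l with
  | zero => rfl
  | succ l ih => rw [Function.iterate_succ_apply', ih, totalDer_jet hS]; rfl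

theorem prolong_C (ξ : R) (ψ : Fin m → R) (f : R) :
    prolongDer S ξ ψ (C f) = C (vectorField S ξ ψ f) := by
  rw [prolongDer_apply, prolong, onCoeffs_C, MvPolynomial.derivation_C, add_zero]

theorem vectorField_apply (ξ : R) (ψ : Fin m → R) (f : R) :
    vectorField S ξ ψ f = ξ * S.dx f + ∑ j, ψ j * S.dy j f := by
  simp only [vectorField, Derivation.add_apply, derivation_sum_apply,
    Derivation.smul_apply, smul_eq_mul]

theorem vectorField_y (hS : Regular S) (ξ : R) (ψ : Fin m → R) (j : Fin m) :
    vectorField S ξ ψ (S.y j) = ψ j := by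
  rw [vectorField_apply, hS.dx_y]
  simp [hS.dy_y]

theorem vectorField_incl (hS : Regular S) (ξ : R) (ψ : Fin m → R) (b : B) :
    vectorField S ξ ψ (S.incl b) = ξ * S.incl (S.d b) := by
  rw [vectorField_apply, hS.dx_incl]
  simp [hS.dy_incl]

theorem prolong_jet (hS : Regular S) (ξ : R) (ψ : Fin m → R) (j : Fin m) (k : ℕ) :
    prolongDer S ξ ψ (jet S j k) = prolCoeff S ξ ψ j k := by
  rcases k with _ | k
  · rw [jet_zero, prolong_C, vectorField_y hS]; rfl
  · rw [jet_succ, prolongDer_apply, prolong, onCoeffs_X, MvPolynomial.mkDerivation_X, zero_add]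

/-- The characteristic form of the prolongation coefficients. -/
theorem prolCoeff_eq (hS : Regular S) (ξ : R) (ψ : Fin m → R) (j : Fin m) (k : ℕ) :
    prolCoeff S ξ ψ j k =
      (totalDer S)^[k] (C (ψ j) - C ξ * jet S j 1) + C ξ * jet S j (k + 1) := by
  induction k with
  | zero => simp [prolCoeff]
  | succ k ih =>
    rw [prolCoeff, ← totalDer_apply, ← totalDer_apply, ih, Function.iterate_succ_apply', map_add,
      Derivation.leibniz (totalDer S) (C ξ), totalDer_jet hS]
    simp only [smul_eq_mul]
    ring

theorem jetPartial_C_zero (j : Fin m) (f : R) : jetPartial S j 0 (C f) = C (S.dy j f) :=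
  onCoeffs_C _ _

theorem jetPartial_C_succ (j : Fin m) (k : ℕ) (f : R) : jetPartial S j (k + 1) (C f) = 0 :=
  MvPolynomial.pderiv_C

theorem jetPartial_jet (hS : Regular S) (i j : Fin m) (k l : ℕ) :
    jetPartial S j k (jet S i l) = if k = l ∧ j = i then 1 else 0 := by
  rcases k with _ | k <;> rcases l with _ | l
  · rw [jet_zero, jetPartial_C_zero, hS.dy_y]
    split_ifs <;> simp_all
  · rw [jet_succ, if_neg (by omega)]
    exact onCoeffs_X _ _
  · rw [jet_zero, jetPartial_C_succ, if_neg (by omega)]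
  · rw [jet_succ]
    change MvPolynomial.pderiv (k, j) (X (l, i)) = _
    rw [MvPolynomial.pderiv_X, Pi.single_apply]
    simp only [Prod.mk.injEq, Nat.add_right_cancel_iff]
    exact if_congr ⟨fun h => ⟨h.1.symm, h.2.symm⟩, fun h => ⟨h.1.symm, h.2.symm⟩⟩ rfl rfl

/-- The coordinate `y_j^{(k+1)}` enters the coefficients of `D_x` only in front of `∂/∂y_j^{(k)}`.
The commutator is a derivation, so it suffices to compare on generators. -/
theorem jetPartial_succ_totalDer (hS : Regular S) (j : Fin m) (k : ℕ) (P : DiffFun m R) :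
    jetPartial S j (k + 1) (totalDer S P) =
      totalDer S (jetPartial S j (k + 1) P) + jetPartial S j k P := by
  have h : ⁅jetPartial S j (k + 1), totalDer S⁆ = jetPartial S j k := by
    refine diffFun_derivation_ext (fun f => ?_) fun i => ?_
    · rw [Derivation.commutator_apply, totalDer_C, jetPartial_C_succ, map_zero, sub_zero, map_add,
        map_sum, jetPartial_C_succ, zero_add]
      simp only [Derivation.leibniz, jetPartial_C_succ, jetPartial_jet hS, smul_eq_mul, mul_zero,
        zero_add]
      rcases k with _ | k
      · simp [jetPartial_C_zero]
      · simp [jetPartial_C_succ]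
    · rw [Derivation.commutator_apply, ← jet_succ (S := S) i.2 i.1, totalDer_jet hS,
        jetPartial_jet hS, jetPartial_jet hS, jetPartial_jet hS]
      simp only [Nat.add_right_cancel_iff]
      rw [sub_eq_self]
      split_ifs <;> simp
  rw [← h, Derivation.commutator_apply]
  abel

/-- No coefficient of `D_x` involves `y_j` itself. -/
theorem jetPartial_zero_totalDer (hS : Regular S) (j : Fin m) (P : DiffFun m R) :
    jetPartial S j 0 (totalDer S P) = totalDer S (jetPartial S j 0 P) := by
  have h : ⁅jetPartial S j 0, totalDer S⁆ = 0 := by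
    refine diffFun_derivation_ext (fun f => ?_) fun i => ?_
    · rw [Derivation.commutator_apply, totalDer_C, jetPartial_C_zero, totalDer_C, map_add,
        map_sum, jetPartial_C_zero, hS.dy_dx]
      simp only [Derivation.leibniz, jetPartial_C_zero, jetPartial_jet hS, smul_eq_mul, hS.dy_dy j]
      simp
    · rw [Derivation.commutator_apply, ← jet_succ (S := S) i.2 i.1, totalDer_jet hS,
        jetPartial_jet hS, jetPartial_jet hS]
      simp
  have := congrArg (fun D => D P) h
  simp only [Derivation.commutator_apply, Derivation.zero_apply] at this
  exact sub_eq_zero.1 this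

theorem jetPartial_iterate_eq_zero (hS : Regular S) (j : Fin m) {P : DiffFun m R}
    (hP : ∀ s, jetPartial S j (s + 2) P = 0) (r k : ℕ) :
    jetPartial S j (r + 2 + k) ((totalDer S)^[r] P) = 0 := by
  induction r generalizing k with
  | zero => rw [show 0 + 2 + k = k + 2 by ring]; exact hP k
  | succ r ih =>
    rw [Function.iterate_succ_apply', show r + 1 + 2 + k = (r + 2 + k) + 1 by ring,
      jetPartial_succ_totalDer hS, ih, show r + 2 + k + 1 = r + 2 + (k + 1) by ring, ih]
    simp

theorem jetPartial_succ_iterate (hS : Regular S) (j : Fin m) {P : DiffFun m R}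
    (hP : ∀ s, jetPartial S j (s + 2) P = 0) (r : ℕ) :
    jetPartial S j (r + 1) ((totalDer S)^[r] P) = jetPartial S j 1 P := by
  induction r with
  | zero => rfl
  | succ r ih =>
    rw [Function.iterate_succ_apply', jetPartial_succ_totalDer hS, ih,
      show r + 1 + 1 = r + 2 + 0 by ring, jetPartial_iterate_eq_zero hS j hP]
    simp

/-- For `P` of order at most one, each commutation of `∂/∂y_j^{(r)}` with `D_x` lowers the index `r`
by one or leaves a `D_x` outside; counting the ways is Pascal's rule. -/
theorem jetPartial_iterate (hS : Regular S) (j : Fin m) {P : DiffFun m R}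
    (hP : ∀ s, jetPartial S j (s + 2) P = 0) (r e : ℕ) :
    jetPartial S j r ((totalDer S)^[r + e] P) =
      ((r + e).choose e : DiffFun m R) * (totalDer S)^[e] (jetPartial S j 0 P) +
        ((r + e).choose (e + 1) : DiffFun m R) * (totalDer S)^[e + 1] (jetPartial S j 1 P) := by
  induction r generalizing e with
  | zero =>
    rw [zero_add, Nat.choose_self, Nat.choose_succ_self]
    simp only [Nat.cast_one, one_mul, Nat.cast_zero, zero_mul, add_zero]
    induction e with
    | zero => rfl
    | succ e ih =>
      rw [Function.iterate_succ_apply', jetPartial_zero_totalDer hS, ih,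
        Function.iterate_succ_apply']
  | succ r ih =>
    induction e with
    | zero =>
      rw [add_zero, Function.iterate_succ_apply', jetPartial_succ_totalDer hS,
        jetPartial_succ_iterate hS j hP]
      have := ih 0
      rw [add_zero] at this
      rw [this]
      simp
      ring
    | succ e ih' =>
      have h1 : (totalDer S) ((totalDer S)^[e] (jetPartial S j 0 P)) =
        (totalDer S)^[e + 1] (jetPartial S j 0 P) := (Function.iterate_succ_apply' _ _ _).symm
      have h2 : (totalDer S) ((totalDer S)^[e + 1] (jetPartial S j 1 P)) =
        (totalDer S)^[e + 2] (jetPartial S j 1 P) := (Function.iterate_succ_apply' _ _ _).symm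
      rw [show r + 1 + (e + 1) = (r + 1 + e) + 1 by ring, Function.iterate_succ_apply',
        jetPartial_succ_totalDer hS, ih', show r + 1 + e = r + (e + 1) by ring, ih,
        Nat.choose_succ_succ (r + (e + 1)) e, Nat.choose_succ_succ (r + (e + 1)) (e + 1)]
      simp only [map_add, Derivation.leibniz, Derivation.map_natCast, smul_eq_mul, mul_zero,
        add_zero, h1, h2]
      push_cast
      ring

section Characteristic

variable (ξ : R) (ψ : Fin m → R) (i j : Fin m)

theorem jetPartial_characteristic_zero (hS : Regular S) :
    jetPartial S j 0 (C (ψ i) - C ξ * jet S i 1) = C (S.dy j (ψ i)) - C (S.dy j ξ) * jet S i 1 := by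
  rw [map_sub, jetPartial_C_zero, Derivation.leibniz, jetPartial_C_zero, jetPartial_jet hS]
  simp [mul_comm]

theorem jetPartial_characteristic_one (hS : Regular S) :
    jetPartial S j 1 (C (ψ i) - C ξ * jet S i 1) = if j = i then -C ξ else 0 := by
  rw [map_sub, jetPartial_C_succ, Derivation.leibniz, jetPartial_C_succ, jetPartial_jet hS]
  split_ifs <;> simp_all

theorem jetPartial_characteristic_add_two (hS : Regular S) (s : ℕ) :
    jetPartial S j (s + 2) (C (ψ i) - C ξ * jet S i 1) = 0 := by
  rw [map_sub, jetPartial_C_succ, Derivation.leibniz, jetPartial_C_succ, jetPartial_jet hS]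
  simp

/-- In the characteristic form the term `-ξ y_i^{(r+1)}` of `D_x^r(ψ_i - ξ y_i')` cancels against `ξ
y_i^{(r+1)}`, so `ψ_i^{(r)}` has order at most `r`. -/
theorem jetPartial_prolCoeff_of_lt (hS : Regular S) {r k : ℕ} (h : r < k) :
    jetPartial S j k (prolCoeff S ξ ψ i r) = 0 := by
  obtain ⟨k, rfl⟩ := Nat.exists_eq_add_of_lt h
  have hQ := jetPartial_characteristic_add_two ξ ψ i j hS
  rw [prolCoeff_eq hS, map_add, Derivation.leibniz, jetPartial_C_succ, jetPartial_jet hS]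
  rcases k with _ | k
  · rw [add_zero, jetPartial_succ_iterate hS j hQ, jetPartial_characteristic_one ξ ψ i j hS]
    split_ifs <;> simp_all
  · rw [show r + (k + 1) + 1 = r + 2 + k by ring, jetPartial_iterate_eq_zero hS j hQ,
      if_neg (by omega)]
    simp

/-- `jetPartial_iterate` for the characteristic `ψ_i - ξ y_i'`. The compensating term `ξ
y_i^{(r+e+2)}` contributes nothing, since `r + 1 ≥ 1` leaves `ξ` alone and is smaller than `r + e +
2`. -/
theorem jetPartial_prolCoeff (hS : Regular S) (r e : ℕ) :
    jetPartial S j (r + 1) (prolCoeff S ξ ψ i (r + 1 + e)) =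
      ((r + 1 + e).choose e : DiffFun m R) *
          (totalDer S)^[e] (C (S.dy j (ψ i)) - C (S.dy j ξ) * jet S i 1) -
        if j = i then ((r + 1 + e).choose (e + 1) : DiffFun m R) * (totalDer S)^[e + 1] (C ξ)
        else 0 := by
  rw [prolCoeff_eq hS, map_add, Derivation.leibniz, jetPartial_C_succ, jetPartial_jet hS,
    jetPartial_iterate hS j (jetPartial_characteristic_add_two ξ ψ i j hS),
    jetPartial_characteristic_zero ξ ψ i j hS, jetPartial_characteristic_one ξ ψ i j hS,
    if_neg (show ¬(r + 1 = r + 1 + e + 1 ∧ j = i) from fun h => absurd h.1 (by omega))]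
  split_ifs
  · rw [iterate_map_neg (totalDer S)]
    simp
    ring
  · rw [iterate_map_zero (totalDer S)]
    simp

end Characteristic

theorem prolong_eqn (hS : Regular S) (n : ℕ) (A : ℕ → B) (ξ : R) (ψ : Fin m → R) (i : Fin m) :
    prolongDer S ξ ψ (eqn S n A i) = prolCoeff S ξ ψ i n + ∑ l ∈ Finset.Icc 2 n,
      (C (ξ * S.incl (S.d (A l))) * jet S i (n - l) +
        C (S.incl (A l)) * prolCoeff S ξ ψ i (n - l)) := by
  rw [eqn, map_add, map_sum, prolong_jet hS]
  refine congrArg (prolCoeff S ξ ψ i n + ·) ?_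
  refine Finset.sum_congr rfl fun l _ => ?_
  rw [Derivation.leibniz, prolong_C, prolong_jet hS, vectorField_incl hS]
  simp only [smul_eq_mul]
  ring

/-- Twice `v^{(n)}(L₀) + L₀ D_x ξ`. -/
def twiceVarExpr (S : Coords K m B R) (n : ℕ) (A : ℕ → B) (ξ : R) (ψ : Fin m → R) :
    DiffFun m R :=
  ∑ i, (C (ψ i) * eqn S n A i + C (S.y i) * prolongDer S ξ ψ (eqn S n A i) +
    C (S.y i) * eqn S n A i * totalDer S (C ξ))

theorem varExpr_eq_zero_iff [CharZero K] (hS : Regular S) (n : ℕ) (A : ℕ → B) (ξ : R)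
    (ψ : Fin m → R) :
    varExpr S (lagrangian S n A) ξ ψ = 0 ↔ twiceVarExpr S n A ξ ψ = 0 := by
  have : varExpr S (lagrangian S n A) ξ ψ = (1 / 2 : K) • twiceVarExpr S n A ξ ψ := by
    rw [varExpr, ← prolongDer_apply, ← totalDer_apply, lagrangian, Derivation.map_smul, map_sum,
      smul_mul_assoc, ← smul_add, twiceVarExpr, Finset.sum_mul, ← Finset.sum_add_distrib]
    refine congrArg ((1 / 2 : K) • ·) ?_
    refine Finset.sum_congr rfl fun i _ => ?_
    rw [Derivation.leibniz, jet_zero, prolong_C, vectorField_y hS]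
    simp only [smul_eq_mul]
    ring
  rw [this]
  constructor
  · intro h
    have h2 := congrArg (fun P : DiffFun m R => (2 : K) • P) h
    simpa [smul_smul] using h2
  · intro h
    rw [h, smul_zero]

end Jets

/-! ### Determining equations: the variational condition fixes `ξ` and `ψ` -/

section Determining

open MvPolynomial (C X)

variable {K : Type*} [Field K] {m : ℕ} {B R : Type*} [CommRing B] [Algebra K B]
  [CommRing R] [Algebra K R] {S : Coords K m B R}

theorem natCast_mul_cancel [CharZero K] {c : ℕ} (hc : c ≠ 0) {f : R}
    (h : (c : R) * f = 0) : f = 0 := by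
  have hu : IsUnit (c : R) := by
    rw [← map_natCast (algebraMap K R)]
    exact (IsUnit.mk0 _ (Nat.cast_ne_zero.2 hc)).map _
  exact hu.mul_right_eq_zero.1 h

/-- Here `n = r + 2`. As there is no term in `y_i^{(n-1)}`, derivatives in jets of order at least `n
- 1` only see the leading term. -/
theorem jetPartial_eqn_of_le (hS : Regular S) (A : ℕ → B) (i j : Fin m) {r k : ℕ} (hk : r ≤ k) :
    jetPartial S j (k + 1) (eqn S (r + 2) A i) = if k + 1 = r + 2 ∧ j = i then 1 else 0 := by
  rw [eqn, map_add, map_sum, jetPartial_jet hS, Finset.sum_eq_zero, add_zero]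
  intro l hl
  rw [Finset.mem_Icc] at hl
  rw [Derivation.leibniz, jetPartial_C_succ, jetPartial_jet hS,
    if_neg (fun h => absurd h.1 (by omega)), smul_zero, smul_zero, add_zero]

theorem jetPartial_prolong_eqn_of_le (hS : Regular S) (A : ℕ → B) (ξ : R) (ψ : Fin m → R)
    (i j : Fin m) {r k : ℕ} (hk : r ≤ k) :
    jetPartial S j (k + 1) (prolongDer S ξ ψ (eqn S (r + 2) A i)) =
      jetPartial S j (k + 1) (prolCoeff S ξ ψ i (r + 2)) := by
  rw [prolong_eqn hS, map_add, map_sum, Finset.sum_eq_zero, add_zero]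
  intro l hl
  rw [Finset.mem_Icc] at hl
  rw [map_add, Derivation.leibniz, Derivation.leibniz, jetPartial_C_succ, jetPartial_C_succ,
    jetPartial_jet hS, if_neg (fun h => absurd h.1 (by omega)),
    jetPartial_prolCoeff_of_lt ξ ψ i j hS (by omega)]
  simp only [smul_zero, add_zero]

/-- Order `n - 2` with `n = r + 3`, where `A_2` first appears. For `n = 2` this would be `∂/∂y_j`,
which also acts on the coefficients; that case is treated by `order_two_relation`. -/
theorem jetPartial_eqn_self (hS : Regular S) (A : ℕ → B) (i j : Fin m) (r : ℕ) :
    jetPartial S j (r + 1) (eqn S (r + 1 + 2) A i) = if j = i then C (S.incl (A 2)) else 0 := by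
  rw [eqn, map_add, map_sum, jetPartial_jet hS, if_neg (fun h => absurd h.1 (by omega)), zero_add,
    Finset.sum_eq_single_of_mem 2 (Finset.mem_Icc.2 ⟨le_rfl, by omega⟩)]
  · rw [Derivation.leibniz, jetPartial_C_succ, jetPartial_jet hS]
    simp
  · intro l hl hl2
    rw [Finset.mem_Icc] at hl
    rw [Derivation.leibniz, jetPartial_C_succ, jetPartial_jet hS,
      if_neg (fun h => absurd h.1 (by omega)), smul_zero, smul_zero, add_zero]

theorem jetPartial_prolong_eqn_self (hS : Regular S) (A : ℕ → B) (ξ : R) (ψ : Fin m → R)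
    (i j : Fin m) (r : ℕ) :
    jetPartial S j (r + 1) (prolongDer S ξ ψ (eqn S (r + 1 + 2) A i)) =
      jetPartial S j (r + 1) (prolCoeff S ξ ψ i (r + 1 + 2)) +
        ((if j = i then C (ξ * S.incl (S.d (A 2))) else 0) +
        C (S.incl (A 2)) * jetPartial S j (r + 1) (prolCoeff S ξ ψ i (r + 1))) := by
  rw [prolong_eqn hS, map_add, map_sum,
    Finset.sum_eq_single_of_mem 2 (Finset.mem_Icc.2 ⟨le_rfl, by omega⟩)]
  · rw [map_add, Derivation.leibniz, Derivation.leibniz, jetPartial_C_succ, jetPartial_C_succ,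
      jetPartial_jet hS]
    simp
  · intro l hl hl2
    rw [Finset.mem_Icc] at hl
    rw [map_add, Derivation.leibniz, Derivation.leibniz, jetPartial_C_succ, jetPartial_C_succ,
      jetPartial_jet hS, if_neg (fun h => absurd h.1 (by omega)),
      jetPartial_prolCoeff_of_lt ξ ψ i j hS (by omega)]
    simp only [smul_zero, add_zero]

theorem constantCoeff_totalDer (P : DiffFun m R) :
    MvPolynomial.constantCoeff (totalDer S P) = S.dx (MvPolynomial.constantCoeff P) := by
  induction P using MvPolynomial.induction_on with
  | C f =>
    rw [totalDer_C, map_add, map_sum]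
    simp [jet_succ]
  | add P Q hP hQ => simp only [map_add, hP, hQ]
  | mul_X P i hP =>
    have : totalDer S (X i : DiffFun m R) = jet S i.2 (i.1 + 2) := by
      rw [totalDer_apply, totalD, onCoeffs_X]
      simp only [onCoeffs_X, MvPolynomial.mkDerivation_X, mul_zero, Finset.sum_const_zero, zero_add]
    rw [Derivation.leibniz, this, jet_succ]
    simp

theorem totalDer_C_of_dy {f : R} (hf : ∀ j, S.dy j f = 0) :
    totalDer S (C f) = C (S.dx f) := by
  rw [totalDer_C]
  simp [hf]

theorem Regular.dy_dx_zero (hS : Regular S) {f : R} (hf : ∀ j, S.dy j f = 0) (j : Fin m) :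
    S.dy j (S.dx f) = 0 := by
  rw [hS.dy_dx, hf, map_zero]

theorem jetPartial_add_two_totalDer_C (hS : Regular S) (j : Fin m) (k : ℕ) (f : R) :
    jetPartial S j (k + 2) (totalDer S (C f)) = 0 := by
  rw [jetPartial_succ_totalDer hS, jetPartial_C_succ, jetPartial_C_succ, map_zero, add_zero]

theorem jetPartial_one_totalDer_C (hS : Regular S) (j : Fin m) (f : R) :
    jetPartial S j 1 (totalDer S (C f)) = C (S.dy j f) := by
  rw [jetPartial_succ_totalDer hS, jetPartial_C_succ, jetPartial_C_zero, map_zero, zero_add]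

section

variable {r : ℕ} {A : ℕ → B} {ξ : R} {ψ : Fin m → R}

/-- The derivative in `y_j^{(n)}`. The factor `-(r + 1) = -n + 1` collects `-n D_x ξ` from the
prolongation and `D_x ξ` from the term `L₀ D_x ξ`. -/
theorem top_coefficient (hS : Regular S) (h : twiceVarExpr S (r + 2) A ξ ψ = 0) (j : Fin m) :
    C (ψ j) + ∑ i, C (S.y i) * (C (S.dy j (ψ i)) - C (S.dy j ξ) * jet S i 1) -
      ((r : DiffFun m R) + 1) * (C (S.y j) * totalDer S (C ξ)) = 0 := by
  have h' := congrArg (jetPartial S j (r + 2)) h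
  rw [map_zero, twiceVarExpr, map_sum] at h'
  rw [← h', ← Finset.add_sum_erase _ _ (Finset.mem_univ j),
    ← Finset.add_sum_erase _ _ (Finset.mem_univ j)]
  have hterm : ∀ i, jetPartial S j (r + 2) (C (ψ i) * eqn S (r + 2) A i +
      C (S.y i) * prolongDer S ξ ψ (eqn S (r + 2) A i) +
        C (S.y i) * eqn S (r + 2) A i * totalDer S (C ξ)) =
      (if j = i then C (ψ i) - ((r : DiffFun m R) + 1) * (C (S.y i) * totalDer S (C ξ)) else 0) +
        C (S.y i) * (C (S.dy j (ψ i)) - C (S.dy j ξ) * jet S i 1) := by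
    intro i
    have h1 := jetPartial_prolCoeff ξ ψ i j hS (r + 1) 0
    simp only [add_zero, zero_add, Nat.choose_zero_right, Nat.choose_one_right,
      Function.iterate_zero_apply, Function.iterate_one] at h1
    simp only [map_add, Derivation.leibniz, jetPartial_C_succ, smul_eq_mul, mul_zero, add_zero]
    rw [jetPartial_eqn_of_le hS A i j (Nat.le_succ r),
      jetPartial_prolong_eqn_of_le hS A ξ ψ i j (Nat.le_succ r), h1,
      jetPartial_add_two_totalDer_C hS]
    simp only [true_and]
    split_ifs <;> push_cast <;> ring
  rw [hterm, if_pos rfl, Finset.sum_congr rfl fun i hi => (hterm i).trans (by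
    rw [if_neg (Finset.ne_of_mem_erase hi).symm, zero_add])]
  ring

/-- The coefficient of `y_j'` in `top_coefficient` is `-n y_j ∂_j ξ`. -/
theorem dy_xi_eq_zero [CharZero K] (hS : Regular S) (h : twiceVarExpr S (r + 2) A ξ ψ = 0)
    (j : Fin m) : S.dy j ξ = 0 := by
  have h' := congrArg (jetPartial S j 1) (top_coefficient hS h j)
  simp only [map_zero, map_sub, map_add, map_sum, Derivation.leibniz, jetPartial_C_succ,
    jetPartial_one_totalDer_C hS, jetPartial_jet hS, Derivation.map_natCast,
    Derivation.map_one_eq_zero, smul_eq_mul] at h'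
  have h2 : C (((r + 2 : ℕ) : R) * (S.y j * S.dy j ξ)) = (0 : DiffFun m R) := by
    simp at h'
    simp [map_ofNat C 2]
    linear_combination -h'
  exact hS.y_mul_cancel j _ (natCast_mul_cancel (K := K) (by omega)
    ((map_eq_zero_iff C (MvPolynomial.C_injective _ _)).1 h2))

theorem linear_relation [CharZero K] (hS : Regular S) (h : twiceVarExpr S (r + 2) A ξ ψ = 0)
    (j : Fin m) :
    ψ j + ∑ i, S.y i * S.dy j (ψ i) = ((r : R) + 1) * (S.y j * S.dx ξ) := by
  have h1 := top_coefficient hS h j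
  rw [totalDer_C_of_dy (dy_xi_eq_zero hS h)] at h1
  simp only [dy_xi_eq_zero hS h, map_zero, zero_mul, sub_zero] at h1
  have h2 : C (ψ j + ∑ i, S.y i * S.dy j (ψ i) - ((r : R) + 1) * (S.y j * S.dx ξ)) =
      (0 : DiffFun m R) := by
    rw [← h1]
    simp [map_sum]
  exact sub_eq_zero.1 ((map_eq_zero_iff C (MvPolynomial.C_injective _ _)).1 h2)

/-- The derivative in `y_j^{(n-1)}`. The equation contributes only through the prolongation of its
leading term. -/
theorem second_coefficient [CharZero K] (hS : Regular S)
    (h : twiceVarExpr S (r + 2) A ξ ψ = 0) (j : Fin m) :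
    ((r : DiffFun m R) + 2) * ∑ i, C (S.y i) * totalDer S (C (S.dy j (ψ i))) =
      ((r + 2).choose 2 : DiffFun m R) * C (S.y j * S.dx (S.dx ξ)) := by
  have hξ := dy_xi_eq_zero hS h
  have h' := congrArg (jetPartial S j (r + 1)) h
  rw [map_zero, twiceVarExpr, map_sum] at h'
  have hterm : ∀ i, jetPartial S j (r + 1) (C (ψ i) * eqn S (r + 2) A i +
      C (S.y i) * prolongDer S ξ ψ (eqn S (r + 2) A i) +
        C (S.y i) * eqn S (r + 2) A i * totalDer S (C ξ)) =
      ((r : DiffFun m R) + 2) * (C (S.y i) * totalDer S (C (S.dy j (ψ i)))) -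
        if j = i then ((r + 2).choose 2 : DiffFun m R) * C (S.y i * S.dx (S.dx ξ)) else 0 := by
    intro i
    have h1 := jetPartial_prolCoeff ξ ψ i j hS r 1
    rw [Function.iterate_one, Function.iterate_succ_apply', Function.iterate_one,
      totalDer_C_of_dy hξ, totalDer_C_of_dy (hS.dy_dx_zero hξ), hξ, map_zero, zero_mul, sub_zero,
      Nat.choose_one_right, show r + 1 + 1 = r + 2 from rfl, show 1 + 1 = 2 from rfl] at h1
    rw [totalDer_C_of_dy hξ]
    simp only [map_add, Derivation.leibniz, jetPartial_C_succ, smul_eq_mul, mul_zero, add_zero]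
    rw [jetPartial_eqn_of_le hS A i j le_rfl,
      jetPartial_prolong_eqn_of_le hS A ξ ψ i j le_rfl, h1, if_neg (by omega)]
    split_ifs
    · push_cast
      rw [map_mul]
      ring
    · push_cast
      ring
  rw [Finset.sum_congr rfl fun i _ => hterm i, Finset.sum_sub_distrib, ← Finset.mul_sum] at h'
  simpa [sub_eq_zero] using h'

theorem cast_choose_two (T : Type*) [CommRing T] (r : ℕ) :
    2 * ((r + 2).choose 2 : T) = (r + 2) * (r + 1) := by
  have h2 : (r + 2).choose 2 * 2 = (r + 2) * (r + 1) := by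
    rw [Nat.choose_two_right, Nat.div_mul_cancel]
    · rfl
    · exact (Nat.even_mul_pred_self _).two_dvd
  have h3 := congrArg (Nat.cast : ℕ → T) h2
  push_cast at h3
  rw [mul_comm, h3]

theorem cast_choose_three (T : Type*) [CommRing T] (r : ℕ) :
    6 * ((r + 2).choose 3 : T) = (r + 2) * (r + 1) * r := by
  have h2 := Nat.descFactorial_eq_factorial_mul_choose (r + 2) 3
  have h3 : (r + 2).descFactorial 3 = (r + 2) * (r + 1) * r := by
    rw [Nat.succ_descFactorial_succ, Nat.succ_descFactorial_succ, Nat.descFactorial_one]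
    ring
  rw [h3] at h2
  have h4 := congrArg (Nat.cast : ℕ → T) h2
  simp only [Nat.factorial] at h4
  push_cast at h4
  linear_combination -h4

/-- The part of `second_coefficient` free of derivatives of `y`; its part linear in `y'` is used in
`skew_relation`. -/
theorem second_derivative_relation [CharZero K] (hS : Regular S)
    (h : twiceVarExpr S (r + 2) A ξ ψ = 0) (j : Fin m) :
    2 * ∑ i, S.y i * S.dx (S.dy j (ψ i)) = ((r : R) + 1) * (S.y j * S.dx (S.dx ξ)) := by
  have h1 := congrArg (MvPolynomial.constantCoeff) (second_coefficient hS h j)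
  simp only [map_mul, map_sum, map_add, map_natCast, constantCoeff_totalDer,
    MvPolynomial.constantCoeff_C, map_ofNat] at h1
  refine sub_eq_zero.1 (natCast_mul_cancel (K := K) (c := r + 2) (by omega) ?_)
  push_cast
  linear_combination 2 * h1 + S.y j * S.dx (S.dx ξ) * cast_choose_two R r

/-- Obtained by applying `∂_k` to `linear_relation`. The second-order term `∑ y_i ∂_k ∂_j ψ_i` is
the coefficient of `y_k'` in `second_coefficient`, up to the factor `n`, and vanishes. -/
theorem skew_relation [CharZero K] (hS : Regular S) (h : twiceVarExpr S (r + 2) A ξ ψ = 0)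
    (j k : Fin m) :
    S.dy k (ψ j) + S.dy j (ψ k) = if k = j then ((r : R) + 1) * S.dx ξ else 0 := by
  have hy : ∑ i, S.y i * S.dy k (S.dy j (ψ i)) = 0 := by
    have h1 := congrArg (jetPartial S k 1) (second_coefficient hS h j)
    simp only [map_sum, Derivation.leibniz, jetPartial_C_succ, jetPartial_one_totalDer_C hS,
      map_add, Derivation.map_natCast, smul_eq_mul, mul_zero, add_zero] at h1
    rw [show jetPartial S k 1 (2 : DiffFun m R) = 0 by
      exact_mod_cast (jetPartial S k 1).map_natCast 2] at h1
    have h2 : C (((r + 2 : ℕ) : R) * ∑ i, S.y i * S.dy k (S.dy j (ψ i))) =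
        (0 : DiffFun m R) := by
      simp at h1
      simp [h1, map_ofNat C 2]
    exact natCast_mul_cancel (K := K) (by omega)
      ((map_eq_zero_iff C (MvPolynomial.C_injective _ _)).1 h2)
  have h1 := congrArg (S.dy k) (linear_relation hS h j)
  simp only [map_add, map_sum, Derivation.leibniz, smul_eq_mul, hS.dy_y, Finset.sum_add_distrib,
    hy, zero_add, hS.dy_dx_zero (dy_xi_eq_zero hS h), Derivation.map_natCast,
    Derivation.map_one_eq_zero, mul_zero, add_zero] at h1
  simp at h1
  rw [h1]

/-- `∂_l ∂_k ψ_j` is symmetric in `k, l` and, by `skew_relation`, skew in `j, k`. Such a three-index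
array is zero. -/
theorem dy_dy_psi_eq_zero [CharZero K] (hS : Regular S) (h : twiceVarExpr S (r + 2) A ξ ψ = 0)
    (j k l : Fin m) : S.dy l (S.dy k (ψ j)) = 0 := by
  have key : ∀ j k l, S.dy l (S.dy k (ψ j)) = -S.dy l (S.dy j (ψ k)) := by
    intro j k l
    have h1 := congrArg (S.dy l) (skew_relation hS h j k)
    have h2 : S.dy l (if k = j then ((r : R) + 1) * S.dx ξ else 0) = 0 := by
      split_ifs
      · simp [hS.dy_dx_zero (dy_xi_eq_zero hS h)]
      · simp
    rw [h2, map_add] at h1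
    exact eq_neg_of_add_eq_zero_left h1
  refine natCast_mul_cancel (K := K) (c := 2) (by omega) ?_
  push_cast
  have e1 := key j k l
  have e2 := key k l j
  have e3 := key l j k
  rw [hS.dy_dy l j] at e1
  rw [hS.dy_dy j k] at e2
  rw [hS.dy_dy k l] at e3
  rw [hS.dy_dy l k] at e1 e3 ⊢
  linear_combination e1 - e2 + e3

/-- `Ω_ij` is `(n-1)/2 ξ' δ_ij - ∂_j ψ_i`. It does not depend on `y` since `ψ` has no second
`y`-derivatives, nor on `x` by the `y_i`-derivative of `second_derivative_relation`. Substitution in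
`linear_relation` recovers `ψ`. -/
theorem exists_skew_matrix [CharZero K] (hS : Regular S)
    (h : twiceVarExpr S (r + 2) A ξ ψ = 0) :
    ∃ Ω : Matrix (Fin m) (Fin m) K, Ω.transpose = -Ω ∧ ∀ j,
      ψ j = algebraMap K R (((r : K) + 1) / 2) * S.dx ξ * S.y j +
        ∑ i, algebraMap K R (Ω i j) * S.y i := by
  have hξ := dy_xi_eq_zero hS h
  set c : R := algebraMap K R (((r : K) + 1) / 2) with hc
  have h2c : 2 * c = (r : R) + 1 := by
    rw [hc, ← map_ofNat (algebraMap K R) 2, ← map_mul, mul_div_cancel₀ _ two_ne_zero]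
    simp
  have hdc : ∀ D : Derivation K R R, D c = 0 := fun D => D.map_algebraMap _
  have hex : ∀ i j, ∃ a : K,
      (if i = j then c * S.dx ξ else 0) - S.dy j (ψ i) = algebraMap K R a := by
    intro k j
    refine hS.const _ ?_ fun l => ?_
    · have h1 := congrArg (S.dy k) (second_derivative_relation hS h j)
      have h20 : S.dy k (2 : R) = 0 := by exact_mod_cast (S.dy k).map_natCast 2
      simp only [map_sum, Derivation.leibniz, smul_eq_mul, hS.dy_y,
        hS.dy_dx, dy_dy_psi_eq_zero hS h, hξ, map_zero, mul_zero, zero_add, add_zero, h20,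
        Derivation.map_natCast, map_add, Derivation.map_one_eq_zero] at h1
      simp at h1
      refine natCast_mul_cancel (K := K) (c := 2) (by omega) ?_
      rw [map_sub]
      push_cast
      split_ifs at h1 ⊢
      · rw [Derivation.leibniz, hdc, smul_eq_mul, smul_zero, add_zero]
        linear_combination -h1 + S.dx (S.dx ξ) * h2c
      · rw [map_zero]
        linear_combination -h1
    · rw [map_sub, dy_dy_psi_eq_zero hS h, sub_zero]
      split_ifs
      · rw [Derivation.leibniz, hS.dy_dx_zero hξ, hdc, smul_zero, smul_zero, add_zero]
      · rw [map_zero]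
  choose Ω hΩ using hex
  have hinj : Function.Injective (algebraMap K R) := by
    have := hS.nontrivial
    exact (algebraMap K R).injective
  refine ⟨Matrix.of Ω, ?_, fun j => ?_⟩
  · ext i j
    apply hinj
    rw [Matrix.transpose_apply, Matrix.neg_apply, Matrix.of_apply, Matrix.of_apply, map_neg,
      ← hΩ, ← hΩ]
    have := skew_relation hS h j i
    split_ifs at this ⊢ with h1 h2 h3
    · linear_combination -this + S.dx ξ * h2c
    · exact absurd h1.symm h2
    · exact absurd h3.symm h1
    · linear_combination -this
  · have h1 := linear_relation hS h j
    simp only [Matrix.of_apply, ← hΩ, sub_mul, Finset.sum_sub_distrib, ite_mul, zero_mul]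
    simp only [Finset.sum_ite_eq', Finset.mem_univ, if_true, mul_comm _ (S.y _)] at h1 ⊢
    linear_combination h1 - S.y j * S.dx ξ * h2c

/-- The derivative in `y_j^{(n-2)}`, for `n = r + 3`. The term `-r A_2 ξ'` combines `-(n-2) A_2 ξ'`
from the prolongation with `A_2 ξ'` from `L₀ D_x ξ`. -/
theorem third_coefficient [CharZero K] (hS : Regular S)
    (h : twiceVarExpr S (r + 1 + 2) A ξ ψ = 0) (j : Fin m) :
    ψ j * S.incl (A 2) + ∑ i, S.y i * (((r + 1 + 2).choose 2 : R) * S.dx (S.dx (S.dy j (ψ i))) +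
        S.incl (A 2) * S.dy j (ψ i)) +
      S.y j * (ξ * S.incl (S.d (A 2)) - ((r + 1 + 2).choose 3 : R) * S.dx (S.dx (S.dx ξ)) -
        (r : R) * S.incl (A 2) * S.dx ξ) = 0 := by
  have hξ := dy_xi_eq_zero hS h
  have hψ : ∀ i k, S.dy k (S.dy j (ψ i)) = 0 := fun i k => dy_dy_psi_eq_zero hS h i j k
  have h' := congrArg (jetPartial S j (r + 1)) h
  rw [map_zero, twiceVarExpr, map_sum] at h'
  have hterm : ∀ i, jetPartial S j (r + 1) (C (ψ i) * eqn S (r + 1 + 2) A i +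
      C (S.y i) * prolongDer S ξ ψ (eqn S (r + 1 + 2) A i) +
        C (S.y i) * eqn S (r + 1 + 2) A i * totalDer S (C ξ)) =
      C ((if j = i then ψ i * S.incl (A 2) + S.y i * (ξ * S.incl (S.d (A 2)) -
        ((r + 1 + 2).choose 3 : R) * S.dx (S.dx (S.dx ξ)) - (r : R) * S.incl (A 2) * S.dx ξ)
        else 0) + S.y i * (((r + 1 + 2).choose 2 : R) * S.dx (S.dx (S.dy j (ψ i))) +
        S.incl (A 2) * S.dy j (ψ i))) := by
    intro i
    have h1 := jetPartial_prolCoeff ξ ψ i j hS r 2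
    have h0 := jetPartial_prolCoeff ξ ψ i j hS r 0
    simp only [Function.iterate_succ_apply', Function.iterate_zero_apply, hξ, map_zero, zero_mul,
      sub_zero, totalDer_C_of_dy hξ, totalDer_C_of_dy (hS.dy_dx_zero hξ),
      totalDer_C_of_dy (hS.dy_dx_zero (hS.dy_dx_zero hξ)), totalDer_C_of_dy (hψ i),
      totalDer_C_of_dy (hS.dy_dx_zero (hψ i)), add_zero, zero_add, Nat.choose_zero_right,
      Nat.choose_one_right, Nat.cast_one, one_mul] at h0 h1
    rw [totalDer_C_of_dy hξ]
    simp only [map_add, Derivation.leibniz, jetPartial_C_succ, smul_eq_mul, mul_zero, add_zero]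
    rw [jetPartial_eqn_self hS, jetPartial_prolong_eqn_self hS, h1, h0]
    split_ifs
    · simp only [map_add, map_mul, map_sub, map_natCast, Nat.cast_add, Nat.cast_one]
      ring
    · simp only [map_add, map_mul, map_natCast]
      simp
  rw [Finset.sum_congr rfl fun i _ => hterm i, ← map_sum,
    map_eq_zero_iff C (MvPolynomial.C_injective _ _), Finset.sum_add_distrib] at h'
  simp only [Finset.sum_ite_eq, Finset.mem_univ, if_true] at h'
  linear_combination h'

/-- The part free of derivatives of `y`, which replaces `third_coefficient` when `n = 2`. -/
theorem order_two_relation [CharZero K] (hS : Regular S)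
    (h : twiceVarExpr S 2 A ξ ψ = 0) :
    ∑ i, (2 * S.incl (A 2) * (S.y i * ψ i) + S.y i * S.dx (S.dx (ψ i)) +
      S.y i * S.y i * (ξ * S.incl (S.d (A 2)) + S.incl (A 2) * S.dx ξ)) = 0 := by
  have h' := congrArg MvPolynomial.constantCoeff h
  rw [map_zero, twiceVarExpr, map_sum] at h'
  rw [← h']
  refine Finset.sum_congr rfl fun i _ => ?_
  rw [prolong_eqn hS, prolCoeff_eq hS, eqn]
  simp only [Finset.Icc_self, Finset.sum_singleton, Nat.sub_self, map_add, map_mul,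
    MvPolynomial.constantCoeff_C, constantCoeff_totalDer, Function.iterate_succ_apply',
    Function.iterate_zero_apply, jet_succ, MvPolynomial.constantCoeff_X, prolCoeff, jet_zero,
    map_sub, mul_zero, sub_zero, map_zero]
  ring

/-- The coefficient of order `n - 2` reduces to `n(n²-1)/12 ξ''' + 2 A_2 ξ' + A_2' ξ = 0`, and `A_2
= n(n²-1)/6 q`. One component `y_j`, available as `m ≥ 1`, is multiplied in and cancelled. -/
theorem xi_equation [CharZero K] (hm : 1 ≤ m) (hS : Regular S) {q : B}
    (hA : 6 * A 2 = ((r + 2 : ℕ) : B) * (((r + 2 : ℕ) : B) - 1) * (((r + 2 : ℕ) : B) + 1) * q)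
    (h : twiceVarExpr S (r + 2) A ξ ψ = 0) :
    S.dx (S.dx (S.dx ξ)) + 4 * S.incl q * S.dx ξ + 2 * S.incl (S.d q) * ξ = 0 := by
  have hξ := dy_xi_eq_zero hS h
  have hAR : 6 * S.incl (A 2) = ((r : R) + 2) * (r + 1) * (r + 3) * S.incl q := by
    have := congrArg S.incl hA
    simp only [map_mul, map_sub, map_add, map_natCast, map_one, map_ofNat] at this
    rw [this]
    push_cast
    ring
  have hAR' : 6 * S.incl (S.d (A 2)) = ((r : R) + 2) * (r + 1) * (r + 3) * S.incl (S.d q) := by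
    have := congrArg S.dx hAR
    have h6 : S.dx (6 : R) = 0 := by exact_mod_cast S.dx.map_natCast 6
    have h2 : S.dx (2 : R) = 0 := by exact_mod_cast S.dx.map_natCast 2
    have h3 : S.dx (3 : R) = 0 := by exact_mod_cast S.dx.map_natCast 3
    simp only [Derivation.leibniz, map_add, Derivation.map_natCast, h6, h2, h3, hS.dx_incl,
      Derivation.map_one_eq_zero, smul_eq_mul, mul_zero, add_zero] at this
    linear_combination this
  let j : Fin m := ⟨0, hm⟩
  refine natCast_mul_cancel (K := K) (c := (r + 2) * (r + 1) * (r + 3)) (by positivity) ?_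
  refine hS.y_mul_cancel j _ ?_
  rcases r with _ | r
  · set g : R := S.dx (S.dx (S.dx ξ)) + 4 * S.incl (A 2) * S.dx ξ + 2 * S.incl (S.d (A 2)) * ξ
      with hg
    have hgy : ∀ k, S.dy k g = 0 := by
      intro k
      have h4 : S.dy k (4 : R) = 0 := by exact_mod_cast (S.dy k).map_natCast 4
      have h2 : S.dy k (2 : R) = 0 := by exact_mod_cast (S.dy k).map_natCast 2
      rw [hg]
      simp only [map_add, Derivation.leibniz, h4, h2, hS.dy_incl, hS.dy_dx, hξ, map_zero,
        smul_zero, add_zero]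
    -- Contract `linear_relation` with `y_i` and `skew_relation` with `y_i y_k`, then eliminate the
    -- double sum `∑ y_i y_k ∂_i ψ_k`.
    have hyψ : 2 * ∑ i, S.y i * ψ i = S.dx ξ * ∑ i, S.y i * S.y i := by
      have e1 : ∀ i, S.y i * ψ i + ∑ k, S.y i * (S.y k * S.dy i (ψ k)) =
          S.dx ξ * (S.y i * S.y i) := by
        intro i
        have := linear_relation hS h i
        rw [← Finset.mul_sum]
        push_cast at this
        linear_combination S.y i * this
      have e2 := Finset.sum_congr rfl fun i (_ : i ∈ Finset.univ) => e1 i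
      rw [Finset.sum_add_distrib, ← Finset.mul_sum] at e2
      have e3 : ∑ i, ∑ k, S.y i * (S.y k * S.dy i (ψ k)) +
          ∑ i, ∑ k, S.y i * (S.y k * S.dy i (ψ k)) = S.dx ξ * ∑ i, S.y i * S.y i := by
        nth_rewrite 2 [Finset.sum_comm]
        rw [← Finset.sum_add_distrib, Finset.mul_sum]
        refine Finset.sum_congr rfl fun i _ => ?_
        rw [← Finset.sum_add_distrib]
        have e4 : ∀ k, S.y i * (S.y k * S.dy i (ψ k)) + S.y k * (S.y i * S.dy k (ψ i)) =
            if k = i then S.dx ξ * (S.y i * S.y i) else 0 := by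
          intro k
          have := skew_relation hS h i k
          split_ifs at this ⊢ with hk
          · subst hk
            push_cast at this
            linear_combination S.y k * S.y k * this
          · linear_combination S.y i * S.y k * this
        rw [Finset.sum_congr rfl fun k _ => e4 k]
        simp
      linear_combination 2 * e2 - e3
    have hyψ2 : 2 * ∑ i, S.y i * S.dx (S.dx (ψ i)) =
        S.dx (S.dx (S.dx ξ)) * ∑ i, S.y i * S.y i := by
      have := congrArg (fun f => S.dx (S.dx f)) hyψ
      have h2 : S.dx (2 : R) = 0 := by exact_mod_cast S.dx.map_natCast 2
      simpa only [Derivation.leibniz, map_sum, h2, hS.dx_y, smul_eq_mul, mul_zero,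
        zero_mul, add_zero, zero_add, map_add, map_zero, Finset.sum_const_zero, mul_comm] using this
    have h1 := order_two_relation hS h
    rw [Finset.sum_add_distrib, Finset.sum_add_distrib, ← Finset.mul_sum, ← Finset.sum_mul] at h1
    have h2 : g * ∑ i, S.y i * S.y i = 0 := by
      linear_combination 2 * h1 - hyψ2 - 2 * S.incl (A 2) * hyψ
    -- `g` does not depend on `y`, so `∂_j` turns `g ∑ y_i² = 0` into `2 y_j g = 0`; regularity of
    -- the sum of squares is not needed.
    have h3 := congrArg (S.dy j) h2
    simp only [Derivation.leibniz, map_sum, hgy, smul_eq_mul, hS.dy_y, mul_zero, add_zero,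
      map_zero, Finset.sum_add_distrib, mul_ite, mul_one, Finset.sum_ite_eq, Finset.mem_univ,
      if_true] at h3
    have h4 : S.y j * g = 0 := by
      refine natCast_mul_cancel (K := K) (c := 2) (by omega) ?_
      push_cast
      linear_combination h3
    push_cast at hAR hAR' ⊢
    linear_combination 6 * h4 - 4 * S.y j * S.dx ξ * hAR - 2 * S.y j * ξ * hAR'
  · have h1 := third_coefficient hS h j
    rw [Finset.sum_congr rfl fun i _ => show S.y i * (((r + 1 + 2).choose 2 : R) *
      S.dx (S.dx (S.dy j (ψ i))) + S.incl (A 2) * S.dy j (ψ i)) =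
      ((r + 1 + 2).choose 2 : R) * (S.y i * S.dx (S.dx (S.dy j (ψ i)))) +
      S.incl (A 2) * (S.y i * S.dy j (ψ i)) by ring, Finset.sum_add_distrib, ← Finset.mul_sum,
      ← Finset.mul_sum] at h1
    have h2 := linear_relation hS h j
    have h3 := congrArg S.dx (second_derivative_relation hS h j)
    have h20 : S.dx (2 : R) = 0 := by exact_mod_cast S.dx.map_natCast 2
    simp only [Derivation.leibniz, map_sum, h20, hS.dx_y, smul_eq_mul, mul_zero, add_zero,
      map_add, Derivation.map_natCast, Derivation.map_one_eq_zero] at h3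
    have c2 := cast_choose_two R (r + 1)
    have c3 := cast_choose_three R (r + 1)
    push_cast at h1 h2 h3 c2 c3 hAR hAR' ⊢
    -- The coefficient of `ξ'''` is `(n-1)/2 · C(n,2) - C(n,3) = n(n²-1)/12`, with `n = r + 3`.
    linear_combination 12 * h1 - 12 * S.incl (A 2) * h2 -
      6 * ((r + 1 + 2).choose 2 : R) * h3 -
      3 * (r + 2) * S.y j * S.dx (S.dx (S.dx ξ)) * c2 +
      2 * S.y j * S.dx (S.dx (S.dx ξ)) * c3 - 4 * S.y j * S.dx ξ * hAR -
      2 * S.y j * ξ * hAR'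

end

end Determining

/-! ### Sufficiency: the candidates are variational symmetries -/

section Symmetries

open MvPolynomial (C X)

variable {K : Type*} [Field K] {m : ℕ} {B R : Type*} [CommRing B] [Algebra K B]
  [CommRing R] [Algebra K R] {S : Coords K m B R}

/-- The equation of order `n`, applied to a differential function instead of `y_i`. -/
def jetOp (S : Coords K m B R) (n : ℕ) (A : ℕ → B) (P : DiffFun m R) : DiffFun m R :=
  (totalDer S)^[n] P +
    ∑ l ∈ Finset.Icc 2 n, C (S.incl (A l)) * (totalDer S)^[n - l] P

theorem jetOp_jet (hS : Regular S) (n : ℕ) (A : ℕ → B) (i : Fin m) :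
    jetOp S n A (jet S i 0) = eqn S n A i := by
  simp only [jetOp, eqn, iterate_totalDer_jet hS, zero_add]

theorem jetOp_add (n : ℕ) (A : ℕ → B) (P Q : DiffFun m R) :
    jetOp S n A (P + Q) = jetOp S n A P + jetOp S n A Q := by
  simp only [jetOp, iterate_map_add (totalDer S), mul_add, Finset.sum_add_distrib]
  ring

theorem iterate_totalDer_smul (k : ℕ) (c : K) (P : DiffFun m R) :
    (totalDer S)^[k] (c • P) = c • (totalDer S)^[k] P := by
  induction k with
  | zero => rfl
  | succ k ih =>
    rw [Function.iterate_succ_apply', Function.iterate_succ_apply', ih, Derivation.map_smul]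

theorem jetOp_smul (n : ℕ) (A : ℕ → B) (c : K) (P : DiffFun m R) :
    jetOp S n A (c • P) = c • jetOp S n A P := by
  simp only [jetOp, iterate_totalDer_smul, mul_smul_comm, smul_add, Finset.smul_sum]

/-- `jetOp` as a linear map. -/
def jetOpLinear (S : Coords K m B R) (n : ℕ) (A : ℕ → B) : DiffFun m R →ₗ[K] DiffFun m R where
  toFun := jetOp S n A
  map_add' := jetOp_add n A
  map_smul' c P := jetOp_smul n A c P

/-- Since the equation is linear, its prolongation is the same operator applied to the
characteristic, plus transport along `ξ D_x`. -/
theorem prolong_eqn_characteristic (hS : Regular S) (n : ℕ) (A : ℕ → B) (ξ : R) (ψ : Fin m → R)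
    (i : Fin m) :
    prolongDer S ξ ψ (eqn S n A i) =
      jetOp S n A (C (ψ i) - C ξ * jet S i 1) + C ξ * totalDer S (eqn S n A i) := by
  rw [prolong_eqn hS, jetOp, eqn, map_add, map_sum, totalDer_jet hS, prolCoeff_eq hS, mul_add,
    Finset.mul_sum]
  have : ∀ l, C (ξ * S.incl (S.d (A l))) * jet S i (n - l) +
      C (S.incl (A l)) * prolCoeff S ξ ψ i (n - l) =
      C (S.incl (A l)) * (totalDer S)^[n - l] (C (ψ i) - C ξ * jet S i 1) +
        C ξ * totalDer S (C (S.incl (A l)) * jet S i (n - l)) := by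
    intro l
    rw [Derivation.leibniz, totalDer_jet hS, totalDer_C_incl hS, prolCoeff_eq hS, map_mul]
    simp only [smul_eq_mul]
    ring
  simp only [this, Finset.sum_add_distrib]
  ring

-- The intertwining relation on functions of `x` determines the symbols on both sides; these are
-- then evaluated on the jets of `y_i`.
open Polynomial in
theorem jetOp_intertwine [CharZero K] (hS : Regular S) {n : ℕ} {A : ℕ → B} {q : B}
    (hL : IsSymmetricPower S.d n A q) {ξ : B}
    (hξ : S.d (S.d (S.d ξ)) + 4 * q * S.d ξ + 2 * S.d q * ξ = 0) (i : Fin m) :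
    jetOp S n A (MvPolynomial.C (S.incl (2 * ξ)) * jet S i 1 -
        MvPolynomial.C (S.incl (((n : B) - 1) * S.d ξ)) * jet S i 0) =
      MvPolynomial.C (S.incl (2 * ξ)) * totalDer S (eqn S n A i) +
        MvPolynomial.C (S.incl (((n : B) + 1) * S.d ξ)) * eqn S n A i := by
  obtain ⟨t, ht⟩ := hS.exists_x
  let L : B[X] → B[X] := fun P => (symbolD S.d)^[n] P +
    ∑ l ∈ Finset.Icc 2 n, Polynomial.C (A l) * (symbolD S.d)^[n - l] P
  have evB : ∀ y P, symbolEval (RingHom.id B) (fun k => S.d^[k] y) (L P) =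
      scalarOp S.d n A (symbolEval (RingHom.id B) (fun k => S.d^[k] y) P) := by
    intro y P
    have h := symbolEval_symbolD_iterate (RingHom.id B) (fun k => S.d^[k] y) S.d S.d
      (fun b => rfl) (fun k => (Function.iterate_succ_apply' _ _ _).symm)
    simp only [L, map_add, map_sum, symbolEval_C_mul, h, scalarOp, RingHom.id_apply]
  let φ : B →+* DiffFun m R := MvPolynomial.C.comp (S.incl : B →+* R)
  have φ_apply : ∀ b, φ b = MvPolynomial.C (S.incl b) := fun b => rfl
  have hφ : ∀ b, totalDer S (φ b) = φ (S.d b) := fun b => totalDer_C_incl hS b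
  have evJ : ∀ P, symbolEval φ (jet S i) (L P) = jetOp S n A (symbolEval φ (jet S i) P) := by
    intro P
    have h := symbolEval_symbolD_iterate φ (jet S i) S.d (totalDer S) hφ (totalDer_jet hS i)
    simp only [L, map_add, map_sum, symbolEval_C_mul, h, jetOp, φ_apply]
  have key : L (monomial 1 (2 * ξ) - monomial 0 (((n : B) - 1) * S.d ξ)) =
      Polynomial.C (2 * ξ) * symbolD S.d (L (monomial 0 1)) +
        Polynomial.C (((n : B) + 1) * S.d ξ) * L (monomial 0 1) := by
    refine symbol_ext ht fun y => ?_
    rw [evB, map_add, symbolEval_C_mul, symbolEval_C_mul, symbolEval_symbolD (RingHom.id B)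
      (fun k => S.d^[k] y) S.d
      S.d (fun b => rfl) (fun k => (Function.iterate_succ_apply' _ _ _).symm), evB, map_sub]
    simp only [symbolEval_monomial, RingHom.id_apply, Function.iterate_one,
      Function.iterate_zero_apply, one_mul]
    have := hL.intertwine ξ hξ y
    rw [← mul_assoc, ← mul_assoc, ← mul_assoc, ← mul_assoc] at this
    exact this
  have := congrArg (symbolEval φ (jet S i)) key
  rw [evJ, map_add, symbolEval_C_mul, symbolEval_C_mul, symbolEval_symbolD φ _ S.d (totalDer S) hφ
    (totalDer_jet hS i), evJ, map_sub] at this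
  simpa only [symbolEval_monomial, map_one, one_mul, jetOp_jet hS, φ_apply] using this

section

variable {n : ℕ} {A : ℕ → B} {q ξ : B} {ψ : Fin m → R} {Ω : Matrix (Fin m) (Fin m) K}

/-- The characteristic is `-½ (2 ξ y_j' - (n-1) ξ' y_j) + ∑ Ω_ij y_i`. By `jetOp_intertwine` the
first part produces `-ξ D_x Δ_j`, which cancels the transport term. -/
theorem two_mul_prolong_eqn [CharZero K] (hS : Regular S)
    (hL : IsSymmetricPower S.d n A q)
    (hξ : S.d (S.d (S.d ξ)) + 4 * q * S.d ξ + 2 * S.d q * ξ = 0)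
    (hψ : ∀ j, 2 * ψ j = S.incl (((n : B) - 1) * S.d ξ) * S.y j +
      2 * ∑ i, algebraMap K R (Ω i j) * S.y i) (j : Fin m) :
    2 * prolongDer S (S.incl ξ) ψ (eqn S n A j) =
      -(C (S.incl (((n : B) + 1) * S.d ξ)) * eqn S n A j) +
        2 * ∑ i, C (algebraMap K R (Ω i j)) * eqn S n A i := by
  have hsmul : ∀ (c : K) (P : DiffFun m R), C (algebraMap K R c) * P = c • P := by
    intro c P
    rw [← MvPolynomial.algebraMap_eq, ← IsScalarTower.algebraMap_apply, Algebra.smul_def]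
  have h1 : (2 : K) • (C (ψ j) - C (S.incl ξ) * jet S j 1) =
      (-1 : K) • (C (S.incl (2 * ξ)) * jet S j 1 -
        C (S.incl (((n : B) - 1) * S.d ξ)) * jet S j 0) +
      (2 : K) • ∑ i, Ω i j • jet S i 0 := by
    have h2 := congrArg (C : R → DiffFun m R) (hψ j)
    simp only [map_mul, map_add, map_sum, map_ofNat, hsmul] at h2
    rw [Algebra.smul_def, Algebra.smul_def, Algebra.smul_def]
    simp only [map_neg, map_one, map_ofNat, map_mul, jet_zero]
    linear_combination h2
  have h3 := congrArg (jetOpLinear S n A) h1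
  rw [map_smul, map_add, map_smul, map_smul, map_sum] at h3
  simp only [map_smul] at h3
  change (2 : K) • jetOp S n A _ = (-1 : K) • jetOp S n A _ +
    (2 : K) • ∑ i, Ω i j • jetOp S n A (jet S i 0) at h3
  simp only [jetOp_jet hS, jetOp_intertwine hS hL hξ] at h3
  rw [Algebra.smul_def, Algebra.smul_def, Algebra.smul_def] at h3
  simp only [map_neg, map_one, map_ofNat, map_mul] at h3
  rw [prolong_eqn_characteristic hS, mul_add, h3]
  simp only [hsmul, map_mul]
  ring

theorem onShell_eqn (hn : 2 ≤ n) (i : Fin m) : onShell S n A (eqn S n A i) = 0 := by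
  have hC : ∀ f, onShell S n A (C f) = C f := fun f => MvPolynomial.aeval_C _ f
  have hlt : ∀ k, k < n → onShell S n A (jet S i k) = jet S i k := by
    intro k hk
    rcases k with _ | k
    · exact hC _
    · rw [jet_succ, onShell, MvPolynomial.aeval_X, if_neg (by omega)]
  have htop : onShell S n A (jet S i n) = jet S i n - eqn S n A i := by
    obtain ⟨k, rfl⟩ : ∃ k, n = k + 1 := ⟨n - 1, by omega⟩
    rw [jet_succ, onShell, MvPolynomial.aeval_X, if_pos rfl, jet_succ]
  have hsum : ∑ l ∈ Finset.Icc 2 n, onShell S n A (C (S.incl (A l)) * jet S i (n - l)) =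
      ∑ l ∈ Finset.Icc 2 n, C (S.incl (A l)) * jet S i (n - l) := by
    refine Finset.sum_congr rfl fun l hl => ?_
    rw [Finset.mem_Icc] at hl
    rw [map_mul, hC, hlt _ (by omega)]
  conv_lhs => rw [eqn]
  rw [map_add, map_sum, hsum, htop, eqn]
  ring

/-- The prolongation of `Δ_i` is a combination of the `Δ_k`, so it vanishes on shell. -/
theorem isPointSymmetry_of_characteristic [CharZero K] (hS : Regular S) (hn : 2 ≤ n)
    (hL : IsSymmetricPower S.d n A q)
    (hξ : S.d (S.d (S.d ξ)) + 4 * q * S.d ξ + 2 * S.d q * ξ = 0)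
    (hψ : ∀ j, 2 * ψ j = S.incl (((n : B) - 1) * S.d ξ) * S.y j +
      2 * ∑ i, algebraMap K R (Ω i j) * S.y i) : IsPointSymmetry S n A (S.incl ξ) ψ := by
  intro i
  have h := congrArg (onShell S n A) (two_mul_prolong_eqn hS hL hξ hψ i)
  simp only [map_mul, map_add, map_neg, map_sum, onShell_eqn hn, mul_zero, neg_zero,
    Finset.sum_const_zero, add_zero, map_ofNat] at h
  exact natCast_mul_cancel (K := K) (c := 2) (by omega) (by exact_mod_cast h)

/-- The `ξ'` terms carry the factor `(n-1) - (n+1) + 2 = 0`. What remains is `∑ Ω_ij (y_i Δ_j + y_j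
Δ_i)`, a skew matrix paired with a symmetric one. -/
theorem twiceVarExpr_of_characteristic [CharZero K] (hS : Regular S)
    (hL : IsSymmetricPower S.d n A q)
    (hξ : S.d (S.d (S.d ξ)) + 4 * q * S.d ξ + 2 * S.d q * ξ = 0) (hΩ : Ω.transpose = -Ω)
    (hψ : ∀ j, 2 * ψ j = S.incl (((n : B) - 1) * S.d ξ) * S.y j +
      2 * ∑ i, algebraMap K R (Ω i j) * S.y i) : twiceVarExpr S n A (S.incl ξ) ψ = 0 := by
  have hterm : ∀ j, 2 * (C (ψ j) * eqn S n A j +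
      C (S.y j) * prolongDer S (S.incl ξ) ψ (eqn S n A j) +
      C (S.y j) * eqn S n A j * totalDer S (C (S.incl ξ))) =
      2 * (∑ i, C (algebraMap K R (Ω i j)) * C (S.y i) * eqn S n A j +
        ∑ i, C (algebraMap K R (Ω i j)) * C (S.y j) * eqn S n A i) := by
    intro j
    have h1 := two_mul_prolong_eqn hS hL hξ hψ j
    have h2 := congrArg (C : R → DiffFun m R) (hψ j)
    simp only [map_mul, map_add, map_sub, map_sum, map_ofNat, map_natCast, map_one] at h1 h2
    have e1 : ∑ i, C (algebraMap K R (Ω i j)) * C (S.y i) * eqn S n A j =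
        (∑ i, C (algebraMap K R (Ω i j)) * C (S.y i)) * eqn S n A j := by
      rw [Finset.sum_mul]
    have e2 : ∑ i, C (algebraMap K R (Ω i j)) * C (S.y j) * eqn S n A i =
        C (S.y j) * ∑ i, C (algebraMap K R (Ω i j)) * eqn S n A i := by
      rw [Finset.mul_sum]
      exact Finset.sum_congr rfl fun _ _ => by ring
    rw [totalDer_C_incl hS, e1, e2]
    linear_combination eqn S n A j * h2 + C (S.y j) * h1
  refine natCast_mul_cancel (K := K) (c := 2) (by omega) ?_
  push_cast
  rw [twiceVarExpr, Finset.mul_sum, Finset.sum_congr rfl fun j _ => hterm j, ← Finset.mul_sum,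
    Finset.sum_add_distrib]
  nth_rewrite 2 [Finset.sum_comm]
  rw [← Finset.sum_add_distrib, Finset.sum_eq_zero, mul_zero]
  intro j _
  rw [← Finset.sum_add_distrib, Finset.sum_eq_zero]
  intro i _
  have : Ω j i = -Ω i j := congrFun (congrFun hΩ i) j
  rw [this, map_neg, map_neg]
  ring

end

/-! ### The symmetric square of the source equation and the classification -/

section QuadraticSolutions

variable {n : ℕ} {A : ℕ → B} {q u v : B}

theorem IsNormalizedBasis.quadratic_equation {d : Derivation K B B}
    (h : IsNormalizedBasis d q u v) (a b c : K) :
    d (d (d (a • u ^ 2 + b • (u * v) + c • v ^ 2))) +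
      4 * q * d (a • u ^ 2 + b • (u * v) + c • v ^ 2) +
      2 * d q * (a • u ^ 2 + b • (u * v) + c • v ^ 2) = 0 := by
  obtain ⟨hu, hv, -⟩ := h
  have hu' : d (d u) = -(q * u) := eq_neg_of_add_eq_zero_left hu
  have hv' : d (d v) = -(q * v) := eq_neg_of_add_eq_zero_left hv
  simp only [map_add, Derivation.map_smul, sq, Derivation.leibniz, smul_eq_mul, hu', hv', map_neg]
  simp only [Algebra.smul_def]
  ring

/-- Over functions of `(x, y)` the equation `ξ''' + 4 q ξ' + 2 q' ξ = 0` has no further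
solutions that are independent of `y`. -/
theorem exists_quadratic [CharZero K] (hS : Regular S) (h : IsNormalizedBasis S.d q u v) {ξ : R}
    (hξy : ∀ j, S.dy j ξ = 0)
    (hξ : S.dx (S.dx (S.dx ξ)) + 4 * S.incl q * S.dx ξ + 2 * S.incl (S.d q) * ξ = 0) :
    ∃ a b c : K, ξ = S.incl (a • u ^ 2 + b • (u * v) + c • v ^ 2) := by
  obtain ⟨hu, hv, hW⟩ := h
  set U := S.incl u
  set V := S.incl v
  set U' := S.incl (S.d u)
  set V' := S.incl (S.d v)
  set Q := S.incl q
  have hdU : S.dx U = U' := hS.dx_incl u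
  have hdV : S.dx V = V' := hS.dx_incl v
  have hdQ : S.dx Q = S.incl (S.d q) := hS.dx_incl q
  have hdU' : S.dx U' = -(Q * U) := by
    rw [hS.dx_incl, ← map_mul, ← map_neg]
    exact congrArg _ (eq_neg_of_add_eq_zero_left hu)
  have hdV' : S.dx V' = -(Q * V) := by
    rw [hS.dx_incl, ← map_mul, ← map_neg]
    exact congrArg _ (eq_neg_of_add_eq_zero_left hv)
  have hW' : U * V' - U' * V = 1 := by
    have := congrArg S.incl hW
    simpa only [map_sub, map_mul, map_one] using this
  have hyξ1 := hS.dy_dx_zero hξy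
  have hyξ2 := hS.dy_dx_zero hyξ1
  have hx2 : S.dx (2 : R) = 0 := by exact_mod_cast S.dx.map_natCast 2
  have hy2 : ∀ j, S.dy j (2 : R) = 0 := fun j => by exact_mod_cast (S.dy j).map_natCast 2
  have cancel : ∀ f : R, 2 * f = 0 → f = 0 := fun f hf =>
    natCast_mul_cancel (K := K) (c := 2) (by omega) (by exact_mod_cast hf)
  have hhalf : ∀ f : R, (∃ a : K, f = algebraMap K R a) → ∃ a : K, f = 2 * algebraMap K R a := by
    rintro _ ⟨a, rfl⟩
    refine ⟨a / 2, ?_⟩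
    rw [← map_ofNat (algebraMap K R) 2, ← map_mul, mul_div_cancel₀ _ two_ne_zero]
  -- First integrals of the third-order equation, dual to `u²`, `v²`, `uv`. Each kills two of these
  -- solutions; on the third the first two give `2 W² = 2` and the last `W² = 1`, where `W` is the
  -- Wronskian, so only `a` and `c` need halving.
  obtain ⟨a, ha⟩ := hhalf _ <| hS.const
    (2 * ξ * V' ^ 2 - 2 * S.dx ξ * V * V' + (S.dx (S.dx ξ) + 2 * Q * ξ) * V ^ 2)
    (by
      simp only [sq, map_add, map_sub, Derivation.leibniz, smul_eq_mul, hdV, hdV', hdQ, hx2]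
      linear_combination V ^ 2 * hξ)
    (fun j => by
      simp only [sq, map_add, map_sub, Derivation.leibniz, smul_eq_mul, hS.dy_incl, hy2, hξy,
        hyξ1, hyξ2, V, V', Q]
      ring)
  obtain ⟨c, hc⟩ := hhalf _ <| hS.const
    (2 * ξ * U' ^ 2 - 2 * S.dx ξ * U * U' + (S.dx (S.dx ξ) + 2 * Q * ξ) * U ^ 2)
    (by
      simp only [sq, map_add, map_sub, Derivation.leibniz, smul_eq_mul, hdU, hdU', hdQ, hx2]
      linear_combination U ^ 2 * hξ)
    (fun j => by
      simp only [sq, map_add, map_sub, Derivation.leibniz, smul_eq_mul, hS.dy_incl, hy2, hξy,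
        hyξ1, hyξ2, U, U', Q]
      ring)
  obtain ⟨b, hb⟩ := hS.const
    (-(2 * ξ * U' * V') + S.dx ξ * (U * V' + U' * V) - (S.dx (S.dx ξ) + 2 * Q * ξ) * (U * V))
    (by
      simp only [map_add, map_sub, map_neg, Derivation.leibniz, smul_eq_mul, hdU, hdU', hdV, hdV',
        hdQ, hx2]
      linear_combination -(U * V) * hξ)
    (fun j => by
      simp only [map_add, map_sub, map_neg, Derivation.leibniz, smul_eq_mul, hS.dy_incl, hy2, hξy,
        hyξ1, hyξ2, U, U', V, V', Q]
      ring)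
  refine ⟨a, b, c, sub_eq_zero.1 (cancel _ ?_)⟩
  simp only [map_add, map_smul, map_mul, map_pow]
  simp only [Algebra.smul_def]
  change 2 * (ξ - (algebraMap K R a * U ^ 2 + algebraMap K R b * (U * V) +
    algebraMap K R c * V ^ 2)) = 0
  linear_combination U ^ 2 * ha + 2 * U * V * hb + V ^ 2 * hc -
    2 * ξ * (U * V' - U' * V + 1) * hW'

/-- The determining equations in one direction, the intertwining relation in the other. -/
theorem mem_variationalSymmetries_iff [CharZero K] (hS : Regular S) (hm : 1 ≤ m) (hn : 2 ≤ n)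
    (hL : IsSymmetricPower S.d n A q) (h : IsNormalizedBasis S.d q u v) (ξ : R)
    (ψ : Fin m → R) :
    (IsPointSymmetry S n A ξ ψ ∧ varExpr S (lagrangian S n A) ξ ψ = 0) ↔
      ∃ (a b c : K) (Ω : Matrix (Fin m) (Fin m) K), Ω.transpose = -Ω ∧
        ξ = S.incl (a • u ^ 2 + b • (u * v) + c • v ^ 2) ∧
        ∀ j, 2 * ψ j = S.incl (((n : B) - 1) * S.d (a • u ^ 2 + b • (u * v) + c • v ^ 2)) * S.y j +
          2 * ∑ i, algebraMap K R (Ω i j) * S.y i := by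
  rw [varExpr_eq_zero_iff hS]
  constructor
  · rintro ⟨-, hE⟩
    obtain ⟨r, rfl⟩ : ∃ r, n = r + 2 := ⟨n - 2, by omega⟩
    obtain ⟨a, b, c, rfl⟩ := exists_quadratic hS h (dy_xi_eq_zero hS hE)
      (xi_equation hm hS hL.second_coeff hE)
    obtain ⟨Ω, hΩ, hψ⟩ := exists_skew_matrix hS hE
    refine ⟨a, b, c, Ω, hΩ, rfl, fun j => ?_⟩
    have h2c : 2 * algebraMap K R (((r : K) + 1) / 2) = (r : R) + 1 := by
      rw [← map_ofNat (algebraMap K R) 2, ← map_mul, mul_div_cancel₀ _ two_ne_zero]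
      simp
    rw [hψ, hS.dx_incl, map_mul]
    simp only [map_sub, map_one, map_natCast]
    push_cast
    linear_combination S.incl (S.d (a • u ^ 2 + b • (u * v) + c • v ^ 2)) * S.y j * h2c
  · rintro ⟨a, b, c, Ω, hΩ, rfl, hψ⟩
    have hξ := h.quadratic_equation a b c
    exact ⟨isPointSymmetry_of_characteristic hS hn hL hξ hψ,
      twiceVarExpr_of_characteristic hS hL hξ hΩ hψ⟩

end QuadraticSolutions

end Symmetries

/-! ### Killing forms of `𝔰𝔬(n)` and `𝔰𝔩₂` -/

section KillingForms

variable {K : Type*} [Field K]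

theorem isKilling_of_forall {L : Type*} [LieRing L] [LieAlgebra K L]
    (h : ∀ x : L, (∀ y, killingForm K L x y = 0) → x = 0) : LieAlgebra.IsKilling K L := by
  constructor
  rw [eq_bot_iff]
  intro x hx
  rw [LieIdeal.mem_killingCompl] at hx
  rw [LieSubmodule.mem_bot]
  exact h x fun y => by
    rw [LieModule.traceForm_comm]
    exact hx y (LieSubmodule.mem_top y)

theorem killingForm_prod {L₁ L₂ : Type*} [LieRing L₁] [LieAlgebra K L₁] [LieRing L₂]
    [LieAlgebra K L₂] [Module.Finite K L₁] [Module.Finite K L₂] (x y : L₁ × L₂) :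
    killingForm K (L₁ × L₂) x y = killingForm K L₁ x.1 y.1 + killingForm K L₂ x.2 y.2 := by
  rw [killingForm_apply_apply, killingForm_apply_apply,
    killingForm_apply_apply, ← LinearMap.trace_prodMap']
  rfl

theorem isKilling_prod {L₁ L₂ : Type*} [LieRing L₁] [LieAlgebra K L₁] [LieRing L₂]
    [LieAlgebra K L₂] [Module.Finite K L₁] [Module.Finite K L₂] [LieAlgebra.IsKilling K L₁]
    [LieAlgebra.IsKilling K L₂] : LieAlgebra.IsKilling K (L₁ × L₂) := by
  refine isKilling_of_forall fun x hx => Prod.ext ?_ ?_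
  · refine (LieAlgebra.IsKilling.killingForm_nondegenerate K L₁).1 _ fun y => ?_
    simpa [killingForm_prod] using hx (y, 0)
  · refine (LieAlgebra.IsKilling.killingForm_nondegenerate K L₂).1 _ fun y => ?_
    simpa [killingForm_prod] using hx (0, y)

variable {n : Type*} [Fintype n] [DecidableEq n]

theorem trace_matrix_endomorphism (f : Matrix n n K →ₗ[K] Matrix n n K) :
    LinearMap.trace K _ f = ∑ i, ∑ j, f (Matrix.single i j 1) i j := by
  rw [LinearMap.trace_eq_matrix_trace K (Matrix.stdBasis K n n), Matrix.trace,
    Fintype.sum_prod_type]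
  refine Finset.sum_congr rfl fun i _ => Finset.sum_congr rfl fun j _ => ?_
  rw [Matrix.diag_apply, LinearMap.toMatrix_apply, Matrix.stdBasis_eq_single]
  rfl

/-- The map `w ↦ a w b`. -/
def matrixMulMul (a b : Matrix n n K) : Matrix n n K →ₗ[K] Matrix n n K :=
  LinearMap.mulLeft K a ∘ₗ LinearMap.mulRight K b

theorem matrixMulMul_apply (a b w : Matrix n n K) : matrixMulMul a b w = a * (w * b) := rfl

theorem mul_single_mul_apply (a b : Matrix n n K) (i j k l : n) :
    (a * (Matrix.single i j 1 * b) : Matrix n n K) k l = a k i * b j l := by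
  rw [Matrix.mul_apply, Finset.sum_eq_single i]
  · rw [Matrix.single_mul_apply_same, one_mul]
  · intro r _ hr
    rw [Matrix.single_mul_apply_of_ne _ _ _ _ _ hr, mul_zero]
  · simp

theorem trace_matrixMulMul (a b : Matrix n n K) :
    LinearMap.trace K _ (matrixMulMul a b) = a.trace * b.trace := by
  rw [trace_matrix_endomorphism, Matrix.trace, Matrix.trace, Finset.sum_mul_sum]
  simp only [matrixMulMul_apply, mul_single_mul_apply, Matrix.diag_apply]

theorem trace_matrixMulMul_transpose (a b : Matrix n n K) :
    LinearMap.trace K _ (matrixMulMul a b ∘ₗ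
      (Matrix.transposeLinearEquiv n n K K : Matrix n n K →ₗ[K] Matrix n n K)) =
      (a * b.transpose).trace := by
  rw [trace_matrix_endomorphism, Matrix.trace]
  refine Finset.sum_congr rfl fun i _ => ?_
  rw [Matrix.diag_apply, Matrix.mul_apply]
  refine Finset.sum_congr rfl fun j _ => ?_
  change (a * ((Matrix.single i j 1).transpose * b) : Matrix n n K) i j = a i j * b i j
  rw [Matrix.transpose_single, mul_single_mul_apply]

/-- The map `w ↦ [x, [y, w]]`. -/
def doubleCommutator (x y : Matrix n n K) : Matrix n n K →ₗ[K] Matrix n n K :=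
  matrixMulMul (x * y) 1 - matrixMulMul x y - matrixMulMul y x + matrixMulMul 1 (y * x)

theorem doubleCommutator_apply (x y w : Matrix n n K) :
    doubleCommutator x y w = x * (y * w - w * y) - (y * w - w * y) * x := by
  simp only [doubleCommutator, LinearMap.add_apply, LinearMap.sub_apply, matrixMulMul_apply]
  noncomm_ring

theorem trace_doubleCommutator (x y : Matrix n n K) :
    LinearMap.trace K _ (doubleCommutator x y) =
      2 * Fintype.card n * (x * y).trace - 2 * x.trace * y.trace := by
  simp only [doubleCommutator, map_add, map_sub, trace_matrixMulMul, Matrix.trace_one,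
    Matrix.trace_mul_comm y x]
  ring

variable [CharZero K]

/-- The projection of matrices onto skew-symmetric ones. -/
def skewPart : Matrix n n K →ₗ[K] LieAlgebra.Orthogonal.so n K where
  toFun w := ⟨(1 / 2 : K) • (w - w.transpose), by
    rw [LieAlgebra.Orthogonal.mem_so, Matrix.transpose_smul, Matrix.transpose_sub,
      Matrix.transpose_transpose, ← smul_neg, neg_sub]⟩
  map_add' w z := Subtype.ext <| by
    change (1 / 2 : K) • (w + z - (w + z).transpose) =
      (1 / 2 : K) • (w - w.transpose) + (1 / 2 : K) • (z - z.transpose)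
    rw [Matrix.transpose_add, ← smul_add, add_sub_add_comm]
  map_smul' c w := Subtype.ext <| by
    change (1 / 2 : K) • (c • w - (c • w).transpose) = c • (1 / 2 : K) • (w - w.transpose)
    rw [Matrix.transpose_smul, ← smul_sub, smul_comm]

/-- With `ι` the inclusion into all matrices, `ad x ∘ ad y = skewPart ∘ f ∘ ι`, where `f` is the
double commutator. Cyclicity of the trace gives `tr (f ∘ ι ∘ skewPart)`, and `ι ∘ skewPart` is half
of identity minus transposition. The two halves contribute `n tr(xy)` and `-2 tr(xy)`. -/
theorem killingForm_so (x y : LieAlgebra.Orthogonal.so n K) :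
    killingForm K _ x y = ((Fintype.card n : K) - 2) * (x.val * y.val).trace := by
  have hx := (LieAlgebra.Orthogonal.mem_so n K x.val).1 x.2
  have hy := (LieAlgebra.Orthogonal.mem_so n K y.val).1 y.2
  have hxt : x.val.trace = 0 := by
    have := congrArg Matrix.trace hx
    rw [Matrix.trace_transpose, Matrix.trace_neg] at this
    exact self_eq_neg.1 this
  set ι : LieAlgebra.Orthogonal.so n K →ₗ[K] Matrix n n K :=
    ⟨⟨Subtype.val, fun _ _ => rfl⟩, fun _ _ => rfl⟩
  have h1 : LieAlgebra.ad K _ x ∘ₗ LieAlgebra.ad K _ y =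
      skewPart ∘ₗ (doubleCommutator x.val y.val ∘ₗ ι) := by
    refine LinearMap.ext fun w => Subtype.ext ?_
    have hw : x.val * (y.val * w.val - w.val * y.val) - (y.val * w.val - w.val * y.val) * x.val ∈
      LieAlgebra.Orthogonal.so n K := ⁅x, ⁅y, w⁆⁆.2
    rw [LieAlgebra.Orthogonal.mem_so] at hw
    change x.val * (y.val * w.val - w.val * y.val) - (y.val * w.val - w.val * y.val) * x.val =
      (1 / 2 : K) • (doubleCommutator x.val y.val w.val -
        (doubleCommutator x.val y.val w.val).transpose)
    rw [doubleCommutator_apply, hw, sub_neg_eq_add, ← two_smul K, smul_smul]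
    norm_num
  have h2 : (doubleCommutator x.val y.val ∘ₗ ι) ∘ₗ skewPart = (1 / 2 : K) •
      (doubleCommutator x.val y.val - doubleCommutator x.val y.val ∘ₗ
        (Matrix.transposeLinearEquiv n n K K : Matrix n n K →ₗ[K] Matrix n n K)) := by
    refine LinearMap.ext fun w => ?_
    change doubleCommutator x.val y.val ((1 / 2 : K) • (w - w.transpose)) = _
    rw [map_smul, map_sub]
    rfl
  have h3 : LinearMap.trace K _ (doubleCommutator x.val y.val ∘ₗ
      (Matrix.transposeLinearEquiv n n K K : Matrix n n K →ₗ[K] Matrix n n K)) =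
      4 * (x.val * y.val).trace := by
    simp only [doubleCommutator, LinearMap.add_comp, LinearMap.sub_comp, map_add, map_sub,
      trace_matrixMulMul_transpose, Matrix.transpose_one, Matrix.transpose_mul, hx, hy,
      Matrix.mul_neg, Matrix.trace_neg, Matrix.mul_one, Matrix.one_mul, Matrix.neg_mul, neg_neg,
      Matrix.trace_mul_comm y.val x.val]
    ring
  rw [killingForm_apply_apply, h1, LinearMap.trace_comp_comm', h2, map_smul, map_sub,
    trace_doubleCommutator, h3, hxt, smul_eq_mul]
  ring

/-- Pairing with the skew part of the matrix unit `E_ji` reads off the entry `x_ij`. -/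
theorem isKilling_so (hn : Fintype.card n ≠ 2) :
    LieAlgebra.IsKilling K (LieAlgebra.Orthogonal.so n K) := by
  refine isKilling_of_forall fun x hx => Subtype.ext ?_
  have hc : (Fintype.card n : K) - 2 ≠ 0 := sub_ne_zero.2 (by exact_mod_cast hn)
  ext i j
  have hxs := congrFun (congrFun ((LieAlgebra.Orthogonal.mem_so n K x.val).1 x.2) i) j
  have h := hx (skewPart (Matrix.single j i 1))
  rw [killingForm_so, mul_eq_zero, or_iff_right hc] at h
  change (x.val * ((1 / 2 : K) • (Matrix.single j i 1 - (Matrix.single j i 1).transpose))).trace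
    = 0 at h
  rw [Matrix.transpose_single, Matrix.mul_smul, Matrix.trace_smul, Matrix.mul_sub,
    Matrix.trace_sub, Matrix.trace_mul_single, Matrix.trace_mul_single] at h
  simp at h hxs ⊢
  linear_combination (1 / 2 : K) * h + (1 / 2 : K) * hxs

/-- The projection of matrices onto trace-free ones. -/
def traceFreePart : Matrix (Fin 2) (Fin 2) K →ₗ[K] LieAlgebra.SpecialLinear.sl (Fin 2) K where
  toFun w := ⟨w - (w.trace / 2) • 1, by
    change Matrix.trace (w - (w.trace / 2) • (1 : Matrix (Fin 2) (Fin 2) K)) = 0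
    rw [Matrix.trace_sub, Matrix.trace_smul, Matrix.trace_one]
    simp⟩
  map_add' w z := Subtype.ext <| by
    change w + z - ((w + z).trace / 2) • (1 : Matrix (Fin 2) (Fin 2) K) =
      (w - (w.trace / 2) • 1) + (z - (z.trace / 2) • 1)
    rw [Matrix.trace_add, add_div, add_smul, add_sub_add_comm]
  map_smul' c w := Subtype.ext <| by
    change c • w - ((c • w).trace / 2) • (1 : Matrix (Fin 2) (Fin 2) K) =
      c • (w - (w.trace / 2) • 1)
    rw [Matrix.trace_smul, smul_eq_mul, mul_div_assoc, mul_smul, smul_sub]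

/-- Same method as for `killingForm_so`. The double commutator kills the identity matrix, so
composing it with the trace-free projection changes nothing. -/
theorem killingForm_sl_two (x y : LieAlgebra.SpecialLinear.sl (Fin 2) K) :
    killingForm K _ x y = 4 * (x.val * y.val).trace := by
  have hxt : x.val.trace = 0 := x.2
  set ι : LieAlgebra.SpecialLinear.sl (Fin 2) K →ₗ[K] Matrix (Fin 2) (Fin 2) K :=
    ⟨⟨Subtype.val, fun _ _ => rfl⟩, fun _ _ => rfl⟩
  have h1 : LieAlgebra.ad K _ x ∘ₗ LieAlgebra.ad K _ y =
      traceFreePart ∘ₗ (doubleCommutator x.val y.val ∘ₗ ι) := by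
    refine LinearMap.ext fun w => Subtype.ext ?_
    have hw : (x.val * (y.val * w.val - w.val * y.val) -
      (y.val * w.val - w.val * y.val) * x.val).trace = 0 := ⁅x, ⁅y, w⁆⁆.2
    change x.val * (y.val * w.val - w.val * y.val) - (y.val * w.val - w.val * y.val) * x.val =
      doubleCommutator x.val y.val w.val - ((doubleCommutator x.val y.val w.val).trace / 2) • 1
    rw [doubleCommutator_apply, hw, zero_div, zero_smul, sub_zero]
  have h2 : (doubleCommutator x.val y.val ∘ₗ ι) ∘ₗ traceFreePart =
      doubleCommutator x.val y.val := by
    refine LinearMap.ext fun w => ?_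
    change doubleCommutator x.val y.val (w - (w.trace / 2) • 1) = _
    rw [map_sub, map_smul, doubleCommutator_apply x.val y.val 1]
    simp
  rw [killingForm_apply_apply, h1, LinearMap.trace_comp_comm', h2,
    trace_doubleCommutator, hxt, Fintype.card_fin]
  push_cast
  ring

theorem isKilling_sl_two : LieAlgebra.IsKilling K (LieAlgebra.SpecialLinear.sl (Fin 2) K) := by
  refine isKilling_of_forall fun x hx => Subtype.ext ?_
  have hxt : x.val 0 0 + x.val 1 1 = 0 := by
    rw [← Matrix.trace_fin_two]
    exact x.2
  have h : ∀ i j, (x.val * (Matrix.single j i 1 - ((Matrix.single j i (1 : K)).trace / 2) • 1)).trace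
      = 0 := by
    intro i j
    have := hx (traceFreePart (Matrix.single j i 1))
    rw [killingForm_sl_two, mul_eq_zero, or_iff_right (by norm_num)] at this
    exact this
  have h0 : x.val.trace = 0 := x.2
  ext i j
  have := h i j
  rw [Matrix.mul_sub, Matrix.trace_sub, Matrix.mul_smul, Matrix.trace_smul, Matrix.mul_one, h0,
    smul_zero, sub_zero, Matrix.trace_mul_single] at this
  simpa using this

end KillingForms

/-! ### Dimensions of `𝔰𝔩₂` and `𝔰𝔬(m)` -/

section Dimensions

variable {K : Type*} [Field K]

/-- A trace-free `2 × 2` matrix is determined by three entries. -/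
def slTwoEquiv : LieAlgebra.SpecialLinear.sl (Fin 2) K ≃ₗ[K] K × K × K where
  toFun x := (x.val 0 0, x.val 0 1, x.val 1 0)
  map_add' _ _ := rfl
  map_smul' _ _ := rfl
  invFun a := ⟨!![a.1, a.2.1; a.2.2, -a.1], by
    change Matrix.trace !![a.1, a.2.1; a.2.2, -a.1] = 0
    rw [Matrix.trace_fin_two]
    simp⟩
  left_inv x := Subtype.ext <| by
    have hxt : x.val 0 0 + x.val 1 1 = 0 := by
      rw [← Matrix.trace_fin_two]
      exact x.2
    ext i j
    fin_cases i <;> fin_cases j <;> simp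
    linear_combination -hxt
  right_inv a := by simp

/-- A skew-symmetric matrix is determined by its entries below the diagonal. -/
def soEquiv [CharZero K] (m : ℕ) :
    LieAlgebra.Orthogonal.so (Fin m) K ≃ₗ[K] ((Σ i : Fin m, Fin i) → K) where
  toFun x p := x.val p.1 ⟨p.2, p.2.2.trans p.1.2⟩
  map_add' _ _ := rfl
  map_smul' _ _ := rfl
  invFun a := ⟨Matrix.of fun i j => if h : j < i then a ⟨i, ⟨j, h⟩⟩ else
      if h : i < j then -a ⟨j, ⟨i, h⟩⟩ else 0, by
    rw [LieAlgebra.Orthogonal.mem_so]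
    ext i j
    simp only [Matrix.transpose_apply, Matrix.of_apply, Matrix.neg_apply]
    rcases lt_trichotomy i j with h | h | h
    · simp [h, h.not_gt]
    · simp [h]
    · simp [h, h.not_gt]⟩
  left_inv x := Subtype.ext <| by
    have hx := fun i j => congrFun (congrFun
      ((LieAlgebra.Orthogonal.mem_so (Fin m) K x.val).1 x.2) i) j
    ext i j
    rcases lt_trichotomy i j with h | h | h
    · simp [h, h.not_gt]
      have := hx i j
      simp at this
      rw [this, neg_neg]
    · subst h
      have := hx i i
      simp at this ⊢
      exact (self_eq_neg.1 this).symm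
    · simp [h]
  right_inv a := by
    ext ⟨i, j⟩
    have : (⟨j, j.2.trans i.2⟩ : Fin m) < i := j.2
    simp [this]

theorem finrank_slTwo_prod_so [CharZero K] (m : ℕ) :
    (Module.finrank K (LieAlgebra.SpecialLinear.sl (Fin 2) K ×
      LieAlgebra.Orthogonal.so (Fin m) K) : ℚ) = ((m : ℚ) ^ 2 - m + 6) / 2 := by
  have h : (∑ i : Fin m, (i : ℕ)) * 2 = m * (m - 1) := by
    rw [Fin.sum_univ_eq_sum_range (fun i => i) m, Finset.sum_range_id_mul_two]
  have hq : ((∑ i : Fin m, (i : ℕ) : ℕ) : ℚ) * 2 = (m : ℚ) ^ 2 - m := by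
    have := congrArg (Nat.cast : ℕ → ℚ) h
    rcases m with _ | m
    · simp
    · rw [Nat.cast_mul] at this
      rw [Nat.cast_ofNat] at this
      rw [this]
      push_cast
      ring_nf
  rw [(slTwoEquiv.prodCongr (soEquiv m)).finrank_eq, Module.finrank_prod, Module.finrank_prod,
    Module.finrank_prod, Module.finrank_fintype_fun_eq_card, Fintype.card_sigma,
    Module.finrank_self]
  simp only [Fintype.card_fin]
  push_cast at hq ⊢
  linear_combination hq / 2

end Dimensions

/-! ### Lie algebra structure of the variational symmetries -/

section Algebra

variable {K : Type*} [Field K] {m : ℕ} {B R : Type*} [CommRing B] [Algebra K B]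
  [CommRing R] [Algebra K R] {S : Coords K m B R}

theorem vectorField_add (ξ η : R) (ψ φ : Fin m → R) :
    vectorField S ξ ψ + vectorField S η φ = vectorField S (ξ + η) fun j => ψ j + φ j := by
  ext f
  simp only [Derivation.add_apply, vectorField_apply, add_mul, Finset.sum_add_distrib]
  ring

theorem smul_vectorField (c : K) (ξ : R) (ψ : Fin m → R) :
    c • vectorField S ξ ψ = vectorField S (c • ξ) fun j => c • ψ j := by
  ext f
  simp only [Derivation.smul_apply, vectorField_apply, smul_add, Finset.smul_sum, smul_mul_assoc]

/-- The second-order part of the composite of two fields is symmetric in them, because the partial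
derivatives commute, and drops out of the commutator. -/
theorem lie_vectorField (hS : Regular S) (ξ η : R) (ψ φ : Fin m → R) :
    ⁅vectorField S ξ ψ, vectorField S η φ⁆ =
      vectorField S (vectorField S ξ ψ η - vectorField S η φ ξ) fun j =>
        vectorField S ξ ψ (φ j) - vectorField S η φ (ψ j) := by
  have key : ∀ (ξ η : R) (ψ φ : Fin m → R) (f : R), vectorField S ξ ψ (vectorField S η φ f) =
      vectorField S (vectorField S ξ ψ η) (fun j => vectorField S ξ ψ (φ j)) f +
        (ξ * η * S.dx (S.dx f) + ∑ j, (ξ * φ j + η * ψ j) * S.dx (S.dy j f) +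
          ∑ j, ∑ k, φ j * ψ k * S.dy k (S.dy j f)) := by
    intro ξ η ψ φ f
    rw [vectorField_apply (S := S) η φ f, map_add, map_sum]
    simp only [Derivation.leibniz, smul_eq_mul]
    rw [vectorField_apply (S := S) (vectorField S ξ ψ η)]
    have h1 : vectorField S ξ ψ (S.dx f) =
        ξ * S.dx (S.dx f) + ∑ j, ψ j * S.dx (S.dy j f) := by
      rw [vectorField_apply]
      simp only [hS.dy_dx]
    have h2 : ∀ j, φ j * vectorField S ξ ψ (S.dy j f) =
        ξ * φ j * S.dx (S.dy j f) + ∑ k, φ j * ψ k * S.dy k (S.dy j f) := by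
      intro j
      rw [vectorField_apply, mul_add, Finset.mul_sum]
      simp only [mul_assoc]
      ring
    simp only [h1, h2, Finset.sum_add_distrib, mul_add, Finset.mul_sum, add_mul]
    simp only [mul_assoc, mul_comm (S.dx f), mul_comm (S.dy _ f)]
    ring
  ext f
  rw [Derivation.commutator_apply, key, key]
  have hsymm : ∑ j, ∑ k, φ j * ψ k * S.dy k (S.dy j f) =
      ∑ j, ∑ k, ψ j * φ k * S.dy k (S.dy j f) := by
    rw [Finset.sum_comm]
    refine Finset.sum_congr rfl fun j _ => Finset.sum_congr rfl fun k _ => ?_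
    rw [hS.dy_dy]
    ring
  have hmix : ∑ j, (ξ * φ j + η * ψ j) * S.dx (S.dy j f) =
      ∑ j, (η * ψ j + ξ * φ j) * S.dx (S.dy j f) :=
    Finset.sum_congr rfl fun j _ => by ring
  rw [hsymm, hmix]
  simp only [vectorField_apply _ _ f, sub_mul, Finset.sum_sub_distrib]
  ring

/-- The vector field `ξ ∂_x + (n-1)/2 ξ' ∑ y_j ∂_j` of a function `ξ` of `x`. -/
def flowField (S : Coords K m B R) (n : ℕ) : B →ₗ[K] Derivation K R R where
  toFun ξ := vectorField S (S.incl ξ) fun j =>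
    algebraMap K R (((n : K) - 1) / 2) * S.incl (S.d ξ) * S.y j
  map_add' ξ η := by
    rw [vectorField_add]
    simp only [map_add, mul_add, add_mul]
  map_smul' c ξ := by
    rw [RingHom.id_apply, smul_vectorField]
    simp only [map_smul, Derivation.map_smul, mul_smul_comm, smul_mul_assoc]

theorem flowField_apply (n : ℕ) (ξ : B) :
    flowField S n ξ = vectorField S (S.incl ξ) fun j =>
      algebraMap K R (((n : K) - 1) / 2) * S.incl (S.d ξ) * S.y j := rfl

/-- The vector field `∑ Ω_ij y_i ∂_j` of a matrix `Ω`. -/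
def linearField (S : Coords K m B R) : Matrix (Fin m) (Fin m) K →ₗ[K] Derivation K R R where
  toFun Ω := vectorField S 0 fun j => ∑ i, algebraMap K R (Ω i j) * S.y i
  map_add' Ω Ω' := by
    rw [vectorField_add, add_zero]
    simp only [Matrix.add_apply, map_add, add_mul, Finset.sum_add_distrib]
  map_smul' c Ω := by
    rw [RingHom.id_apply, smul_vectorField, smul_zero]
    simp only [Matrix.smul_apply, smul_eq_mul, map_mul, Finset.mul_sum, Algebra.smul_def,
      mul_assoc]

theorem linearField_apply (Ω : Matrix (Fin m) (Fin m) K) :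
    linearField S Ω = vectorField S 0 fun j => ∑ i, algebraMap K R (Ω i j) * S.y i := rfl

theorem lie_flowField (hS : Regular S) (n : ℕ) (ξ η : B) :
    ⁅flowField S n ξ, flowField S n η⁆ = flowField S n (ξ * S.d η - η * S.d ξ) := by
  rw [flowField_apply, flowField_apply, lie_vectorField hS, flowField_apply]
  congr 1
  · simp only [vectorField_incl hS, map_sub, map_mul]
  · ext j
    simp only [vectorField_incl hS, Derivation.leibniz, vectorField_y hS,
      Derivation.map_algebraMap, smul_eq_mul, map_sub, map_mul, map_add]
    ring

theorem vectorField_linear (hS : Regular S) (ξ : R) (ψ : Fin m → R)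
    (Ω : Matrix (Fin m) (Fin m) K) (j : Fin m) :
    vectorField S ξ ψ (∑ i, algebraMap K R (Ω i j) * S.y i) =
      ∑ i, algebraMap K R (Ω i j) * ψ i := by
  simp only [map_sum, Derivation.leibniz, Derivation.map_algebraMap, smul_eq_mul, mul_zero,
    add_zero, vectorField_y hS]

/-- With the first index of `Ω` on `y_i` and the second on `∂_j`, the map to vector fields preserves
brackets without a sign. -/
theorem lie_linearField (hS : Regular S) (Ω Ω' : Matrix (Fin m) (Fin m) K) :
    ⁅linearField S Ω, linearField S Ω'⁆ = linearField S (Ω * Ω' - Ω' * Ω) := by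
  have key : ∀ (Ω Ω' : Matrix (Fin m) (Fin m) K) j,
      ∑ i, algebraMap K R (Ω' i j) * ∑ k, algebraMap K R (Ω k i) * S.y k =
        ∑ k, algebraMap K R ((Ω * Ω') k j) * S.y k := by
    intro Ω Ω' j
    simp only [Finset.mul_sum, Matrix.mul_apply, map_sum, Finset.sum_mul, map_mul]
    rw [Finset.sum_comm]
    exact Finset.sum_congr rfl fun k _ => Finset.sum_congr rfl fun i _ => by ring
  rw [linearField_apply, linearField_apply, lie_vectorField hS, linearField_apply]
  congr 1
  · simp only [map_zero, sub_zero]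
  · ext j
    simp only [vectorField_linear hS, key, Matrix.sub_apply, map_sub, sub_mul,
      Finset.sum_sub_distrib]

/-- A linear field with constant coefficients commutes with `∂_x` and with the Euler field `∑ y_j
∂_j`, and annihilates functions of `x`. -/
theorem lie_flowField_linearField (hS : Regular S) (n : ℕ) (ξ : B)
    (Ω : Matrix (Fin m) (Fin m) K) : ⁅flowField S n ξ, linearField S Ω⁆ = 0 := by
  have h0 : vectorField S 0 (fun _ : Fin m => (0 : R)) = 0 := by
    ext f
    simp [vectorField_apply]
  rw [← h0]
  simp only [flowField_apply, linearField_apply, lie_vectorField hS, vectorField_linear hS,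
    vectorField_incl hS, Derivation.leibniz, vectorField_y hS, Derivation.map_algebraMap,
    smul_eq_mul, map_zero]
  congr 1
  · ring
  · ext j
    rw [mul_zero, add_zero, zero_mul, mul_zero, mul_zero, add_zero, Finset.mul_sum, sub_eq_zero]
    exact Finset.sum_congr rfl fun i _ => by ring

variable {n : ℕ} {A : ℕ → B} {q u v : B}

/-- The quadratic expression in `u`, `v` that corresponds to a trace-free matrix. -/
def slQuadratic (u v : B) : LieAlgebra.SpecialLinear.sl (Fin 2) K →ₗ[K] B where
  toFun x := (-x.val 1 0) • u ^ 2 + (2 * x.val 0 0) • (u * v) + x.val 0 1 • v ^ 2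
  map_add' x y := by
    change (-(x.val 1 0 + y.val 1 0)) • u ^ 2 + (2 * (x.val 0 0 + y.val 0 0)) • (u * v) +
      (x.val 0 1 + y.val 0 1) • v ^ 2 = _
    simp only [neg_add, mul_add, add_smul]
    abel
  map_smul' c x := by
    change (-(c * x.val 1 0)) • u ^ 2 + (2 * (c * x.val 0 0)) • (u * v) +
      (c * x.val 0 1) • v ^ 2 = _
    rw [RingHom.id_apply, smul_add, smul_add, smul_smul, smul_smul, smul_smul, mul_neg,
      mul_left_comm]

theorem slQuadratic_apply (u v : B) (x : LieAlgebra.SpecialLinear.sl (Fin 2) K) :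
    slQuadratic u v x =
      (-x.val 1 0) • u ^ 2 + (2 * x.val 0 0) • (u * v) + x.val 0 1 • v ^ 2 := rfl

theorem sl_two_apply_one_one (x : LieAlgebra.SpecialLinear.sl (Fin 2) K) :
    x.val 1 1 = -x.val 0 0 := by
  have hxt : x.val 0 0 + x.val 1 1 = 0 := by
    rw [← Matrix.trace_fin_two]
    exact x.2
  linear_combination hxt

/-- The standard basis `e, f, h` goes to `v²`, `-u²`, `2uv`, that is, to `F_p`, `F_m`, `F_z`. Each
bracket `ξ η' - η ξ'` contains one factor `uv' - u'v = 1`. -/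
theorem slQuadratic_lie {d : Derivation K B B} (hW : u * d v - d u * v = 1)
    (x y : LieAlgebra.SpecialLinear.sl (Fin 2) K) :
    slQuadratic u v ⁅x, y⁆ =
      slQuadratic u v x * d (slQuadratic u v y) - slQuadratic u v y * d (slQuadratic u v x) := by
  have h00 : ⁅x, y⁆.val 0 0 = x.val 0 1 * y.val 1 0 - y.val 0 1 * x.val 1 0 := by
    rw [LieAlgebra.SpecialLinear.sl_bracket, Matrix.sub_apply, Matrix.mul_apply,
      Matrix.mul_apply, Fin.sum_univ_two, Fin.sum_univ_two]
    ring
  have h01 : ⁅x, y⁆.val 0 1 = 2 * x.val 0 0 * y.val 0 1 - 2 * y.val 0 0 * x.val 0 1 := by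
    rw [LieAlgebra.SpecialLinear.sl_bracket, Matrix.sub_apply, Matrix.mul_apply,
      Matrix.mul_apply, Fin.sum_univ_two, Fin.sum_univ_two, sl_two_apply_one_one,
      sl_two_apply_one_one]
    ring
  have h10 : ⁅x, y⁆.val 1 0 = 2 * x.val 1 0 * y.val 0 0 - 2 * y.val 1 0 * x.val 0 0 := by
    rw [LieAlgebra.SpecialLinear.sl_bracket, Matrix.sub_apply, Matrix.mul_apply,
      Matrix.mul_apply, Fin.sum_univ_two, Fin.sum_univ_two, sl_two_apply_one_one,
      sl_two_apply_one_one]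
    ring
  simp only [slQuadratic_apply, h00, h01, h10]
  simp only [map_add, Derivation.map_smul, sq, Derivation.leibniz, smul_eq_mul]
  simp only [Algebra.smul_def, map_neg, map_sub, map_mul, map_ofNat]
  set a := algebraMap K B (x.val 0 0)
  set b := algebraMap K B (x.val 0 1)
  set c := algebraMap K B (x.val 1 0)
  set a' := algebraMap K B (y.val 0 0)
  set b' := algebraMap K B (y.val 0 1)
  set c' := algebraMap K B (y.val 1 0)
  linear_combination -(2 * (c' * a - c * a') * (u * u) + 2 * (b * c' - b' * c) * (u * v) +
    2 * (a * b' - a' * b) * (v * v)) * hW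

/-- The homomorphism of `𝔰𝔩₂` onto `𝔤_F`. -/
def slHom (hS : Regular S) (n : ℕ) (h : IsNormalizedBasis S.d q u v) :
    LieAlgebra.SpecialLinear.sl (Fin 2) K →ₗ⁅K⁆ Derivation K R R :=
  { flowField S n ∘ₗ slQuadratic u v with
    map_lie' := fun {x y} => by
      change flowField S n (slQuadratic u v ⁅x, y⁆) =
        ⁅flowField S n (slQuadratic u v x), flowField S n (slQuadratic u v y)⁆
      rw [lie_flowField hS, slQuadratic_lie h.2.2] }

theorem slHom_apply (hS : Regular S) (h : IsNormalizedBasis S.d q u v)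
    (x : LieAlgebra.SpecialLinear.sl (Fin 2) K) :
    slHom hS n h x = flowField S n (slQuadratic u v x) := rfl

/-- The homomorphism of `𝔰𝔬(m)` onto the span of the rotations. -/
def soHom (hS : Regular S) : LieAlgebra.Orthogonal.so (Fin m) K →ₗ⁅K⁆ Derivation K R R where
  toFun x := linearField S x.val
  map_add' x y := (linearField S).map_add x.val y.val
  map_smul' c x := (linearField S).map_smul c x.val
  map_lie' := fun {x y} => by
    change linearField S (x.val * y.val - y.val * x.val) = _
    rw [lie_linearField hS]

theorem soHom_apply (hS : Regular S) (x : LieAlgebra.Orthogonal.so (Fin m) K) :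
    soHom hS x = linearField S x.val := rfl

/-- The homomorphism of `𝔰𝔩₂ × 𝔰𝔬(m)` onto the variational symmetries. -/
def symmetryHom (hS : Regular S) (n : ℕ) (h : IsNormalizedBasis S.d q u v) :
    (LieAlgebra.SpecialLinear.sl (Fin 2) K × LieAlgebra.Orthogonal.so (Fin m) K) →ₗ⁅K⁆
      Derivation K R R :=
  { (slHom hS n h : _ →ₗ[K] Derivation K R R).coprod (soHom hS : _ →ₗ[K] Derivation K R R) with
    map_lie' := fun {x y} => by
      change slHom hS n h ⁅x.1, y.1⁆ + soHom hS ⁅x.2, y.2⁆ =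
        ⁅slHom hS n h x.1 + soHom hS x.2, slHom hS n h y.1 + soHom hS y.2⁆
      have h1 : ∀ a b, ⁅slHom hS n h a, soHom hS b⁆ = 0 := fun a b =>
        lie_flowField_linearField hS n _ _
      have h2 : ∀ a b, ⁅soHom hS b, slHom hS n h a⁆ = 0 := fun a b => by
        rw [← lie_skew, h1, neg_zero]
      rw [LieHom.map_lie, LieHom.map_lie, add_lie, lie_add, lie_add, h1, h2, add_zero, zero_add] }

theorem symmetryHom_apply (hS : Regular S) (h : IsNormalizedBasis S.d q u v)
    (x : LieAlgebra.SpecialLinear.sl (Fin 2) K × LieAlgebra.Orthogonal.so (Fin m) K) :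
    symmetryHom hS n h x = slHom hS n h x.1 + soHom hS x.2 := rfl

theorem symmetryHom_eq_vectorField (hS : Regular S) (h : IsNormalizedBasis S.d q u v)
    (x : LieAlgebra.SpecialLinear.sl (Fin 2) K × LieAlgebra.Orthogonal.so (Fin m) K) :
    symmetryHom hS n h x = vectorField S (S.incl (slQuadratic u v x.1)) fun j =>
      algebraMap K R (((n : K) - 1) / 2) * S.incl (S.d (slQuadratic u v x.1)) * S.y j +
        ∑ i, algebraMap K R (x.2.val i j) * S.y i := by
  rw [symmetryHom_apply, slHom_apply, soHom_apply, flowField_apply, linearField_apply,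
    vectorField_add, add_zero]

/-- The components are the values of the derivation on `x` and on the `y_j`. -/
theorem vectorField_inj (hS : Regular S) {ξ η : R} {ψ φ : Fin m → R}
    (h : vectorField S ξ ψ = vectorField S η φ) : ξ = η ∧ ψ = φ := by
  obtain ⟨t, ht⟩ := hS.exists_x
  constructor
  · have := congrArg (fun D => D (S.incl t)) h
    simpa only [vectorField_incl hS, ht, map_one, mul_one] using this
  · ext j
    have := congrArg (fun D => D (S.y j)) h
    simpa only [vectorField_y hS] using this

/-- The first integrals of `exists_quadratic`, evaluated on the zero solution, return the
coefficients. -/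
theorem incl_quadratic_eq_zero [CharZero K] (hS : Regular S) (h : IsNormalizedBasis S.d q u v)
    {a b c : K} (h0 : S.incl (a • u ^ 2 + b • (u * v) + c • v ^ 2) = 0) :
    a = 0 ∧ b = 0 ∧ c = 0 := by
  obtain ⟨hu, hv, hW⟩ := h
  have hinj : Function.Injective (algebraMap K R) := by
    have := hS.nontrivial
    exact (algebraMap K R).injective
  have cancel : ∀ c : K, 2 * algebraMap K R c = 0 → c = 0 := by
    intro c hc
    rw [← map_ofNat (algebraMap K R) 2, ← map_mul, map_eq_zero_iff _ hinj] at hc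
    simpa using hc
  have hW' : S.incl u * S.incl (S.d v) - S.incl (S.d u) * S.incl v = 1 := by
    simpa only [map_sub, map_mul, map_one] using congrArg S.incl hW
  have hu' : S.incl (S.d (S.d u)) = -(S.incl q * S.incl u) := by
    rw [← map_mul, ← map_neg]
    exact congrArg _ (eq_neg_of_add_eq_zero_left hu)
  have hv' : S.incl (S.d (S.d v)) = -(S.incl q * S.incl v) := by
    rw [← map_mul, ← map_neg]
    exact congrArg _ (eq_neg_of_add_eq_zero_left hv)
  have h1 := congrArg S.dx h0
  have h2 := congrArg S.dx h1
  rw [hS.dx_incl, map_zero] at h1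
  rw [hS.dx_incl, hS.dx_incl, map_zero, map_zero] at h2
  simp only [map_add, map_smul, Derivation.map_smul, sq, Derivation.leibniz, smul_eq_mul,
    map_mul, hu', hv'] at h0 h1 h2
  simp only [Algebra.smul_def] at h0 h1 h2
  set U := S.incl u
  set V := S.incl v
  set U' := S.incl (S.d u)
  set V' := S.incl (S.d v)
  set Q := S.incl q
  refine ⟨cancel a ?_, cancel b ?_, cancel c ?_⟩
  · linear_combination 2 * V' ^ 2 * h0 - 2 * V * V' * h1 + V ^ 2 * (h2 + 2 * Q * h0) -
      2 * algebraMap K R a * (U * V' - U' * V + 1) * hW'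
  · linear_combination -4 * U' * V' * h0 + 2 * (U * V' + U' * V) * h1 -
      2 * U * V * (h2 + 2 * Q * h0) - 2 * algebraMap K R b * (U * V' - U' * V + 1) * hW'
  · linear_combination 2 * U' ^ 2 * h0 - 2 * U * U' * h1 + U ^ 2 * (h2 + 2 * Q * h0) -
      2 * algebraMap K R c * (U * V' - U' * V + 1) * hW'

theorem symmetryHom_injective [CharZero K] (hS : Regular S) (h : IsNormalizedBasis S.d q u v) :
    Function.Injective (symmetryHom hS n h) := by
  rw [injective_iff_map_eq_zero]
  intro x hx
  have h0 : vectorField S 0 (fun _ : Fin m => (0 : R)) = 0 := by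
    ext f
    simp [vectorField_apply]
  rw [symmetryHom_eq_vectorField, ← h0] at hx
  obtain ⟨h1, h2⟩ := vectorField_inj hS hx
  obtain ⟨ha, hb, hc⟩ := incl_quadratic_eq_zero hS h h1
  have hd : S.incl (S.d (slQuadratic u v x.1)) = 0 := by rw [← hS.dx_incl, h1, map_zero]
  have hinj : Function.Injective (algebraMap K R) := by
    have := hS.nontrivial
    exact (algebraMap K R).injective
  refine Prod.ext (Subtype.ext ?_) (Subtype.ext ?_)
  · have h00 : x.1.val 0 0 = 0 := by simpa using hb
    ext i j
    fin_cases i <;> fin_cases j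
    · exact h00
    · exact hc
    · exact neg_eq_zero.1 ha
    · exact (sl_two_apply_one_one x.1).trans (by rw [h00, neg_zero]; rfl)
  · ext i j
    have h3 := congrArg (S.dy i) (congrFun h2 j)
    simp only [hd, mul_zero, zero_mul, zero_add, map_sum, Derivation.leibniz, hS.dy_y,
      Derivation.map_algebraMap, smul_eq_mul, add_zero, map_zero, mul_ite, mul_one,
      Finset.sum_ite_eq, Finset.mem_univ, if_true] at h3
    exact (map_eq_zero_iff _ hinj).1 h3

theorem range_symmetryHom [CharZero K] (hS : Regular S) (hm : 1 ≤ m) (hn : 2 ≤ n)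
    (hL : IsSymmetricPower S.d n A q) (h : IsNormalizedBasis S.d q u v) :
    ((symmetryHom hS n h).range : Set (Derivation K R R)) = variationalSymmetries S n A := by
  have h2c : 2 * algebraMap K R (((n : K) - 1) / 2) = (n : R) - 1 := by
    rw [← map_ofNat (algebraMap K R) 2, ← map_mul, mul_div_cancel₀ _ two_ne_zero]
    simp
  have hcast : ∀ b, S.incl (((n : B) - 1) * b) = ((n : R) - 1) * S.incl b := fun b => by simp
  ext w
  rw [SetLike.mem_coe, LieHom.mem_range]
  constructor
  · rintro ⟨x, rfl⟩
    refine ⟨_, _, symmetryHom_eq_vectorField hS h x, ?_⟩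
    rw [mem_variationalSymmetries_iff hS hm hn hL h]
    refine ⟨-x.1.val 1 0, 2 * x.1.val 0 0, x.1.val 0 1, x.2.val,
      (LieAlgebra.Orthogonal.mem_so _ _ _).1 x.2.2, rfl, fun j => ?_⟩
    rw [← slQuadratic_apply, hcast]
    linear_combination S.incl (S.d (slQuadratic u v x.1)) * S.y j * h2c
  · rintro ⟨ξ, ψ, rfl, hsym⟩
    rw [mem_variationalSymmetries_iff hS hm hn hL h] at hsym
    obtain ⟨a, b, c, Ω, hΩ, rfl, hψ⟩ := hsym
    -- `slTwoEquiv` lists the entries `x₀₀, x₀₁, x₁₀`; they solve `2 x₀₀ = b`, `x₀₁ = c`, `-x₁₀ =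
    -- a`.
    have hq : slQuadratic u v (slTwoEquiv.symm (b / 2, c, -a)) =
        a • u ^ 2 + b • (u * v) + c • v ^ 2 := by
      change (-(-a)) • u ^ 2 + (2 * (b / 2)) • (u * v) + c • v ^ 2 = _
      rw [neg_neg, mul_div_cancel₀ _ two_ne_zero]
    refine ⟨(slTwoEquiv.symm (b / 2, c, -a),
      ⟨Ω, (LieAlgebra.Orthogonal.mem_so _ _ _).2 hΩ⟩), ?_⟩
    rw [symmetryHom_eq_vectorField]
    simp only [hq]
    congr 1
    ext j
    refine sub_eq_zero.1 (natCast_mul_cancel (K := K) (c := 2) (by omega) ?_)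
    have := hψ j
    rw [hcast] at this
    push_cast
    linear_combination S.incl (S.d (a • u ^ 2 + b • (u * v) + c • v ^ 2)) * S.y j * h2c - this

theorem range_slHom [CharZero K] (hS : Regular S) (h : IsNormalizedBasis S.d q u v) :
    (slHom hS n h).range.toSubmodule = gF S n u v := by
  have h2c : 2 * algebraMap K R (((n : K) - 1) / 2) = (n : R) - 1 := by
    rw [← map_ofNat (algebraMap K R) 2, ← map_mul, mul_div_cancel₀ _ two_ne_zero]
    simp
  have hp : flowField S n (v ^ 2) = Fp S n v := by
    rw [flowField_apply, Fp]
    congr 1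
    ext j
    simp only [sq, Derivation.leibniz, map_add, map_mul, smul_eq_mul]
    linear_combination S.incl v * S.incl (S.d v) * S.y j * h2c
  have hmm : flowField S n (-u ^ 2) = Fm S n u := by
    rw [flowField_apply, Fm, map_neg]
    congr 1
    ext j
    simp only [sq, Derivation.leibniz, map_add, map_neg, map_mul, smul_eq_mul]
    linear_combination -S.incl u * S.incl (S.d u) * S.y j * h2c
  have hz : flowField S n ((2 : K) • (u * v)) = Fz S n u v := by
    rw [flowField_apply, Fz]
    congr 1
    · rw [map_smul, Algebra.smul_def, map_ofNat]
    · ext j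
      rw [Derivation.map_smul, map_smul, Algebra.smul_def (2 : K) (S.incl _)]
      simp only [Derivation.leibniz, map_add, map_mul, smul_eq_mul, map_ofNat]
      linear_combination (S.incl u * S.incl (S.d v) + S.incl (S.d u) * S.incl v) * S.y j * h2c
  have hq : ∀ x : LieAlgebra.SpecialLinear.sl (Fin 2) K, slHom hS n h x =
      x.val 0 1 • Fp S n v + x.val 1 0 • Fm S n u + x.val 0 0 • Fz S n u v := by
    intro x
    rw [slHom_apply, ← hp, ← hmm, ← hz, ← map_smul, ← map_smul, ← map_smul, ← map_add, ← map_add,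
      slQuadratic_apply]
    congr 1
    rw [smul_neg, neg_smul, smul_smul, mul_comm (x.val 0 0)]
    abel
  apply le_antisymm
  · rintro _ ⟨x, rfl⟩
    change slHom hS n h x ∈ _
    rw [hq]
    exact add_mem (add_mem (Submodule.smul_mem _ _ (Submodule.subset_span (by simp)))
      (Submodule.smul_mem _ _ (Submodule.subset_span (by simp))))
      (Submodule.smul_mem _ _ (Submodule.subset_span (by simp)))
  · rw [gF, Submodule.span_le]
    have hmem : ∀ a b c : K, a • Fp S n v + b • Fm S n u + c • Fz S n u v ∈
        (slHom hS n h).range := by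
      intro a b c
      exact LieHom.mem_range _ _ |>.2 ⟨slTwoEquiv.symm (c, a, b), hq _⟩
    rintro w (rfl | rfl | rfl)
    · simpa using hmem 1 0 0
    · simpa using hmem 0 1 0
    · simpa using hmem 0 0 1

theorem range_soHom [CharZero K] (hS : Regular S) :
    (soHom hS).range.toSubmodule = gRot S := by
  have hrot : ∀ i j, linearField S (Matrix.single i j (1 : K) - Matrix.single j i 1) =
      rotation S i j := by
    intro i j
    ext f
    rw [linearField_apply, vectorField_apply, rotation]
    simp only [Matrix.sub_apply, Matrix.single_apply, Derivation.sub_apply, Derivation.smul_apply,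
      smul_eq_mul, map_sub, sub_mul, zero_mul, zero_add, Finset.sum_sub_distrib]
    congr 1
    · rw [Finset.sum_eq_single j, Finset.sum_eq_single i] <;> simp +contextual [eq_comm]
    · rw [Finset.sum_eq_single i, Finset.sum_eq_single j] <;> simp +contextual [eq_comm]
  apply le_antisymm
  · rintro _ ⟨x, rfl⟩
    change linearField S x.val ∈ _
    have hx := (LieAlgebra.Orthogonal.mem_so _ _ _).1 x.2
    -- The sum runs over ordered pairs, so every rotation occurs twice; hence the factor `1/2`.
    have hsum : x.val = ∑ i, ∑ j, (x.val i j / 2) •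
        (Matrix.single i j (1 : K) - Matrix.single j i 1) := by
      ext k l
      have hkl : x.val l k = -x.val k l := congrFun (congrFun hx k) l
      simp only [Matrix.sum_apply, Matrix.smul_apply, Matrix.sub_apply, Matrix.single_apply,
        smul_eq_mul, mul_sub, Finset.sum_sub_distrib]
      have e1 : ∑ i, ∑ j, x.val i j / 2 * (if i = k ∧ j = l then 1 else 0) = x.val k l / 2 := by
        rw [Finset.sum_eq_single k, Finset.sum_eq_single l] <;> simp +contextual
      have e2 : ∑ i, ∑ j, x.val i j / 2 * (if j = k ∧ i = l then 1 else 0) = x.val l k / 2 := by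
        rw [Finset.sum_eq_single l, Finset.sum_eq_single k] <;> simp +contextual
      rw [e1, e2, hkl]
      ring
    rw [hsum]
    simp only [map_sum, map_smul, hrot]
    exact sum_mem fun i _ => sum_mem fun j _ =>
      Submodule.smul_mem _ _ (Submodule.subset_span ⟨(i, j), rfl⟩)
  · rw [gRot, Submodule.span_le]
    rintro _ ⟨⟨i, j⟩, rfl⟩
    refine LieHom.mem_range _ _ |>.2 ⟨⟨Matrix.single i j 1 - Matrix.single j i 1, ?_⟩, hrot i j⟩
    rw [LieAlgebra.Orthogonal.mem_so, Matrix.transpose_sub, Matrix.transpose_single,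
      Matrix.transpose_single, neg_sub]

theorem exists_eq_vectorField_of_mem_gS {w : Derivation K R R} (hS : Regular S)
    (hw : w ∈ gS S n u v) :
    ∃ ψ : Fin m → R, (∀ j k, S.dy k (ψ j) = 0) ∧ w = vectorField S 0 ψ := by
  induction hw using Submodule.span_induction with
  | mem w hw =>
    obtain ⟨⟨k, j⟩, rfl⟩ := hw
    refine ⟨Pi.single j (S.incl (u ^ (n - 1 - (k : ℕ)) * v ^ (k : ℕ))), fun i l => ?_, ?_⟩
    · rw [Pi.single_apply]
      split_ifs
      · exact hS.dy_incl _ _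
      · exact map_zero _
    · ext f
      rw [vectorField_apply, Finset.sum_eq_single j]
      · simp
      · intro i _ hij
        rw [Pi.single_eq_of_ne hij, zero_mul]
      · simp
  | zero =>
    refine ⟨fun _ => 0, fun _ _ => map_zero _, ?_⟩
    ext f
    simp [vectorField_apply]
  | add w z _ _ hw hz =>
    obtain ⟨ψ, hψ, rfl⟩ := hw
    obtain ⟨φ, hφ, rfl⟩ := hz
    exact ⟨fun j => ψ j + φ j, fun j k => by rw [map_add, hψ, hφ, add_zero], by
      rw [vectorField_add, add_zero]⟩
  | smul c w _ hw =>
    obtain ⟨ψ, hψ, rfl⟩ := hw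
    exact ⟨fun j => c • ψ j, fun j k => by rw [Derivation.map_smul, hψ, smul_zero], by
      rw [smul_vectorField, smul_zero]⟩

/-- With `ξ = 0` and `∂_j ψ_i = 0`, `linear_relation` reads `ψ_j = 0`. -/
theorem eq_zero_of_mem_gS [CharZero K] (hS : Regular S) (hn : 2 ≤ n) {w : Derivation K R R}
    (hw : w ∈ gS S n u v) (hw' : w ∈ variationalSymmetries S n A) : w = 0 := by
  obtain ⟨ψ, hψ, rfl⟩ := exists_eq_vectorField_of_mem_gS hS hw
  obtain ⟨ξ, φ, heq, -, hE⟩ := hw'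
  obtain ⟨rfl, rfl⟩ := vectorField_inj hS heq
  obtain ⟨r, rfl⟩ : ∃ r, n = r + 2 := ⟨n - 2, by omega⟩
  rw [varExpr_eq_zero_iff hS] at hE
  have hz : ∀ j, ψ j = 0 := fun j => by
    simpa [hψ] using linear_relation hS hE j
  ext f
  simp [vectorField_apply, hz]

/-- Everything is transported along `symmetryHom`; its injectivity makes the images of the two
factors disjoint. -/
theorem variationalAlgebraDecomposes [CharZero K] (hS : Regular S) (hm : 1 ≤ m) (hn : 2 ≤ n)
    (hL : IsSymmetricPower S.d n A q) (h : IsNormalizedBasis S.d q u v) :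
    VariationalAlgebraDecomposes S n A u v := by
  have hinj := symmetryHom_injective (n := n) hS h
  have hsl : Function.Injective (slHom hS n h) := fun x y hxy => by
    have := @hinj (x, 0) (y, 0) (by simp only [symmetryHom_apply, hxy])
    exact congrArg Prod.fst this
  have hso : Function.Injective (soHom hS) := fun x y hxy => by
    have := @hinj (0, x) (0, y) (by simp only [symmetryHom_apply, hxy])
    exact congrArg Prod.snd this
  have hfin : Module.Finite K (LieAlgebra.SpecialLinear.sl (Fin 2) K) :=
    Module.Finite.equiv slTwoEquiv.symm
  have hfin' : Module.Finite K (LieAlgebra.Orthogonal.so (Fin m) K) :=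
    Module.Finite.equiv (soEquiv m).symm
  let e := LieEquiv.ofInjective (symmetryHom hS n h) hinj
  have hfinV : Module.Finite K (symmetryHom hS n h).range := Module.Finite.equiv e.toLinearEquiv
  refine ⟨(symmetryHom hS n h).range, (slHom hS n h).range, (soHom hS).range,
    range_symmetryHom hS hm hn hL h, range_slHom hS h, range_soHom hS, ?_, ?_, ?_,
    ⟨(LieEquiv.ofInjective _ hsl).symm⟩, ⟨(LieEquiv.ofInjective _ hso).symm⟩, hfinV, ?_, ?_,
    fun w hw hw' => eq_zero_of_mem_gS hS hn hw hw'⟩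
  · rintro _ ⟨x, rfl⟩ _ ⟨y, rfl⟩
    exact lie_flowField_linearField hS n _ _
  · rw [Submodule.disjoint_def]
    rintro _ ⟨x, rfl⟩ ⟨y, hy⟩
    change soHom hS y = slHom hS n h x at hy
    change slHom hS n h x = 0
    have := @hinj (x, 0) (0, y) (by simp only [symmetryHom_apply, hy, map_zero, add_zero, zero_add])
    rw [show x = 0 from congrArg Prod.fst this, map_zero]
  · apply le_antisymm
    · rw [sup_le_iff]
      constructor
      · rintro _ ⟨x, rfl⟩
        exact ⟨(x, 0), by
          change symmetryHom hS n h (x, 0) = slHom hS n h x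
          rw [symmetryHom_apply, map_zero, add_zero]⟩
      · rintro _ ⟨x, rfl⟩
        exact ⟨(0, x), by
          change symmetryHom hS n h (0, x) = soHom hS x
          rw [symmetryHom_apply, map_zero, zero_add]⟩
    · rintro _ ⟨x, rfl⟩
      exact Submodule.add_mem_sup ⟨x.1, rfl⟩ ⟨x.2, rfl⟩
  · rw [← e.toLinearEquiv.finrank_eq]
    exact finrank_slTwo_prod_so m
  · intro hm2
    have h1 := isKilling_sl_two (K := K)
    have h2 : LieAlgebra.IsKilling K (LieAlgebra.Orthogonal.so (Fin m) K) :=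
      isKilling_so (by simpa using hm2)
    have h3 : LieAlgebra.IsKilling K (LieAlgebra.SpecialLinear.sl (Fin 2) K ×
      LieAlgebra.Orthogonal.so (Fin m) K) := isKilling_prod
    have h4 : LieAlgebra.IsKilling K (symmetryHom hS n h).range := LieAlgebra.isKilling_of_equiv e
    exact LieAlgebra.IsKilling.instSemisimple K _

end Algebra

/-! ### Smooth and holomorphic functions -/

section SmoothInstance

open TopologicalSpace (Opens)

variable {𝕜 : Type*} [RCLike 𝕜] {E E' : Type*} [NormedAddCommGroup E] [NormedSpace 𝕜 E]
  [NormedAddCommGroup E'] [NormedSpace 𝕜 E']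

theorem dirDeriv_apply (U : Opens E) (e : E) (f : smoothFn (𝕜 := 𝕜) U) (p : U) :
    (dirDeriv (𝕜 := 𝕜) U e f : U → 𝕜) p = fderiv 𝕜 (extend (f : U → 𝕜)) p e := rfl

/-- Extension by zero may be replaced by any function that agrees on the open set `U`, since
derivatives are local. -/
theorem dirDeriv_apply_of_eq (U : Opens E) (e : E) (f : smoothFn (𝕜 := 𝕜) U) {g : E → 𝕜}
    (hg : ∀ p : U, (f : U → 𝕜) p = g p) (p : U) :
    (dirDeriv (𝕜 := 𝕜) U e f : U → 𝕜) p = fderiv 𝕜 g p e := by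
  rw [dirDeriv_apply]
  have : extend (f : U → 𝕜) =ᶠ[nhds (p : E)] g := by
    filter_upwards [U.isOpen.mem_nhds p.2] with r hr
    exact (extend_apply _ ⟨r, hr⟩).trans (hg ⟨r, hr⟩)
  rw [this.fderiv_eq]

theorem dirDeriv_comm (U : Opens E) (e e' : E) (f : smoothFn (𝕜 := 𝕜) U) :
    dirDeriv (𝕜 := 𝕜) U e (dirDeriv (𝕜 := 𝕜) U e' f) =
      dirDeriv (𝕜 := 𝕜) U e' (dirDeriv (𝕜 := 𝕜) U e f) := by
  have key : ∀ (e e' : E) (p : U), (dirDeriv (𝕜 := 𝕜) U e (dirDeriv (𝕜 := 𝕜) U e' f) : U → 𝕜) p =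
      fderiv 𝕜 (fderiv 𝕜 (extend (f : U → 𝕜))) p e e' := by
    intro e e' p
    rw [dirDeriv_apply_of_eq U e (dirDeriv (𝕜 := 𝕜) U e' f)
      (g := fun x => fderiv 𝕜 (extend (f : U → 𝕜)) x e') fun p => dirDeriv_apply U e' f p]
    have hd : DifferentiableAt 𝕜 (fderiv 𝕜 (extend (f : U → 𝕜))) p :=
      (((contDiffOn_extend f).fderiv_of_isOpen (m := ∞) U.isOpen (by simp)).contDiffAt
        (U.isOpen.mem_nhds p.2)).differentiableAt (by simp)
    rw [fderiv_clm_apply hd (differentiableAt_const _)]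
    simp
  ext p
  rw [key, key]
  refine ((contDiffOn_extend f).contDiffAt (U.isOpen.mem_nhds p.2)).isSymmSndFDerivAt ?_ e e'
  rw [minSmoothness_of_isRCLikeNormedField]
  exact WithTop.coe_le_coe.2 le_top

theorem dirDeriv_pullback (T : E →L[𝕜] E') (U : Opens E) (V : Opens E') (h : ∀ p ∈ U, T p ∈ V)
    (e : E) (f : smoothFn (𝕜 := 𝕜) V) :
    dirDeriv (𝕜 := 𝕜) U e (pullback T U V h f) =
      pullback T U V h (dirDeriv (𝕜 := 𝕜) V (T e) f) := by
  ext p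
  have hg : ∀ p : U, (pullback T U V h f : U → 𝕜) p = (extend (f : V → 𝕜) ∘ T) p := fun p =>
    (extend_apply (f : V → 𝕜) ⟨T p, h p p.2⟩).symm
  rw [dirDeriv_apply_of_eq U e _ hg]
  have hd : HasFDerivAt (extend (f : V → 𝕜) ∘ T)
      ((fderiv 𝕜 (extend (f : V → 𝕜)) (T p)).comp T) (p : E) :=
    (differentiableAt_extend f ⟨T p, h p p.2⟩).hasFDerivAt.comp (p : E) T.hasFDerivAt
  rw [hd.fderiv]
  rfl

theorem dirDeriv_zero_direction (U : Opens E) (f : smoothFn (𝕜 := 𝕜) U) :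
    dirDeriv (𝕜 := 𝕜) U 0 f = 0 := by
  ext p
  rw [dirDeriv_apply, map_zero]
  rfl

theorem dirDeriv_of_linear (U : Opens E) (e : E) (f : smoothFn (𝕜 := 𝕜) U) (T : E →L[𝕜] 𝕜)
    (hT : ∀ p : U, (f : U → 𝕜) p = T p) : dirDeriv (𝕜 := 𝕜) U e f = algebraMap 𝕜 _ (T e) := by
  ext p
  rw [dirDeriv_apply_of_eq U e f hT, T.fderiv]
  rfl

theorem exists_coordinate (U : Opens 𝕜) :
    ∃ t : smoothFn (𝕜 := 𝕜) U, dirDeriv (𝕜 := 𝕜) U (1 : 𝕜) t = 1 :=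
  ⟨⟨fun p => p, fun p => p, contDiffOn_id, fun _ => rfl⟩, by
    rw [dirDeriv_of_linear U 1 _ (ContinuousLinearMap.id 𝕜 𝕜) fun _ => rfl]
    exact map_one _⟩

theorem regular_smoothCoords (m : ℕ) (Ω : Opens 𝕜) (M : Opens (𝕜 × (Fin m → 𝕜)))
    (hM : ∀ p ∈ M, p.1 ∈ Ω) (hc : IsConnected (M : Set (𝕜 × (Fin m → 𝕜)))) :
    Regular (smoothCoords m Ω M hM) := by
  have hy : ∀ (j : Fin m) (p : M), ((smoothCoords m Ω M hM).y j : M → 𝕜) p =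
      ((ContinuousLinearMap.proj j).comp (ContinuousLinearMap.snd 𝕜 𝕜 (Fin m → 𝕜))) p :=
    fun j p => rfl
  have hdx : ∀ j, (smoothCoords m Ω M hM).dx ((smoothCoords m Ω M hM).y j) = 0 := fun j => by
    refine (dirDeriv_of_linear M _ _ _ (hy j)).trans ?_
    exact map_zero _
  have hdy : ∀ j k, (smoothCoords m Ω M hM).dy j ((smoothCoords m Ω M hM).y k) =
      if j = k then 1 else 0 := fun j k => by
    refine (dirDeriv_of_linear M _ _ _ (hy k)).trans ?_
    change algebraMap 𝕜 _ ((Pi.single j (1 : 𝕜) : Fin m → 𝕜) k) = _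
    rw [Pi.single_apply]
    split_ifs with h1 h2 h2
    · exact map_one _
    · exact absurd h1.symm h2
    · exact absurd h2.symm h1
    · exact map_zero _
  refine ⟨exists_coordinate Ω, fun b => ?_, fun j b => ?_, hdx, hdy, fun j f => ?_,
    fun j k f => ?_, fun j f hf => ?_, fun f hx hyf => ?_, ?_⟩
  · exact dirDeriv_pullback (ContinuousLinearMap.fst 𝕜 𝕜 (Fin m → 𝕜)) M Ω hM (1, 0) b
  · refine (dirDeriv_pullback (ContinuousLinearMap.fst 𝕜 𝕜 (Fin m → 𝕜)) M Ω hM _ b).trans ?_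
    change pullback _ M Ω hM (dirDeriv (𝕜 := 𝕜) Ω 0 b) = 0
    rw [dirDeriv_zero_direction, map_zero]
  · exact dirDeriv_comm M _ _ f
  · exact dirDeriv_comm M _ _ f
  -- Where `y_j ≠ 0` one can divide. Where `y_j = 0`, the derivative `y_j ∂_j f + f = 0` of the
  -- hypothesis shows that `f` vanishes too.
  · have h1 := congrArg ((smoothCoords m Ω M hM).dy j) hf
    rw [Derivation.leibniz, hdy, if_pos rfl, map_zero, smul_eq_mul, smul_eq_mul, mul_one] at h1
    ext p
    have h0 : ((smoothCoords m Ω M hM).y j : M → 𝕜) p * (f : M → 𝕜) p = 0 :=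
      congrFun (congrArg Subtype.val hf) p
    have h2 : ((smoothCoords m Ω M hM).y j : M → 𝕜) p *
        ((smoothCoords m Ω M hM).dy j f : M → 𝕜) p + (f : M → 𝕜) p = 0 :=
      congrFun (congrArg Subtype.val h1) p
    change (f : M → 𝕜) p = 0
    rcases mul_eq_zero.1 h0 with h | h
    · rwa [h, zero_mul, zero_add] at h2
    · exact h
  · have hx' : ∀ p : M, fderiv 𝕜 (extend (f : M → 𝕜)) p (1, 0) = 0 := fun p =>
      congrFun (congrArg Subtype.val hx) p
    have hy' : ∀ (j : Fin m) (p : M), fderiv 𝕜 (extend (f : M → 𝕜)) p (0, Pi.single j 1) = 0 :=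
      fun j p => congrFun (congrArg Subtype.val (hyf j)) p
    -- The coordinate directions span, so the full derivative vanishes; connectedness of `M` then
    -- makes `f` constant.
    have hzero : Set.EqOn (fderiv 𝕜 (extend (f : M → 𝕜))) 0 M := by
      intro p hp
      refine ContinuousLinearMap.ext fun w => ?_
      have hw : w = w.1 • ((1 : 𝕜), (0 : Fin m → 𝕜)) +
          ∑ j, w.2 j • ((0 : 𝕜), (Pi.single j (1 : 𝕜) : Fin m → 𝕜)) := by
        refine Prod.ext ?_ ?_
        · simp [Prod.fst_sum]
        · ext k
          simp [Prod.snd_sum, Pi.single_apply]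
      rw [hw, map_add, map_sum, map_smul, hx' ⟨p, hp⟩]
      simp only [map_smul, hy' _ ⟨p, hp⟩]
      simp
    obtain ⟨a, ha⟩ := M.isOpen.exists_is_const_of_fderiv_eq_zero hc.isPreconnected
      (fun p hp => (differentiableAt_extend f ⟨p, hp⟩).differentiableWithinAt) hzero
    refine ⟨a, ?_⟩
    ext p
    rw [← extend_apply (f : M → 𝕜) p]
    exact ha p p.2
  · obtain ⟨p, hp⟩ := hc.nonempty
    refine ⟨0, 1, fun h => zero_ne_one (α := 𝕜) ?_⟩
    exact congrFun (congrArg Subtype.val h) ⟨p, hp⟩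

theorem map_scalarOp {K B B' : Type*} [Field K] [CommRing B] [Algebra K B] [CommRing B']
    [Algebra K B'] {d : Derivation K B B} {d' : Derivation K B' B'} (ρ : B →ₐ[K] B')
    (hρ : ∀ b, d' (ρ b) = ρ (d b)) (n : ℕ) (A : ℕ → B) (y : B) :
    ρ (scalarOp d n A y) = scalarOp d' n (fun j => ρ (A j)) (ρ y) := by
  have h : ∀ k, ρ (d^[k] y) = d'^[k] (ρ y) := by
    intro k
    induction k with
    | zero => rfl
    | succ k ih => rw [Function.iterate_succ_apply', Function.iterate_succ_apply', ← ih, hρ]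
  simp only [scalarOp, map_add, map_sum, map_mul, h]

/-- Both properties are identities of functions on `Ω`, hence local, and a solution `ξ` on `Ω`
restricts to a solution on each neighbourhood where a change of variables exists. -/
theorem IsCanonicalSmooth.isSymmetricPower {Ω : Opens 𝕜} {n : ℕ}
    {A : ℕ → smoothFn (𝕜 := 𝕜) Ω} {q : smoothFn (𝕜 := 𝕜) Ω} (hn : 2 ≤ n)
    (h : IsCanonicalSmooth Ω n A q) : IsSymmetricPower (dirDeriv (𝕜 := 𝕜) Ω (1 : 𝕜)) n A q := by
  have hloc : ∀ f g : smoothFn (𝕜 := 𝕜) Ω, (∀ (U : Opens 𝕜) (hU : ∀ t ∈ U, t ∈ Ω),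
      IsCanonicalTransform (dirDeriv (𝕜 := 𝕜) U (1 : 𝕜)) n
        (fun j => pullback (ContinuousLinearMap.id 𝕜 𝕜) U Ω hU (A j))
        (pullback (ContinuousLinearMap.id 𝕜 𝕜) U Ω hU q) →
      pullback (ContinuousLinearMap.id 𝕜 𝕜) U Ω hU f =
        pullback (ContinuousLinearMap.id 𝕜 𝕜) U Ω hU g) → f = g := by
    intro f g hfg
    ext p
    obtain ⟨U, hU, hpU, hcan⟩ := h p p.2
    exact congrFun (congrArg Subtype.val (hfg U hU hcan)) ⟨p, hpU⟩
  have hd : ∀ (U : Opens 𝕜) (hU : ∀ t ∈ U, t ∈ Ω) (b : smoothFn (𝕜 := 𝕜) Ω),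
      dirDeriv (𝕜 := 𝕜) U (1 : 𝕜) (pullback (ContinuousLinearMap.id 𝕜 𝕜) U Ω hU b) =
        pullback (ContinuousLinearMap.id 𝕜 𝕜) U Ω hU (dirDeriv (𝕜 := 𝕜) Ω (1 : 𝕜) b) :=
    fun U hU b => dirDeriv_pullback _ U Ω hU 1 b
  constructor
  · refine hloc _ _ fun U hU hcan => ?_
    obtain ⟨t, ht⟩ := exists_coordinate U
    simpa only [map_mul, map_sub, map_add, map_natCast, map_one, map_ofNat] using
      hcan.second_coeff hn ht
  · intro ξ hξ y
    refine hloc _ _ fun U hU hcan => ?_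
    have hξ' := congrArg (pullback (ContinuousLinearMap.id 𝕜 𝕜) U Ω hU) hξ
    simp only [map_mul, map_add, map_ofNat, map_zero, ← hd] at hξ'
    have := hcan.intertwine (by omega) hξ' (pullback (ContinuousLinearMap.id 𝕜 𝕜) U Ω hU y)
    rw [map_scalarOp _ (hd U hU)]
    simp only [map_mul, map_sub, map_add, map_natCast, map_one, map_ofNat, ← hd,
      map_scalarOp _ (hd U hU)]
    exact this

end SmoothInstance

/-! ### Formal power series -/

section FormalInstance

variable {K : Type*} [Field K]

theorem pderiv_comm {σ : Type*} (i j : σ) (f : MvPowerSeries σ K) :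
    MvPowerSeries.pderiv K i (MvPowerSeries.pderiv K j f) =
      MvPowerSeries.pderiv K j (MvPowerSeries.pderiv K i f) := by
  classical
  by_cases h : i = j
  · rw [h]
  · ext x
    simp only [MvPowerSeries.coeff_pderiv, Finsupp.add_apply, Finsupp.single_apply, if_neg h,
      if_neg (Ne.symm h)]
    rw [add_right_comm]
    push_cast
    ring

/-- The inclusion of the variable `x` among the variables `x`, `y_j`. -/
def xEmbedding (m : ℕ) : Unit ↪ Option (Fin m) := ⟨fun _ => none, fun _ _ _ => rfl⟩

theorem coeff_rename_x {m : ℕ} (p : PowerSeries K) (x : Option (Fin m) →₀ ℕ) :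
    MvPowerSeries.coeff x (MvPowerSeries.rename (fun _ : Unit => (none : Option (Fin m))) p) =
      if ∀ j, x (some j) = 0 then PowerSeries.coeff (x none) p else 0 := by
  split_ifs with h
  · have hx : x = Finsupp.embDomain (xEmbedding m) (Finsupp.single () (x none)) := by
      rw [Finsupp.embDomain_single]
      ext a
      rcases a with _ | j
      · exact Finsupp.single_eq_same.symm
      · rw [h j]
        exact (Finsupp.single_eq_of_ne (by simp [xEmbedding])).symm
    conv_lhs => rw [hx]
    exact MvPowerSeries.coeff_embDomain_rename (xEmbedding m) p _
  · refine MvPowerSeries.coeff_rename_eq_zero _ p ?_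
    rintro ⟨y, rfl⟩
    refine h fun j => Finsupp.mapDomain_of_notMem_range _ _ ?_
    rintro ⟨a, ha⟩
    cases ha

theorem regular_formalCoords [CharZero K] {m : ℕ} (c : Fin m → K) :
    Regular (formalCoords c) := by
  classical
  -- Power series over a field form a domain, so for cancellation it is enough that `y_j ≠ 0`; its
  -- derivative is `1`.
  have hy : ∀ j, (formalCoords c).y j ≠ 0 := fun j hj => by
    have := congrArg (MvPowerSeries.pderiv K (some j)) hj
    change MvPowerSeries.pderiv K (some j)
      (MvPowerSeries.C (c j) + MvPowerSeries.X (some j)) = _ at this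
    rw [map_add, MvPowerSeries.pderiv_C, MvPowerSeries.pderiv_X_self, map_zero, zero_add] at this
    exact one_ne_zero this
  refine ⟨⟨PowerSeries.X, PowerSeries.derivative_X⟩, fun b => ?_, fun j b => ?_, fun j => ?_,
    fun j k => ?_, fun j f => pderiv_comm _ _ f, fun j k f => pderiv_comm _ _ f,
    fun j f hf => (mul_eq_zero.1 hf).resolve_left (hy j), fun f hx hyf => ?_, inferInstance⟩
  · change MvPowerSeries.pderiv K none (MvPowerSeries.rename (fun _ : Unit => none) b) =
      MvPowerSeries.rename (fun _ : Unit => none) (PowerSeries.derivative K b)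
    ext x
    rw [MvPowerSeries.coeff_pderiv, coeff_rename_x, coeff_rename_x, PowerSeries.coeff_derivative]
    simp
  · change MvPowerSeries.pderiv K (some j) (MvPowerSeries.rename (fun _ : Unit => none) b) = 0
    ext x
    rw [MvPowerSeries.coeff_pderiv, coeff_rename_x, if_neg, zero_mul, map_zero]
    intro h
    simpa using h j
  · change MvPowerSeries.pderiv K none (MvPowerSeries.C (c j) + MvPowerSeries.X (some j)) = 0
    rw [map_add, MvPowerSeries.pderiv_C, MvPowerSeries.pderiv_X_of_ne (by simp), add_zero]
  · change MvPowerSeries.pderiv K (some j) (MvPowerSeries.C (c k) + MvPowerSeries.X (some k)) = _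
    rw [map_add, MvPowerSeries.pderiv_C, zero_add]
    split_ifs with h
    · rw [h, MvPowerSeries.pderiv_X_self]
    · exact MvPowerSeries.pderiv_X_of_ne fun h' => h (Option.some_injective _ h').symm
  -- In characteristic zero a power series is determined by its partial derivatives and its constant
  -- term.
  · refine ⟨MvPowerSeries.constantCoeff f, MvPowerSeries.pderiv.ext (fun i => ?_) ?_⟩
    · change _ = MvPowerSeries.pderiv K i (MvPowerSeries.C _)
      rw [MvPowerSeries.pderiv_C]
      rcases i with _ | j
      · exact hx
      · exact hyf j
    · exact (MvPowerSeries.constantCoeff_C _).symm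

end FormalInstance

end VarSym

end

/-- Let `m ≥ 1` and let `n ≥ 2` be even. The first part is about smooth functions over `ℝ` or `ℂ`,
on a connected open set `M ⊆ Ω × 𝕜^m`; the second one about formal power series over an arbitrary
field of characteristic zero. -/
theorem theorem3 (m n : ℕ) (hm : 1 ≤ m) (hn : 2 ≤ n) (hn_even : Even n) :
    (∀ (𝕜 : Type*) [RCLike 𝕜] (Ω : TopologicalSpace.Opens 𝕜)
        (M : TopologicalSpace.Opens (𝕜 × (Fin m → 𝕜))) (hM : ∀ p ∈ M, p.1 ∈ Ω)
        (A : ℕ → VarSym.smoothFn (𝕜 := 𝕜) Ω) (q u v : VarSym.smoothFn (𝕜 := 𝕜) Ω),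
        IsConnected (M : Set (𝕜 × (Fin m → 𝕜))) →
        VarSym.IsCanonicalSmooth Ω n A q →
        VarSym.IsNormalizedBasis (VarSym.dirDeriv Ω (1 : 𝕜)) q u v →
        VarSym.VariationalAlgebraDecomposes (VarSym.smoothCoords m Ω M hM) n A u v) ∧
    (∀ (K : Type*) [Field K] [CharZero K] (c : Fin m → K)
        (A : ℕ → PowerSeries K) (q u v : PowerSeries K),
        VarSym.IsCanonicalTransform (PowerSeries.derivative K) n A q →
        VarSym.IsNormalizedBasis (PowerSeries.derivative K) q u v →
        VarSym.VariationalAlgebraDecomposes (VarSym.formalCoords c) n A u v) := by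
  refine ⟨fun 𝕜 _ Ω M hM A q u v hc hcan hb => ?_, fun K _ _ c A q u v hcan hb => ?_⟩
  · exact VarSym.variationalAlgebraDecomposes (VarSym.regular_smoothCoords m Ω M hM hc) hm hn
      (hcan.isSymmetricPower hn) hb
  · exact VarSym.variationalAlgebraDecomposes (VarSym.regular_formalCoords c) hm hn
      (hcan.isSymmetricPower hn PowerSeries.derivative_X) hb
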